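/- Work in one of the following settings: smooth ($C^\infty$) real manifolds and real Lie groups ($\mathbb K=\mathbb R$); real or complex analytic manifolds and Lie groups ($\mathbb K=\mathbb R$ or $\mathbb C$), all finite-dimensional; or non-singular affine varieties and affine algebraic groups over a field $\mathbb K$ of characteristic zero (not necessarily algebraically closed). "Admissible" means smooth, analytic or regular, respectively. Let $G$ be a group with Lie algebra $\mathfrak g$ (left invariant vector fields), let $\bullet$ be a non-degenerate $\mathrm{Ad}$-invariant symmetric bilinear form on $\mathfrak g$, let $\omega,\overline\omega\in\Omega^1(G,\mathfrak g)$ be the left and right invariant Maurer–Cartan forms, and let $\lambda=\tfrac1{12}[\omega,\omega]\bullet\omega\in\Omega^3(G)$. Let $M$ be a manifold with an admissible left $G$-action; for $X\in\mathfrak g$ let $X_M$ be the vector field $X_{M,q}=\tfrac{d}{dt}\big|_{t=0}\exp(-tX)q$. Let $(M,\sigma,\Phi)$ be a $G$-quasi Hamiltonian manifold relative to $\bullet$, that is: $\sigma$ is an admissible $G$-invariant $2$-form on $M$ and $\Phi\colon M\to G$ is an admissible map, equivariant for the conjugation action on $G$, such that 1. $d\sigma=\Phi^*\lambda$; 2.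 $\sigma(X_M,\cdot)=\tfrac12\,\Phi^*\big(X\bullet(\omega+\overline\omega)\big)$ for every $X\in\mathfrak g$; 3. the morphism $v\mapsto(\sigma(v,\cdot),d\Phi(v))$ of vector bundles on $M$ is injective on every fiber. Then for every $G$-invariant admissible function $f\colon M\to\mathbb K$ there is a unique admissible vector field $X_f$ on $M$ with $\sigma(X_f,\cdot)=df$ and $d\Phi(X_f)=0$. Moreover, for $G$-invariant admissible functions $f,h$ one has $X_f(h)=\sigma(X_h,X_f)$, this function is again $G$-invariant and admissible, and $$\{f,h\}=X_f(h)=\sigma(X_h,X_f)$$ defines a Poisson bracket on the algebra $\mathcal A[M]^G$ of $G$-invariant admissible functions on $M$: it is $\mathbb K$-bilinear, skew-symmetric, a derivation in each variable, and satisfies the Jacobi identity. -/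

import Mathlib

open scoped Manifold ContDiff TensorProduct

noncomputable section

namespace QuasiHam

/-! ### Notions common to all settings -/

/-- A `K`-bilinear bracket on a commutative `K`-algebra is a Poisson bracket when it is alternating,
satisfies the Jacobi identity, and is a derivation in each variable (by skew symmetry one variable
suffices). -/
structure IsPoissonBracket {K A : Type*} [Field K] [CommRing A] [Algebra K A]
    (br : A →ₗ[K] A →ₗ[K] A) : Prop where
  alternating : ∀ f, br f f = 0
  leibniz : ∀ f g h, br f (g * h) = br f g * h + g * br f h
  jacobi : ∀ f g h, br (br f g) h + br (br g h) f + br (br h f) g = 0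

/-- The trilinear expression `(1/12) [x, x] • x` evaluated on `(x, y, z)`: with `ω` the identity
`1`-form of `L`, the `2`-form `[ω, ω]` has `[ω, ω](x, y) = 2 [x, y]`, and
`([ω, ω] • ω)(x, y, z) = [ω, ω](x, y) • z + [ω, ω](y, z) • x + [ω, ω](z, x) • y`. -/
def cartanForm (K : Type*) {R L : Type*} [Field K] [CommRing R] [Algebra K R] [AddCommGroup L]
    [Module R L] [Bracket L L] (B : LinearMap.BilinForm R L) (x y z : L) : R :=
  (12 : K)⁻¹ • (B (2 • ⁅x, y⁆) z + B (2 • ⁅y, z⁆) x + B (2 • ⁅z, x⁆) y)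

/-! ### Smooth and analytic manifolds -/

section Manifold

variable {𝕜 : Type*} [RCLike 𝕜]
  {V : Type*} [NormedAddCommGroup V] [NormedSpace 𝕜 V]
  {G : Type*} [TopologicalSpace G] [ChartedSpace V G] [Group G]
  {E : Type*} [NormedAddCommGroup E] [NormedSpace 𝕜 E]
  {M : Type*} [TopologicalSpace M] [ChartedSpace E M]

/-- The left invariant Maurer-Cartan form, `v ↦ q⁻¹ v`. -/
def maurerCartanLeft (q : G) (v : TangentSpace 𝓘(𝕜, V) q) : GroupLieAlgebra 𝓘(𝕜, V) G :=
  (mfderiv 𝓘(𝕜, V) 𝓘(𝕜, V) (fun x : G => q⁻¹ * x) q v : V)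

/-- The right invariant Maurer-Cartan form, `v ↦ v q⁻¹`. -/
def maurerCartanRight (q : G) (v : TangentSpace 𝓘(𝕜, V) q) : GroupLieAlgebra 𝓘(𝕜, V) G :=
  (mfderiv 𝓘(𝕜, V) 𝓘(𝕜, V) (fun x : G => x * q⁻¹) q v : V)

/-- The adjoint action of the group on its Lie algebra. -/
def adjointAction (g : G) (X : GroupLieAlgebra 𝓘(𝕜, V) G) : GroupLieAlgebra 𝓘(𝕜, V) G :=
  (mfderiv 𝓘(𝕜, V) 𝓘(𝕜, V) (fun x : G => g * x * g⁻¹) 1 X : V)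

/-- `Ad`-invariance of a bilinear form on the Lie algebra. -/
def IsAdInvariant (B : LinearMap.BilinForm 𝕜 (GroupLieAlgebra 𝓘(𝕜, V) G)) : Prop :=
  ∀ (g : G) (X Y : GroupLieAlgebra 𝓘(𝕜, V) G), B (adjointAction g X) (adjointAction g Y) = B X Y

/-- The fundamental vector field `X_M`, with value `d/dt exp (-t X) q` at `t = 0`. -/
def fundamentalField [MulAction G M] (X : GroupLieAlgebra 𝓘(𝕜, V) G) (q : M) :
    TangentSpace 𝓘(𝕜, E) q :=
  (-(mfderiv 𝓘(𝕜, V) 𝓘(𝕜, E) (fun g : G => g • q) 1 X : E) : E)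

/-- The derivative at `q`, in the direction `v`, of a scalar function. -/
def dirDeriv (f : M → 𝕜) (q : M) (v : TangentSpace 𝓘(𝕜, E) q) : 𝕜 :=
  (mfderiv 𝓘(𝕜, E) 𝓘(𝕜, 𝕜) f q v : 𝕜)

/-- The value at `q` of the exterior derivative of the `2`-form `σ` on `(u q, v q, w q)`, for vector
fields `u`, `v`, `w` that are defined near `q`. -/
def extDerivTwoForm
    (σ : ∀ q : M, TangentSpace 𝓘(𝕜, E) q →L[𝕜] TangentSpace 𝓘(𝕜, E) q →L[𝕜] 𝕜)
    (u v w : ∀ q : M, TangentSpace 𝓘(𝕜, E) q) (q : M) : 𝕜 :=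
  dirDeriv (fun x => σ x (v x) (w x)) q (u q)
    - dirDeriv (fun x => σ x (u x) (w x)) q (v q)
    + dirDeriv (fun x => σ x (u x) (v x)) q (w q)
    - σ q (VectorField.mlieBracket 𝓘(𝕜, E) u v q) (w q)
    + σ q (VectorField.mlieBracket 𝓘(𝕜, E) u w q) (v q)
    - σ q (VectorField.mlieBracket 𝓘(𝕜, E) v w q) (u q)

/-- A `G`-quasi Hamiltonian structure of class `n` on the `G`-manifold `M`, relative to the bilinear
form `B` on the Lie algebra of `G`. -/
structure QuasiHamiltonian (n : ℕ∞ω) [IsManifold 𝓘(𝕜, E) 1 M] [MulAction G M]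
    (B : LinearMap.BilinForm 𝕜 (GroupLieAlgebra 𝓘(𝕜, V) G)) where
  /-- the `2`-form -/
  σ : ∀ q : M, TangentSpace 𝓘(𝕜, E) q →L[𝕜] TangentSpace 𝓘(𝕜, E) q →L[𝕜] 𝕜
  /-- the momentum mapping -/
  Φ : M → G
  contMDiff_σ : ContMDiff 𝓘(𝕜, E) (𝓘(𝕜, E).prod 𝓘(𝕜, E →L[𝕜] E →L[𝕜] 𝕜)) n
    (fun q : M => Bundle.TotalSpace.mk' (E →L[𝕜] E →L[𝕜] 𝕜)
      (E := fun q : M => TangentSpace 𝓘(𝕜, E) q →L[𝕜] TangentSpace 𝓘(𝕜, E) q →L[𝕜] 𝕜) q (σ q))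
  alternating : ∀ (q : M) (v : TangentSpace 𝓘(𝕜, E) q), σ q v v = 0
  invariant : ∀ (g : G) (q : M) (v w : TangentSpace 𝓘(𝕜, E) q),
    σ (g • q) (mfderiv 𝓘(𝕜, E) 𝓘(𝕜, E) (fun x : M => g • x) q v)
      (mfderiv 𝓘(𝕜, E) 𝓘(𝕜, E) (fun x : M => g • x) q w) = σ q v w
  contMDiff_Φ : ContMDiff 𝓘(𝕜, E) 𝓘(𝕜, V) n Φ
  /-- `Φ` is equivariant, `G` acting on itself by conjugation -/
  equivariant : ∀ (g : G) (q : M), Φ (g • q) = g * Φ q * g⁻¹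
  /-- `dσ = Φ^* λ`, where `λ = (1/12) [ω, ω] • ω`; tested on all local vector fields -/
  quasiClosed : ∀ (q : M) (u v w : ∀ x : M, TangentSpace 𝓘(𝕜, E) x),
    ContMDiffAt 𝓘(𝕜, E) 𝓘(𝕜, E).tangent n
      (fun x => (⟨x, u x⟩ : TangentBundle 𝓘(𝕜, E) M)) q →
    ContMDiffAt 𝓘(𝕜, E) 𝓘(𝕜, E).tangent n
      (fun x => (⟨x, v x⟩ : TangentBundle 𝓘(𝕜, E) M)) q →
    ContMDiffAt 𝓘(𝕜, E) 𝓘(𝕜, E).tangent n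
      (fun x => (⟨x, w x⟩ : TangentBundle 𝓘(𝕜, E) M)) q →
    extDerivTwoForm σ u v w q = cartanForm 𝕜 B
      (maurerCartanLeft (Φ q) (mfderiv 𝓘(𝕜, E) 𝓘(𝕜, V) Φ q (u q)))
      (maurerCartanLeft (Φ q) (mfderiv 𝓘(𝕜, E) 𝓘(𝕜, V) Φ q (v q)))
      (maurerCartanLeft (Φ q) (mfderiv 𝓘(𝕜, E) 𝓘(𝕜, V) Φ q (w q)))
  /-- the momentum property -/
  momentum : ∀ (X : GroupLieAlgebra 𝓘(𝕜, V) G) (q : M) (v : TangentSpace 𝓘(𝕜, E) q),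
    σ q (fundamentalField X q) v = (2 : 𝕜)⁻¹ *
      B X (maurerCartanLeft (Φ q) (mfderiv 𝓘(𝕜, E) 𝓘(𝕜, V) Φ q v)
        + maurerCartanRight (Φ q) (mfderiv 𝓘(𝕜, E) 𝓘(𝕜, V) Φ q v))
  /-- `Φ`-non-degeneracy: `v ↦ (σ(v, ·), dΦ v)` is injective on each tangent space -/
  nondegenerate : ∀ (q : M) (v : TangentSpace 𝓘(𝕜, E) q),
    (∀ w, σ q v w = 0) → mfderiv 𝓘(𝕜, E) 𝓘(𝕜, V) Φ q v = 0 → v = 0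

/-- `X` is a vector field of class `n` with `σ(X, ·) = df` and `dΦ(X) = 0`. -/
structure QuasiHamiltonian.IsHamiltonianField {n : ℕ∞ω} [IsManifold 𝓘(𝕜, E) 1 M] [MulAction G M]
    {B : LinearMap.BilinForm 𝕜 (GroupLieAlgebra 𝓘(𝕜, V) G)}
    (S : QuasiHamiltonian (E := E) (M := M) n B) (f : M → 𝕜)
    (X : ∀ q : M, TangentSpace 𝓘(𝕜, E) q) : Prop where
  contMDiff : ContMDiff 𝓘(𝕜, E) 𝓘(𝕜, E).tangent n
    (fun q => (⟨q, X q⟩ : TangentBundle 𝓘(𝕜, E) M))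
  flat_eq : ∀ (q : M) (v : TangentSpace 𝓘(𝕜, E) q), S.σ q (X q) v = dirDeriv f q v
  map_eq_zero : ∀ q : M, mfderiv 𝓘(𝕜, E) 𝓘(𝕜, V) S.Φ q (X q) = 0

/-- The algebra of `G`-invariant functions of class `n`. -/
def invariantFunctions (𝕜 E G M : Type*) [RCLike 𝕜] [NormedAddCommGroup E] [NormedSpace 𝕜 E]
    [Group G] [TopologicalSpace M] [ChartedSpace E M] [MulAction G M] (n : ℕ∞ω) :
    Subalgebra 𝕜 C^n⟮𝓘(𝕜, E), M; 𝕜⟯ where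
  carrier := {f | ∀ (g : G) (q : M), f (g • q) = f q}
  mul_mem' := fun {a b} ha hb g q => by
    simp only [ContMDiffMap.coe_mul, Pi.mul_apply, ha g q, hb g q]
  add_mem' := fun {a b} ha hb g q => by
    simp only [ContMDiffMap.coe_add, Pi.add_apply, ha g q, hb g q]
  algebraMap_mem' := fun _ _ _ => rfl

end Manifold

/-! ### Affine algebraic manifolds

The group is given by its coordinate ring `H`, a commutative Hopf algebra, and the manifold by its
coordinate ring `A`. A morphism of varieties is a homomorphism of coordinate rings in the opposite
direction, a vector field is a derivation, and a vector field along a morphism with comorphism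
`φ : H → A` is a derivation `H → A`, with `A` an `H`-module through `φ`. Such derivations are
expanded in terms of elements of `A ⊗ W`, for a space `W` of vector fields, by means of the maps
`a ⊗ X ↦ a • (φ ∘ X)` below. -/

section Algebraic

variable {K : Type*} [Field K] {H : Type*} [CommRing H] [HopfAlgebra K H]
  {A : Type*} [CommRing A] [Algebra K A]

/-- The Lie algebra of the group: the left invariant derivations of its coordinate ring. -/
def leftInvariant (K H : Type*) [Field K] [CommRing H] [HopfAlgebra K H] :
    LieSubalgebra K (Derivation K H H) where
  carrier := {D | ∀ h, CoalgebraStruct.comul (R := K) (D h)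
    = (D : H →ₗ[K] H).lTensor H (CoalgebraStruct.comul (R := K) h)}
  add_mem' := fun {a b} ha hb h => by
    simp only [Set.mem_ofPred_eq] at ha hb
    simp [ha, hb, LinearMap.lTensor_add]
  zero_mem' := fun h => by simp
  smul_mem' := fun c D hD h => by
    simp only [Set.mem_ofPred_eq] at hD
    simp [hD, LinearMap.lTensor_smul]
  lie_mem' := fun {a b} ha hb h => by
    simp only [Set.mem_ofPred_eq] at ha hb
    have h1 : ∀ (D D' : Derivation K H H) (_ : ∀ h, CoalgebraStruct.comul (R := K) (D h)
        = (D : H →ₗ[K] H).lTensor H (CoalgebraStruct.comul (R := K) h))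
        (_ : ∀ h, CoalgebraStruct.comul (R := K) (D' h)
        = (D' : H →ₗ[K] H).lTensor H (CoalgebraStruct.comul (R := K) h)),
        CoalgebraStruct.comul (R := K) (D (D' h)) =
          ((D : H →ₗ[K] H) ∘ₗ (D' : H →ₗ[K] H)).lTensor H (CoalgebraStruct.comul (R := K) h) := by
      intro D D' hD hD'
      rw [hD, hD', ← LinearMap.comp_apply, LinearMap.lTensor_comp]
    have h2 : ((⁅a, b⁆ : Derivation K H H) : H →ₗ[K] H)
        = (a : H →ₗ[K] H) ∘ₗ (b : H →ₗ[K] H) - (b : H →ₗ[K] H) ∘ₗ (a : H →ₗ[K] H) := by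
      rw [Derivation.commutator_coe_linear_map]; rfl
    rw [h2, LinearMap.lTensor_sub, LinearMap.sub_apply, ← h1 a b ha hb, ← h1 b a hb ha,
      Derivation.commutator_apply, map_sub]

/-- The tangent vector at the identity element of a left invariant vector field, a linear functional
on the coordinate ring. -/
def atOne : leftInvariant K H →ₗ[K] (H →ₗ[K] K) where
  toFun X := CoalgebraStruct.counit ∘ₗ ((X : Derivation K H H) : H →ₗ[K] H)
  map_add' X Y := by ext; simp
  map_smul' c X := by ext; simp

/-- The vector field `X^R`, with `(X^R h)(q) = d/dt h(exp (t X) q)` at `t = 0`. -/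
def rightField : leftInvariant K H →ₗ[K] (H →ₗ[K] H) where
  toFun X := (TensorProduct.lid K H).toLinearMap ∘ₗ (atOne X).rTensor H ∘ₗ CoalgebraStruct.comul
  map_add' X Y := by ext; simp [LinearMap.rTensor_add]
  map_smul' c X := by ext; simp [LinearMap.rTensor_smul]

/-- Left translation `L_Φ`, from functions on `M` with values in the Lie algebra to vector fields
along `Φ`: `a ⊗ X ↦ a • (φ ∘ X)`. (It is bijective onto the derivations `H → A` along `φ`.) -/
def leftTranslation (φ : H →ₐ[K] A) : A ⊗[K] leftInvariant K H →ₗ[A] (H →ₗ[K] A) :=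
  LinearMap.liftBaseChange A
    { toFun := fun X => φ.toLinearMap ∘ₗ ((X : Derivation K H H) : H →ₗ[K] H)
      map_add' := fun X Y => by ext; simp
      map_smul' := fun c X => by ext; simp }

/-- Right translation `R_Φ`: `a ⊗ X ↦ a • (φ ∘ X^R)`. (It is bijective onto the derivations `H → A`
along `φ`.) -/
def rightTranslation (φ : H →ₐ[K] A) : A ⊗[K] leftInvariant K H →ₗ[A] (H →ₗ[K] A) :=
  LinearMap.liftBaseChange A (LinearMap.llcomp K H H A φ.toLinearMap ∘ₗ rightField)

variable (K H) in
/-- The comorphism `h ↦ h₁ S(h₃) ⊗ h₂` of the conjugation action `(g, q) ↦ g q g⁻¹`. -/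
def conjCoaction : H →ₗ[K] H ⊗[K] H :=
  (LinearMap.mul' K H).rTensor H ∘ₗ (TensorProduct.assoc K H H H).symm.toLinearMap ∘ₗ
    ((TensorProduct.comm K H H).toLinearMap ∘ₗ (HopfAlgebra.antipode K).lTensor H ∘ₗ
      CoalgebraStruct.comul).lTensor H ∘ₗ CoalgebraStruct.comul

/-- The function `s` on the group with values in the Lie algebra is `g ↦ Ad_g X`; tangent vectors at
the identity element are compared as functionals on the coordinate ring. -/
def IsAdjoint (X : leftInvariant K H) (s : H ⊗[K] leftInvariant K H) : Prop :=
  ∀ h : H, LinearMap.liftBaseChange H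
      (LinearMap.llcomp K H K H (Algebra.linearMap K H) ∘ₗ atOne) s h
    = TensorProduct.rid K H ((atOne X).lTensor H (conjCoaction K H h))

/-- `Ad`-invariance of a bilinear form on the Lie algebra: the function
`g ↦ B (Ad_g X) (Ad_g Y)` is constant with value `B X Y`. -/
def IsAdInvariantAlg (B : LinearMap.BilinForm K (leftInvariant K H)) : Prop :=
  ∀ (X Y : leftInvariant K H) (s t : H ⊗[K] leftInvariant K H), IsAdjoint X s → IsAdjoint Y t →
    B.baseChange H s t = algebraMap K H (B X Y)

/-- A left action of the affine group with coordinate ring `H` on the affine variety with coordinate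
ring `A`, given by its comorphism, `f ↦ ((g, q) ↦ f (g q))`. -/
structure GroupAction (K H A : Type*) [Field K] [CommRing H] [HopfAlgebra K H] [CommRing A]
    [Algebra K A] where
  /-- the comorphism -/
  ρ : A →ₐ[K] H ⊗[K] A
  coassoc : ∀ a, TensorProduct.assoc K H H A
    ((CoalgebraStruct.comul (R := K) (A := H)).rTensor A (ρ a)) = ρ.toLinearMap.lTensor H (ρ a)
  counit : ∀ a, TensorProduct.lid K A
    ((CoalgebraStruct.counit (R := K) (A := H)).rTensor A (ρ a)) = a

/-- The algebra of invariant functions: those `f` with `f (g q) = f q` identically in `(g, q)`. -/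
def GroupAction.invariants (act : GroupAction K H A) : Subalgebra K A :=
  AlgHom.equalizer act.ρ Algebra.TensorProduct.includeRight

lemma atOne_mul (X : leftInvariant K H) (x y : H) : atOne X (x * y)
    = CoalgebraStruct.counit x * atOne X y + CoalgebraStruct.counit y * atOne X x := by
  simp [atOne]

lemma lid_rTensor_mul (X : leftInvariant K H) (s t : H ⊗[K] A) :
    TensorProduct.lid K A ((atOne X).rTensor A (s * t))
      = TensorProduct.lid K A ((CoalgebraStruct.counit (R := K) (A := H)).rTensor A s)
          * TensorProduct.lid K A ((atOne X).rTensor A t)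
        + TensorProduct.lid K A ((CoalgebraStruct.counit (R := K) (A := H)).rTensor A t)
          * TensorProduct.lid K A ((atOne X).rTensor A s) := by
  induction s with
  | zero => simp
  | add s₁ s₂ h₁ h₂ => simp only [add_mul, map_add, h₁, h₂]; ring
  | tmul x a =>
    induction t with
    | zero => simp
    | add t₁ t₂ h₁ h₂ => simp only [mul_add, map_add, h₁, h₂]; ring
    | tmul y b =>
      simp only [Algebra.TensorProduct.tmul_mul_tmul, LinearMap.rTensor_tmul,
        TensorProduct.lid_tmul, atOne_mul, add_smul, smul_mul_smul_comm, mul_comm b a]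

/-- The fundamental vector field `X_M`, with `(X_M f)(q) = d/dt f(exp (-t X) q)` at `t = 0`. -/
def GroupAction.fundamentalField (act : GroupAction K H A) (X : leftInvariant K H) :
    Derivation K A A :=
  -Derivation.mk' ((TensorProduct.lid K A).toLinearMap ∘ₗ (atOne X).rTensor A ∘ₗ
      act.ρ.toLinearMap) (fun a b => by
    simp [lid_rTensor_mul, act.counit])

/-- Expansion of vector fields along a morphism with comorphism `φ`: `b ⊗ v ↦ b • (φ ∘ v)`. (For
smooth `A` its image consists of all derivations `A → C` along `φ`.) -/
def expandAlong {C : Type*} [CommRing C] [Algebra K C] (φ : A →ₐ[K] C) :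
    C ⊗[K] Derivation K A A →ₗ[C] (A →ₗ[K] C) :=
  LinearMap.liftBaseChange C
    { toFun := fun v => φ.toLinearMap ∘ₗ (v : A →ₗ[K] A)
      map_add' := fun v w => by ext; simp
      map_smul' := fun c v => by ext; simp }

/-- The evaluation of a `2`-form on vector fields along a morphism with comorphism `φ`, in terms of
their expansions: `(b ⊗ v, c ⊗ w) ↦ b * c * φ (σ(v, w))`. -/
def evalAlong {C : Type*} [CommRing C] [Algebra K C] (φ : A →ₐ[K] C)
    (σ : LinearMap.BilinForm A (Derivation K A A)) (s t : C ⊗[K] Derivation K A A) : C :=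
  LinearMap.liftBaseChange C φ.toLinearMap
    (LinearMap.BilinMap.baseChange C (LinearMap.restrictScalars₁₂ K K σ) s t)

/-- Invariance of a `2`-form: `σ_{gq}(g v, g w) = σ_q(v, w)` identically in `(g, q)`. The vector
field `(g, q) ↦ g v_q` along the action map is `(id ⊗ v) ∘ ρ`. -/
def GroupAction.IsInvariantForm (act : GroupAction K H A)
    (σ : LinearMap.BilinForm A (Derivation K A A)) : Prop :=
  ∀ (v w : Derivation K A A) (s t : (H ⊗[K] A) ⊗[K] Derivation K A A),
    expandAlong act.ρ s = (v : A →ₗ[K] A).lTensor H ∘ₗ act.ρ.toLinearMap →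
    expandAlong act.ρ t = (w : A →ₗ[K] A).lTensor H ∘ₗ act.ρ.toLinearMap →
    evalAlong act.ρ σ s t = (1 : H) ⊗ₜ[K] σ v w

/-- The exterior derivative of a `2`-form, evaluated on vector fields. -/
def extDerivTwoFormAlg (σ : LinearMap.BilinForm A (Derivation K A A))
    (u v w : Derivation K A A) : A :=
  u (σ v w) - v (σ u w) + w (σ u v) - σ ⁅u, v⁆ w + σ ⁅u, w⁆ v - σ ⁅v, w⁆ u

/-- The derivative `dΦ` of the morphism with comorphism `φ`, from vector fields to vector fields
along the morphism: `v ↦ v ∘ φ`. -/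
def tangentMap (φ : H →ₐ[K] A) (v : Derivation K A A) : H →ₗ[K] A :=
  (v : A →ₗ[K] A) ∘ₗ φ.toLinearMap

/-- A `G`-quasi Hamiltonian structure on the affine algebraic `G`-manifold with coordinate ring `A`,
relative to the bilinear form `B` on the Lie algebra of `G`. -/
structure QuasiHamiltonianAlg (act : GroupAction K H A)
    (B : LinearMap.BilinForm K (leftInvariant K H)) where
  /-- the `2`-form -/
  σ : LinearMap.BilinForm A (Derivation K A A)
  /-- the comorphism of the momentum mapping `Φ` -/
  φ : H →ₐ[K] A
  alternating : ∀ v, σ v v = 0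
  invariant : act.IsInvariantForm σ
  /-- `Φ` is equivariant, `G` acting on itself by conjugation -/
  equivariant : ∀ h, act.ρ (φ h) = φ.toLinearMap.lTensor H (conjCoaction K H h)
  /-- `dσ = Φ^* λ`, where `λ = (1/12) [ω, ω] • ω`, and `ω ∘ dΦ = L_Φ⁻¹ ∘ dΦ` -/
  quasiClosed : ∀ (u v w : Derivation K A A) (x y z : A ⊗[K] leftInvariant K H),
    leftTranslation φ x = tangentMap φ u → leftTranslation φ y = tangentMap φ v →
    leftTranslation φ z = tangentMap φ w →
    extDerivTwoFormAlg σ u v w = cartanForm K (B.baseChange A) x y z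
  /-- the momentum property `σ(X_M, v) = (1/2) X • ((L_Φ⁻¹ + R_Φ⁻¹) (dΦ v))` -/
  momentum : ∀ (X : leftInvariant K H) (v : Derivation K A A) (x y : A ⊗[K] leftInvariant K H),
    leftTranslation φ x = tangentMap φ v → rightTranslation φ y = tangentMap φ v →
    σ (act.fundamentalField X) v = (2 : K)⁻¹ • B.baseChange A (1 ⊗ₜ[K] X) (x + y)
  /-- `Φ`-non-degeneracy: the morphism `v ↦ (σ(v, ·), dΦ v)` of vector bundles is injective on the
  fiber at each closed point `m`. A section of one of these bundles vanishes at `m` when its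
  values lie in `m`. -/
  nondegenerate : ∀ (m : Ideal A), m.IsMaximal → ∀ v : Derivation K A A,
    (∀ w, σ v w ∈ m) → (∀ h, tangentMap φ v h ∈ m) → ∀ a, v a ∈ m

/-- `X` is a vector field with `σ(X, ·) = df` and `dΦ(X) = 0`. -/
structure QuasiHamiltonianAlg.IsHamiltonianField {act : GroupAction K H A}
    {B : LinearMap.BilinForm K (leftInvariant K H)} (S : QuasiHamiltonianAlg act B) (f : A)
    (X : Derivation K A A) : Prop where
  flat_eq : ∀ v : Derivation K A A, S.σ X v = v f
  map_eq_zero : tangentMap S.φ X = 0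

end Algebraic

end QuasiHam

end

/-! ### Linear algebra shared by all settings -/

namespace QuasiHam

/-! Put a = ω ∘ dΦ, with values in 𝔤, and let Ad be the adjoint action of Φ. Non-degeneracy says
that v ↦ (σ(v, ·), a v) is injective. Dually, every covector, and df in particular, has the form
σ(w, ·) + x • a(·) with w a tangent vector and x in 𝔤. The second term must be absorbed into the
first. Invariance of f says that df kills every y_M. The momentum property computes σ(y_M, ·), and
equivariance gives a(y_M) = y − Ad⁻¹ y. Together they turn df(y_M) = 0 into Ad(x + ½ a w) = x − ½ a
w. If z denotes this common value, then σ(z_M, ·) = x • a(·) and a(z_M) = −a w, so X_f = w + z_M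
solves both equations. This is `exists_flat_eq_of_expansion`. Uniqueness is non-degeneracy once
more.

The field X_f is G-invariant because its translates solve the same equations, so X_f(h) is invariant
when h is. All Hamiltonian fields are killed by dΦ, hence Φ^*λ vanishes on them, and the Jacobi
identity follows from dσ(X_f, X_g, X_h) = 0 as in symplectic geometry.

What remains is admissibility. On a manifold X_f is found point by point, and Cramer's rule in a
local frame shows that it has the right class (`contMDiffAt_of_sum_smul_eq`,
`contMDiff_of_isHamiltonian`). On an affine variety everything is done over the coordinate ring A.
The expansion of df comes from a maximal submodule argument in Ω[A⁄K] (`exists_expansion`). The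
identities about Φ are computed in the convolution algebra of linear maps H → A, where left and
right translation of a tangent vector ξ at the identity are φ * ξ and ξ * φ. Invariance of X_f
becomes an identity of derivations A → H ⊗ A (`translate_eq`). -/

theorem exists_flat_eq_of_expansion {R D L : Type*} [CommRing R] [AddCommGroup D] [Module R D]
    [AddCommGroup L] [Module R L] {c : R} (hc : 2 * c = 1) (σ : LinearMap.BilinForm R D)
    (hσ : ∀ v, σ v v = 0) (B : LinearMap.BilinForm R L) (hB : ∀ x y, B x y = B y x)
    (hB0 : ∀ x, (∀ y, B y x = 0) → x = 0) (a : D →ₗ[R] L) (Ad Ad' : L →ₗ[R] L)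
    (hAd : ∀ x, Ad (Ad' x) = x) (hAd' : ∀ x, Ad' (Ad x) = x)
    (hiso : ∀ x y, B (Ad x) (Ad y) = B x y) (ι : L →ₗ[R] D)
    (hι : ∀ x v, σ (ι x) v = c * B x (a v + Ad (a v))) (haι : ∀ x, a (ι x) = x - Ad' x)
    (α : D →ₗ[R] R) (hα : ∀ x, α (ι x) = 0) (w : D) (x : L)
    (hw : ∀ v, α v = σ w v + B x (a v)) : ∃ v, (∀ u, σ v u = α u) ∧ a v = 0 := by
  have hskew : ∀ v u, σ v u = -σ u v := fun v u => by
    have h := hσ (v + u)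
    simp only [map_add, LinearMap.add_apply, hσ, zero_add, add_zero] at h
    exact eq_neg_of_add_eq_zero_right h
  -- This is α (ι y) = 0, written out with the expansion of α and paired with an arbitrary y;
  -- non-degeneracy of B removes y.
  have key : x - Ad x = c • (a w + Ad (a w)) := by
    rw [← sub_eq_zero]
    refine hB0 _ fun y => ?_
    have h1 := hw (ι y)
    have h2 : B x (Ad' y) = B y (Ad x) := by rw [← hiso, hAd, hB]
    rw [hα, haι, hskew, hι, map_sub, h2, hB x y] at h1
    simp only [map_sub, map_smul, smul_eq_mul]
    linear_combination -h1
  have hc2 : ∀ z : L, c • z + c • z = z := fun z => by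
    rw [← add_smul, ← two_mul, hc, one_smul]
  have hz : Ad (x + c • a w) = x - c • a w := by
    rw [map_add, map_smul]
    rw [smul_add, sub_eq_iff_eq_add] at key
    nth_rewrite 2 [key]
    abel
  have hz' : Ad' (x - c • a w) = x + c • a w := by rw [← hz, hAd']
  -- The correction z = x - c • a w equals Ad (x + c • a w) by `hz`. In σ (ι z) the two halves
  -- therefore add up to B x ∘ a, and a (ι z) = z - Ad' z = -a w.
  refine ⟨w + ι (x - c • a w), fun u => ?_, ?_⟩
  · have h3 : B (x - c • a w) (Ad (a u)) = B (x + c • a w) (a u) := by rw [← hz, hiso]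
    rw [map_add, LinearMap.add_apply, hι, map_add, h3, hw]
    simp only [map_sub, map_add, LinearMap.sub_apply, LinearMap.add_apply]
    linear_combination B x (a u) * hc
  · rw [map_add, haι, hz']
    nth_rewrite 1 [← hc2 (a w)]
    abel

end QuasiHam

/-! ### Derivations along a morphism, and convolution -/

namespace QuasiHam

open WithConv

section Derivations

variable {K : Type*} [Field K] {A : Type*} [CommRing A] [Algebra K A] {C : Type*} [CommRing C]
  [Algebra K C]

/-- The linear map `δ` is a derivation along the algebra homomorphism `ψ`. -/
def IsDerivAlong (ψ : A →ₐ[K] C) (δ : A →ₗ[K] C) : Prop :=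
  ∀ x y, δ (x * y) = ψ x * δ y + ψ y * δ x

namespace IsDerivAlong

variable {ψ : A →ₐ[K] C} {δ δ' : A →ₗ[K] C}

theorem sub (h : IsDerivAlong ψ δ) (h' : IsDerivAlong ψ δ') : IsDerivAlong ψ (δ - δ') := by
  intro x y
  simp only [LinearMap.sub_apply, h x y, h' x y]
  ring

theorem algHom_comp {C' : Type*} [CommRing C'] [Algebra K C'] (h : IsDerivAlong ψ δ)
    (f : C →ₐ[K] C') : IsDerivAlong (f.comp ψ) (f.toLinearMap ∘ₗ δ) := by
  intro x y
  simp [h x y]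

theorem comp_algHom {A' : Type*} [CommRing A'] [Algebra K A'] (h : IsDerivAlong ψ δ)
    (f : A' →ₐ[K] A) : IsDerivAlong (ψ.comp f) (δ ∘ₗ f.toLinearMap) := by
  intro x y
  simp [h (f x) (f y)]

theorem map_one (h : IsDerivAlong ψ δ) : δ 1 = 0 := by
  have := h 1 1
  simpa using this

theorem map_algebraMap (h : IsDerivAlong ψ δ) (k : K) : δ (algebraMap K A k) = 0 := by
  rw [Algebra.algebraMap_eq_smul_one, map_smul, h.map_one, smul_zero]

end IsDerivAlong

theorem isDerivAlong_id (v : Derivation K A A) : IsDerivAlong (AlgHom.id K A) (v : A →ₗ[K] A) := by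
  intro x y
  simp

theorem tmul_mem_of_isDerivAlong {A' C' : Type*} [CommRing A'] [Algebra K A'] [CommRing C']
    [Algebra K C'] {ψ : A →ₐ[K] C} {δ : A →ₗ[K] C} (h : IsDerivAlong ψ δ) (χ : A' →ₐ[K] C') :
    IsDerivAlong (Algebra.TensorProduct.map ψ χ) (TensorProduct.map δ χ.toLinearMap) := by
  intro s t
  induction s with
  | zero => simp
  | add s₁ s₂ h₁ h₂ => simp only [add_mul, map_add, h₁, h₂, mul_add]; ring
  | tmul x a =>
    induction t with
    | zero => simp
    | add t₁ t₂ h₁ h₂ => simp only [mul_add, map_add, h₁, h₂, add_mul]; ring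
    | tmul y b => simp [h x y, TensorProduct.add_tmul, mul_comm (χ b)]

theorem tmul_mem_of_isDerivAlong' {A' C' : Type*} [CommRing A'] [Algebra K A'] [CommRing C']
    [Algebra K C'] {ψ : A →ₐ[K] C} {δ : A →ₗ[K] C} (h : IsDerivAlong ψ δ) (χ : A' →ₐ[K] C') :
    IsDerivAlong (Algebra.TensorProduct.map χ ψ) (TensorProduct.map χ.toLinearMap δ) := by
  intro s t
  induction s with
  | zero => simp
  | add s₁ s₂ h₁ h₂ => simp only [add_mul, map_add, h₁, h₂, mul_add]; ring
  | tmul a x =>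
    induction t with
    | zero => simp
    | add t₁ t₂ h₁ h₂ => simp only [mul_add, map_add, h₁, h₂, add_mul]; ring
    | tmul b y => simp [h x y, TensorProduct.tmul_add, mul_comm (χ b)]

/-- Convolution is the group law on A-valued points: a tangent vector at the point ψ, translated on
the right by χ, is tangent at the product. -/
theorem IsDerivAlong.convMul {H : Type*} [CommRing H] [Bialgebra K H] {ψ : H →ₐ[K] A}
    {δ : H →ₗ[K] A} (h : IsDerivAlong ψ δ) (χ : H →ₐ[K] A) :
    IsDerivAlong (toConv ψ * toConv χ).ofConv (toConv δ * toConv χ.toLinearMap).ofConv :=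
  ((tmul_mem_of_isDerivAlong h χ).algHom_comp (Algebra.TensorProduct.lmul' K)).comp_algHom
    (Bialgebra.comulAlgHom K H)

theorem IsDerivAlong.convMul_left {H : Type*} [CommRing H] [Bialgebra K H] {ψ : H →ₐ[K] A}
    {δ : H →ₗ[K] A} (h : IsDerivAlong ψ δ) (χ : H →ₐ[K] A) :
    IsDerivAlong (toConv χ * toConv ψ).ofConv (toConv χ.toLinearMap * toConv δ).ofConv :=
  ((tmul_mem_of_isDerivAlong' h χ).algHom_comp (Algebra.TensorProduct.lmul' K)).comp_algHom
    (Bialgebra.comulAlgHom K H)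

/-- A finite subfamily already spans, and a section of the resulting surjection from a free module
supplies the coordinate functionals. -/
theorem exists_dual_family {R P ι : Type*} [CommRing R] [AddCommGroup P] [Module R P]
    [Module.Finite R P] [Module.Projective R P] (f : ι → P)
    (hf : Submodule.span R (Set.range f) = ⊤) :
    ∃ (n : ℕ) (a : Fin n → ι) (d : Fin n → P →ₗ[R] R), ∀ x, x = ∑ i, d i x • f (a i) := by
  have hfg : (Submodule.span R (Set.range f)).FG := hf ▸ Module.Finite.fg_top
  obtain ⟨s, hs, hsp⟩ := (Submodule.fg_span_iff_fg_span_finset_subset _).1 hfg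
  choose b hb using fun x : s => hs x.2
  let e := s.equivFin.symm
  let p : (Fin s.card → R) →ₗ[R] P := Fintype.linearCombination R fun i => f (b (e i))
  have hp : Function.Surjective p := by
    rw [← LinearMap.range_eq_top, Fintype.range_linearCombination, ← hf, hsp]
    congr 1
    ext x
    simp only [hb, Set.mem_range, SetLike.mem_coe]
    exact ⟨fun ⟨i, hi⟩ => hi ▸ (e i).2, fun hx => ⟨e.symm ⟨x, hx⟩, by simp⟩⟩
  obtain ⟨q, hq⟩ := Module.projective_lifting_property p LinearMap.id hp
  refine ⟨s.card, fun i => b (e i), fun i => (LinearMap.proj i).comp q, fun x => ?_⟩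
  exact (LinearMap.congr_fun hq x).symm

/-- Smoothness makes the Kähler differentials finite projective, and exact differentials span them.
The functions `a i` serve as global coordinates, although their differentials need not be
independent. -/
theorem exists_coframe (K A : Type*) [Field K] [CommRing A] [Algebra K A] [Algebra.Smooth K A] :
    ∃ (n : ℕ) (a : Fin n → A) (d : Fin n → Derivation K A A),
      ∀ x, KaehlerDifferential.D K A x = ∑ i, d i x • KaehlerDifferential.D K A (a i) := by
  obtain ⟨n, a, d, h⟩ := exists_dual_family (R := A) (KaehlerDifferential.D K A)
    (KaehlerDifferential.span_range_derivation K A)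
  exact ⟨n, a, fun i => (d i).compDer (KaehlerDifferential.D K A), fun x => h _⟩

/-- A derivation along ψ factors through the Kähler differentials, so its values on the coframe
functions determine it. -/
theorem IsDerivAlong.eq_sum {n : ℕ} {a : Fin n → A} {d : Fin n → Derivation K A A}
    (hd : ∀ x, KaehlerDifferential.D K A x = ∑ i, d i x • KaehlerDifferential.D K A (a i))
    {ψ : A →ₐ[K] C} {δ : A →ₗ[K] C} (h : IsDerivAlong ψ δ) (x : A) :
    δ x = ∑ i, ψ (d i x) * δ (a i) := by
  let := ψ.toRingHom.toAlgebra
  have : IsScalarTower K A C := IsScalarTower.of_algebraMap_eq fun k => (ψ.commutes k).symm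
  let δ' : Derivation K A C := Derivation.mk' δ fun x y => h x y
  have := congrArg δ'.liftKaehlerDifferential (hd x)
  simp only [map_sum, map_smul, Derivation.liftKaehlerDifferential_comp_D] at this
  exact this

end Derivations

section Convolution

variable {K : Type*} [Field K] {H : Type*} [CommRing H] [HopfAlgebra K H]
  {A : Type*} [CommRing A] [Algebra K A]

/-- Functions on `M` with values in the Lie algebra, as functionals on the coordinate ring of the
group: `a ⊗ X ↦ a • X_1`. -/
noncomputable def tangentAtOne (K H A : Type*) [Field K] [CommRing H] [HopfAlgebra K H] [CommRing A]
    [Algebra K A] : A ⊗[K] leftInvariant K H →ₗ[A] H →ₗ[K] A :=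
  LinearMap.liftBaseChange A
    { toFun := fun X => Algebra.linearMap K A ∘ₗ atOne X
      map_add' := fun X Y => by simp [LinearMap.comp_add]
      map_smul' := fun c X => by simp [LinearMap.comp_smul] }

theorem tangentAtOne_tmul (a : A) (X : leftInvariant K H) :
    tangentAtOne K H A (a ⊗ₜ X) = a • (Algebra.linearMap K A ∘ₗ atOne X) := rfl

theorem leftInvariant_apply (X : leftInvariant K H) (h : H) :
    X.1 h = TensorProduct.rid K H ((atOne X).lTensor H (CoalgebraStruct.comul h)) := by
  have h1 := X.2 h
  have h2 := Coalgebra.lTensor_counit_comul (R := K) (X.1 h)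
  rw [h1, ← LinearMap.comp_apply, ← LinearMap.lTensor_comp] at h2
  have : atOne X = CoalgebraStruct.counit ∘ₗ (X.1 : H →ₗ[K] H) := rfl
  rw [this, h2]
  simp

/-- A left invariant field is the convolution of the identity of H with its tangent vector at one.
Translations thus become products, and inverting them is multiplication by φ ∘ S. -/
theorem toConv_leftTranslation (φ : H →ₐ[K] A) (x : A ⊗[K] leftInvariant K H) :
    toConv (leftTranslation φ x) = toConv φ.toLinearMap * toConv (tangentAtOne K H A x) := by
  induction x with
  | zero => simp
  | add x y hx hy => simp [hx, hy, mul_add]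
  | tmul a X =>
    rw [tangentAtOne_tmul, toConv_smul, mul_smul_comm]
    ext h
    have h1 : ∀ s : H ⊗[K] H, φ (TensorProduct.rid K H ((atOne X).lTensor H s)) =
        LinearMap.mul' K A (TensorProduct.map φ.toLinearMap
          (Algebra.linearMap K A ∘ₗ atOne X) s) := by
      intro s
      induction s with
      | zero => simp
      | add s t hs ht => simp [hs, ht]
      | tmul x y => simp [Algebra.smul_def, mul_comm]
    have h2 : (leftTranslation φ (a ⊗ₜ X)) h = a * φ (X.1 h) := rfl
    simp [h2, leftInvariant_apply X h, h1]

theorem toConv_rightTranslation (φ : H →ₐ[K] A) (x : A ⊗[K] leftInvariant K H) :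
    toConv (rightTranslation φ x) = toConv (tangentAtOne K H A x) * toConv φ.toLinearMap := by
  induction x with
  | zero => simp
  | add x y hx hy => simp [hx, hy, add_mul]
  | tmul a X =>
    rw [tangentAtOne_tmul, toConv_smul, smul_mul_assoc]
    ext h
    have h1 : ∀ s : H ⊗[K] H, φ (TensorProduct.lid K H ((atOne X).rTensor H s)) =
        LinearMap.mul' K A (TensorProduct.map
          (Algebra.linearMap K A ∘ₗ atOne X) φ.toLinearMap s) := by
      intro s
      induction s with
      | zero => simp
      | add s t hs ht => simp [hs, ht]
      | tmul x y => simp [Algebra.smul_def, mul_comm]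
    have h2 : (rightTranslation φ (a ⊗ₜ X)) h = a * φ (rightField X h) := rfl
    simp [h2, rightField, h1]

theorem conv_mul_conv_antipode (φ : H →ₐ[K] A) :
    toConv φ.toLinearMap * toConv (φ.toLinearMap ∘ₗ HopfAlgebra.antipode K) = 1 := by
  have := LinearMap.algHom_comp_convMul_distrib φ (toConv (LinearMap.id : H →ₗ[K] H))
    (toConv (HopfAlgebra.antipode K))
  rw [LinearMap.id_mul_antipode] at this
  apply WithConv.ofConv_injective
  simp only [LinearMap.comp_id] at this
  rw [← this]
  ext; simp

theorem conv_antipode_mul_conv (φ : H →ₐ[K] A) :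
    toConv (φ.toLinearMap ∘ₗ HopfAlgebra.antipode K) * toConv φ.toLinearMap = 1 := by
  have := LinearMap.algHom_comp_convMul_distrib φ (toConv (HopfAlgebra.antipode K))
    (toConv (LinearMap.id : H →ₗ[K] H))
  rw [LinearMap.antipode_mul_id] at this
  apply WithConv.ofConv_injective
  simp only [LinearMap.comp_id] at this
  rw [← this]
  ext; simp

end Convolution

end QuasiHam

/-! ### Tangent vectors at the identity with coefficients in A -/

namespace QuasiHam

open WithConv

section TangentAtOne

variable {K : Type*} [Field K] {H : Type*} [CommRing H] [HopfAlgebra K H]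
  {A : Type*} [CommRing A] [Algebra K A]

/-- The identity element of the group of points with coordinates in `A`. -/
noncomputable def onePoint (K H A : Type*) [Field K] [CommRing H] [HopfAlgebra K H] [CommRing A]
    [Algebra K A] : H →ₐ[K] A :=
  (Algebra.ofId K A).comp (Bialgebra.counitAlgHom K H)

theorem onePoint_apply (x : H) :
    onePoint K H A x = algebraMap K A (CoalgebraStruct.counit x) := rfl

/-- At the identity the coefficients in the Leibniz rule are counit values, that is, scalars, so
products of generators contribute nothing new to the span. -/
theorem range_le_of_adjoin_eq_top {δ : H →ₗ[K] A} (hδ : IsDerivAlong (onePoint K H A) δ)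
    {s : Set H} (hs : Algebra.adjoin K s = ⊤) (x : H) : δ x ∈ Submodule.span K (δ '' s) := by
  have hx : x ∈ Algebra.adjoin K s := hs ▸ Algebra.mem_top
  induction hx using Algebra.adjoin_induction with
  | mem x hx => exact Submodule.subset_span ⟨x, hx, rfl⟩
  | algebraMap r => rw [hδ.map_algebraMap]; exact zero_mem _
  | add x y _ _ hx hy => rw [map_add]; exact add_mem hx hy
  | mul x y _ _ hx hy =>
    rw [hδ x y, onePoint_apply, onePoint_apply, ← Algebra.smul_def, ← Algebra.smul_def]
    exact add_mem (Submodule.smul_mem _ _ hy) (Submodule.smul_mem _ _ hx)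

theorem isDerivAlong_atOne (X : leftInvariant K H) : IsDerivAlong (onePoint K H K) (atOne X) :=
  fun x y => atOne_mul X x y

theorem atOne_injective : Function.Injective (atOne (K := K) (H := H)) := by
  rw [injective_iff_map_eq_zero]
  intro X hX
  ext h
  rw [leftInvariant_apply, hX]
  simp

/-- A left invariant field is determined by its tangent vector at one, and that vector by its values
on finitely many generators. -/
theorem finite_leftInvariant [Algebra.FiniteType K H] : Module.Finite K (leftInvariant K H) := by
  obtain ⟨s, hs⟩ := Algebra.FiniteType.out (R := K) (A := H)
  let f : leftInvariant K H →ₗ[K] (s → K) := LinearMap.pi fun h => LinearMap.applyₗ h.1 ∘ₗ atOne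
  refine Module.Finite.of_injective f ((injective_iff_map_eq_zero f).2 fun X hX => ?_)
  apply atOne_injective
  rw [map_zero]
  ext h
  have h1 := range_le_of_adjoin_eq_top (isDerivAlong_atOne X) hs h
  have h2 : Submodule.span K (atOne X '' s) = ⊥ := by
    rw [Submodule.span_eq_bot]
    rintro _ ⟨x, hx, rfl⟩
    exact congrFun hX ⟨x, hx⟩
  rw [h2] at h1
  exact h1

/-- The left invariant vector field with a given tangent vector at the identity element. -/
theorem exists_atOne_eq {ξ : H →ₗ[K] K} (hξ : IsDerivAlong (onePoint K H K) ξ) :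
    ∃ X : leftInvariant K H, atOne X = ξ := by
  -- The field consists of the left translates of ξ. As the convolution of the identity with ξ it is
  -- a derivation, and its left invariance is coassociativity.
  let D : H →ₗ[K] H := (TensorProduct.rid K H).toLinearMap ∘ₗ ξ.lTensor H ∘ₗ CoalgebraStruct.comul
  have hDconv : D = (toConv (AlgHom.id K H).toLinearMap *
      toConv ((Algebra.ofId K H).toLinearMap ∘ₗ ξ)).ofConv := by
    ext h
    have h1 : ∀ s : H ⊗[K] H, TensorProduct.rid K H (ξ.lTensor H s) =
        LinearMap.mul' K H (TensorProduct.map (AlgHom.id K H).toLinearMap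
          ((Algebra.ofId K H).toLinearMap ∘ₗ ξ) s) := by
      intro s
      induction s with
      | zero => simp
      | add s t hs ht => simp only [map_add, hs, ht]
      | tmul x y => simp [Algebra.smul_def, mul_comm, Algebra.ofId_apply]
    exact h1 _
  have hD : IsDerivAlong (AlgHom.id K H) D := by
    have h1 := (hξ.algHom_comp (Algebra.ofId K H)).convMul_left (AlgHom.id K H)
    rw [← hDconv] at h1
    have h2 : (toConv (AlgHom.id K H) * toConv ((Algebra.ofId K H).comp (onePoint K H K))) =
        toConv (AlgHom.id K H) := mul_one _
    rw [h2] at h1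
    exact h1
  let X : Derivation K H H := Derivation.mk' D fun x y => hD x y
  refine ⟨⟨X, fun h => ?_⟩, ?_⟩
  · have h1 : ∀ s : H ⊗[K] H, CoalgebraStruct.comul (R := K) (TensorProduct.rid K H (ξ.lTensor H s))
        = TensorProduct.map LinearMap.id ((TensorProduct.rid K H).toLinearMap ∘ₗ ξ.lTensor H)
          (TensorProduct.assoc K H H H (CoalgebraStruct.comul.rTensor H s)) := by
      intro s
      induction s with
      | zero => simp
      | add s t hs ht => simp only [map_add, hs, ht]
      | tmul x y =>
        simp only [LinearMap.lTensor_tmul, TensorProduct.rid_tmul, map_smul, LinearMap.rTensor_tmul]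
        generalize (CoalgebraStruct.comul (R := K) x : H ⊗[K] H) = t
        induction t with
        | zero => simp
        | add s t hs ht => simp only [map_add, hs, ht, TensorProduct.add_tmul, smul_add]
        | tmul a b => simp
    change CoalgebraStruct.comul (R := K) (D h) = D.lTensor H _
    rw [show D h = TensorProduct.rid K H (ξ.lTensor H (CoalgebraStruct.comul h)) from rfl, h1,
      Coalgebra.coassoc_apply, LinearMap.lTensor, LinearMap.lTensor, ← LinearMap.comp_apply,
      ← TensorProduct.map_comp]
    rfl
  · ext h
    have h1 : ∀ s : H ⊗[K] H, CoalgebraStruct.counit (R := K)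
        (TensorProduct.rid K H (ξ.lTensor H s)) =
        ξ (TensorProduct.lid K H (CoalgebraStruct.counit.rTensor H s)) := by
      intro s
      induction s with
      | zero => simp
      | add s t hs ht => simp only [map_add, hs, ht]
      | tmul x y => simp [mul_comm]
    refine (h1 _).trans ?_
    simp

theorem isDerivAlong_tangentAtOne (x : A ⊗[K] leftInvariant K H) :
    IsDerivAlong (onePoint K H A) (tangentAtOne K H A x) := by
  induction x with
  | zero => intro x y; simp
  | add s t hs ht =>
    intro x y
    simp only [map_add, LinearMap.add_apply, hs x y, ht x y]
    ring
  | tmul a X =>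
    intro x y
    simp only [tangentAtOne_tmul, LinearMap.smul_apply, LinearMap.comp_apply, atOne_mul,
      onePoint_apply, Algebra.linearMap_apply, smul_eq_mul, map_add, map_mul]
    ring

/-- The values of δ lie in a finite-dimensional K-subspace W of A. Each coordinate of δ in a basis
of W is a tangent vector over K, hence comes from a left invariant field. -/
theorem exists_tangentAtOne_eq [Algebra.FiniteType K H] {δ : H →ₗ[K] A}
    (hδ : IsDerivAlong (onePoint K H A) δ) : ∃ x, tangentAtOne K H A x = δ := by
  obtain ⟨s, hs⟩ := Algebra.FiniteType.out (R := K) (A := H)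
  let W := Submodule.span K (δ '' s)
  have : Module.Finite K W := Module.Finite.span_of_finite K (s.finite_toSet.image _)
  let b := Module.finBasis K W
  let δ' : H →ₗ[K] W := δ.codRestrict W (range_le_of_adjoin_eq_top hδ hs)
  have hδ' : ∀ x y, δ' (x * y) = (CoalgebraStruct.counit x : K) • δ' y +
      (CoalgebraStruct.counit y : K) • δ' x := fun x y => by
    apply Subtype.ext
    simp [δ', hδ x y, onePoint_apply, Algebra.smul_def]
  have hξ : ∀ i, IsDerivAlong (onePoint K H K) (b.coord i ∘ₗ δ') := fun i x y => by
    simp only [LinearMap.comp_apply, hδ', map_add, map_smul]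
    rfl
  choose X hX using fun i => exists_atOne_eq (hξ i)
  refine ⟨∑ i, (b i : A) ⊗ₜ X i, ?_⟩
  ext h
  have h1 := congrArg Subtype.val (b.sum_repr (δ' h))
  rw [Submodule.coe_sum] at h1
  simp only [map_sum, tangentAtOne_tmul, LinearMap.sum_apply, hX, LinearMap.smul_apply,
    LinearMap.comp_apply, Algebra.linearMap_apply]
  refine Eq.trans (Finset.sum_congr rfl fun i _ => ?_) h1
  simp [Algebra.smul_def, mul_comm]

/-- K-linear functionals on A reduce the claim to injectivity of `atOne`; they also separate the
coordinates of x in a basis of the Lie algebra. -/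
theorem tangentAtOne_injective [Algebra.FiniteType K H] :
    Function.Injective (tangentAtOne K H A) := by
  rw [injective_iff_map_eq_zero]
  intro x hx
  have := finite_leftInvariant (K := K) (H := H)
  let e := Module.finBasis K (leftInvariant K H)
  have h1 : ∀ (l : A →ₗ[K] K) (y : A ⊗[K] leftInvariant K H),
      atOne (TensorProduct.lid K _ (l.rTensor _ y)) = l ∘ₗ tangentAtOne K H A y := by
    intro l y
    induction y with
    | zero => simp
    | add s t hs ht => simp only [map_add, hs, ht, LinearMap.comp_add]
    | tmul a X =>
      ext h
      simp only [LinearMap.rTensor_tmul, TensorProduct.lid_tmul, map_smul, LinearMap.smul_apply,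
        tangentAtOne_tmul, LinearMap.comp_apply, Algebra.linearMap_apply, smul_eq_mul]
      rw [mul_comm a, ← Algebra.smul_def, map_smul, smul_eq_mul, mul_comm]
  have h2 : ∀ l : A →ₗ[K] K, TensorProduct.lid K _ (l.rTensor _ x) = 0 := fun l => by
    apply atOne_injective
    rw [h1, hx]
    simp
  rw [← (e.baseChange A).sum_repr x]
  refine Finset.sum_eq_zero fun i _ => ?_
  have h3 : (e.baseChange A).repr x i = 0 := by
    rw [← Module.forall_dual_apply_eq_zero_iff K]
    intro l
    have h4 := h2 l
    rw [← (e.baseChange A).sum_repr x] at h4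
    simp only [Module.Basis.baseChange_apply, TensorProduct.smul_tmul', smul_eq_mul, mul_one,
      map_sum, LinearMap.rTensor_tmul, TensorProduct.lid_tmul] at h4
    exact Fintype.linearIndependent_iff.1 e.linearIndependent _ h4 i
  rw [h3, zero_smul]

/-- The B-dual basis supplies coordinate functionals, and these survive the extension of scalars to
A. -/
theorem exists_dual_bases {L : Type*} [AddCommGroup L] [Module K L] [Module.Finite K L]
    (B : LinearMap.BilinForm K L) (hB : B.Nondegenerate) :
    ∃ (n : ℕ) (e e' : Fin n → L), ∀ x : A ⊗[K] L,
      x = ∑ i, B.baseChange A (1 ⊗ₜ e' i) x • (1 : A) ⊗ₜ[K] e i := by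
  let e := Module.finBasis K L
  refine ⟨_, e, B.dualBasis hB e, fun x => ?_⟩
  have h1 : ∀ y, y = ∑ i, B (B.dualBasis hB e i) y • e i := fun y => by
    conv_lhs => rw [← e.sum_repr y]
    refine Finset.sum_congr rfl fun i _ => ?_
    congr 1
    conv_rhs => rw [← e.sum_repr y, map_sum]
    simp only [map_smul, LinearMap.BilinForm.apply_dualBasis_left, smul_eq_mul, mul_ite, mul_one,
      mul_zero, Finset.sum_ite_eq', Finset.mem_univ, if_true]
  induction x with
  | zero => simp
  | add s t hs ht =>
    simp only [map_add, add_smul, Finset.sum_add_distrib]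
    rw [← hs, ← ht]
  | tmul a y =>
    conv_lhs => rw [h1 y, TensorProduct.tmul_sum]
    refine Finset.sum_congr rfl fun i _ => ?_
    rw [LinearMap.BilinForm.baseChange_tmul, TensorProduct.smul_tmul', TensorProduct.tmul_smul,
      TensorProduct.smul_tmul']
    simp [Algebra.smul_def, mul_comm]

end TangentAtOne

end QuasiHam

/-! ### Points of the group and the adjoint action -/

namespace QuasiHam

open WithConv

theorem exists_linear_lift {R L N D : Type*} [CommRing R] [AddCommGroup L] [Module R L]
    [AddCommGroup N] [Module R N] [AddCommGroup D] [Module R D] {f : L →ₗ[R] N}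
    (hf : Function.Injective f) (m : D →ₗ[R] N) (h : ∀ v, ∃ x, f x = m v) :
    ∃ a : D →ₗ[R] L, ∀ v, f (a v) = m v := by
  refine ⟨(LinearEquiv.ofInjective f hf).symm.toLinearMap ∘ₗ m.codRestrict _ h, fun v => ?_⟩
  have := LinearEquiv.apply_symm_apply (LinearEquiv.ofInjective f hf) (m.codRestrict _ h v)
  exact congrArg Subtype.val this

section Adjoint

variable {K : Type*} [Field K] {H : Type*} [CommRing H] [HopfAlgebra K H]
  {A : Type*} [CommRing A] [Algebra K A]

/-- The inverse of a point of the group with coordinates in `A`. -/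
noncomputable def invPoint (φ : H →ₐ[K] A) : H →ₐ[K] A :=
  φ.comp (HopfAlgebra.antipodeAlgHom K H)

theorem point_mul_inv (φ : H →ₐ[K] A) : toConv φ * toConv (invPoint φ) = 1 := by
  apply WithConv.ofConv_injective
  apply AlgHom.toLinearMap_injective
  exact congrArg WithConv.ofConv (conv_mul_conv_antipode φ)

theorem inv_mul_point (φ : H →ₐ[K] A) : toConv (invPoint φ) * toConv φ = 1 := by
  apply WithConv.ofConv_injective
  apply AlgHom.toLinearMap_injective
  exact congrArg WithConv.ofConv (conv_antipode_mul_conv φ)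

theorem conv_point_mul_inv (φ : H →ₐ[K] A) :
    toConv φ.toLinearMap * toConv (invPoint φ).toLinearMap = 1 := conv_mul_conv_antipode φ

theorem conv_inv_mul_point (φ : H →ₐ[K] A) :
    toConv (invPoint φ).toLinearMap * toConv φ.toLinearMap = 1 := conv_antipode_mul_conv φ

theorem leftTranslation_injective [Algebra.FiniteType K H] (φ : H →ₐ[K] A) :
    Function.Injective (leftTranslation φ) := by
  rw [injective_iff_map_eq_zero]
  intro x hx
  have h := toConv_leftTranslation φ x
  rw [hx, toConv_zero] at h
  apply tangentAtOne_injective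
  apply WithConv.toConv_injective
  have h1 := congrArg (toConv (invPoint φ).toLinearMap * ·) h
  simp only [mul_zero, ← mul_assoc, conv_inv_mul_point, one_mul] at h1
  rw [← h1, map_zero, toConv_zero]

theorem exists_leftTranslation_eq [Algebra.FiniteType K H] {φ : H →ₐ[K] A} {δ : H →ₗ[K] A}
    (hδ : IsDerivAlong φ δ) : ∃ x, leftTranslation φ x = δ := by
  have h1 := hδ.convMul_left (invPoint φ)
  rw [inv_mul_point] at h1
  obtain ⟨x, hx⟩ := exists_tangentAtOne_eq h1
  refine ⟨x, WithConv.toConv_injective ?_⟩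
  rw [toConv_leftTranslation, hx, toConv_ofConv, ← mul_assoc, conv_point_mul_inv, one_mul]

/-- The derivative of a morphism, as a linear map on vector fields. -/
noncomputable def tangentMapₗ (φ : H →ₐ[K] A) : Derivation K A A →ₗ[A] H →ₗ[K] A where
  toFun v := tangentMap φ v
  map_add' v w := by ext; simp [tangentMap]
  map_smul' c v := by ext; simp [tangentMap]

/-- The map `v ↦ L_Φ⁻¹ (dΦ v)`. -/
theorem exists_leftTranslation_eq_tangentMap [Algebra.FiniteType K H] (φ : H →ₐ[K] A) :
    ∃ a : Derivation K A A →ₗ[A] A ⊗[K] leftInvariant K H,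
      ∀ v, leftTranslation φ (a v) = tangentMap φ v :=
  exists_linear_lift (leftTranslation_injective φ) (tangentMapₗ φ) fun v =>
    exists_leftTranslation_eq ((isDerivAlong_id v).comp_algHom φ)

/-- Conjugation by a point of the group. -/
theorem exists_adjoint [Algebra.FiniteType K H] (φ ψ : H →ₐ[K] A)
    (h : toConv φ * toConv ψ = 1) :
    ∃ Ad : A ⊗[K] leftInvariant K H →ₗ[A] A ⊗[K] leftInvariant K H,
      ∀ x, toConv (tangentAtOne K H A (Ad x)) =
        toConv φ.toLinearMap * toConv (tangentAtOne K H A x) * toConv ψ.toLinearMap := by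
  let m : A ⊗[K] leftInvariant K H →ₗ[A] H →ₗ[K] A :=
    { toFun := fun x => (toConv φ.toLinearMap * toConv (tangentAtOne K H A x) *
        toConv ψ.toLinearMap).ofConv
      map_add' := fun x y => by simp [mul_add, add_mul]
      map_smul' := fun c x => by
        simp only [map_smul, toConv_smul, mul_smul_comm, smul_mul_assoc, ofConv_smul,
          RingHom.id_apply] }
  obtain ⟨Ad, hAd⟩ := exists_linear_lift tangentAtOne_injective m fun x => by
    apply exists_tangentAtOne_eq
    have h1 := ((isDerivAlong_tangentAtOne x).convMul_left φ).convMul ψ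
    -- The base point of the conjugated vector is φ · 1 · ψ = 1, so it is again tangent at the
    -- identity.
    have h2 : toConv (toConv φ * toConv (onePoint K H A)).ofConv * toConv ψ = 1 := by
      rw [toConv_ofConv, show toConv (onePoint K H A) = 1 from rfl, mul_one, h]
    rw [h2] at h1
    exact h1
  exact ⟨Ad, fun x => by rw [hAd]; rfl⟩

theorem convMul_assoc_apply (δ₁ δ₂ δ₃ : H →ₗ[K] A) (h : H) :
    (toConv δ₁ * (toConv δ₂ * toConv δ₃)) h = LinearMap.mul' K A (TensorProduct.map δ₁
      (LinearMap.mul' K A ∘ₗ TensorProduct.map δ₂ δ₃)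
        ((CoalgebraStruct.comul (R := K)).lTensor H (CoalgebraStruct.comul h))) := by
  rw [LinearMap.lTensor, ← LinearMap.comp_apply (TensorProduct.map _ _), ← TensorProduct.map_comp]
  rfl

/-- A linear map applied to h₁ S(h₃) ⊗ h₂ can be read off on the iterated coproduct h₁ ⊗ h₂ ⊗ h₃,
where convolution products of three factors live. -/
theorem apply_conjCoaction {N : Type*} [AddCommGroup N] [Module K N] (F : H ⊗[K] H →ₗ[K] N)
    (F' : H ⊗[K] (H ⊗[K] H) →ₗ[K] N)
    (hF : ∀ x y z : H, F ((x * HopfAlgebra.antipode K z) ⊗ₜ y) = F' (x ⊗ₜ (y ⊗ₜ z))) (h : H) :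
    F (conjCoaction K H h) =
      F' ((CoalgebraStruct.comul (R := K)).lTensor H (CoalgebraStruct.comul h)) := by
  have h1 : F ∘ₗ (LinearMap.mul' K H).rTensor H ∘ₗ
      (TensorProduct.assoc K H H H).symm.toLinearMap ∘ₗ
      ((TensorProduct.comm K H H).toLinearMap ∘ₗ (HopfAlgebra.antipode K).lTensor H).lTensor H
        = F' := by
    ext x y z
    simpa using hF x y z
  rw [← h1]
  simp only [LinearMap.comp_apply, conjCoaction, LinearMap.lTensor_comp]

theorem mul_map_conjCoaction (χ : H →ₐ[K] A) (δ : H →ₗ[K] A) (h : H) :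
    LinearMap.mul' K A (TensorProduct.map χ.toLinearMap δ (conjCoaction K H h)) =
      (toConv χ.toLinearMap * (toConv δ * toConv (invPoint χ).toLinearMap)) h := by
  rw [convMul_assoc_apply]
  refine apply_conjCoaction (LinearMap.mul' K A ∘ₗ TensorProduct.map χ.toLinearMap δ)
    (LinearMap.mul' K A ∘ₗ TensorProduct.map χ.toLinearMap (LinearMap.mul' K A ∘ₗ
      TensorProduct.map δ (invPoint χ).toLinearMap)) (fun x y z => ?_) h
  simp [invPoint]
  ring

/-- The derivative of inversion at the identity is −1: apply δ to the relation S(h₁) h₂ = ε(h). -/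
theorem IsDerivAlong.comp_antipode {δ : H →ₗ[K] A} (hδ : IsDerivAlong (onePoint K H A) δ) :
    δ ∘ₗ HopfAlgebra.antipode K = -δ := by
  have h1 : toConv (δ ∘ₗ HopfAlgebra.antipode K) * 1 + 1 * toConv δ = 0 := by
    ext h
    have h2 : ∀ s : H ⊗[K] H, LinearMap.mul' K A (TensorProduct.map
        (δ ∘ₗ HopfAlgebra.antipode K) (onePoint K H A).toLinearMap s) +
        LinearMap.mul' K A (TensorProduct.map (onePoint K H A).toLinearMap δ s) =
        δ (LinearMap.mul' K H ((HopfAlgebra.antipode K).rTensor H s)) := by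
      intro s
      induction s with
      | zero => simp
      | add s t hs ht =>
        simp only [map_add, ← hs, ← ht]
        ring
      | tmul x y =>
        simp [hδ _ y, onePoint_apply]
        ring
    refine (h2 (CoalgebraStruct.comul h)).trans ?_
    rw [HopfAlgebra.mul_antipode_rTensor_comul_apply, hδ.map_algebraMap]
    rfl
  rw [mul_one, one_mul, ← toConv_add, ← toConv_zero] at h1
  exact eq_neg_of_add_eq_zero_left (WithConv.toConv_injective h1)

/-- This differentiates g ↦ g q g⁻¹ at the identity: the factor g contributes δ * φ, and by
`comp_antipode` the factor g⁻¹ contributes −φ * δ. -/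
theorem IsDerivAlong.mul_map_conjCoaction {δ : H →ₗ[K] A}
    (hδ : IsDerivAlong (onePoint K H A) δ) (φ : H →ₗ[K] A) (h : H) :
    LinearMap.mul' K A (TensorProduct.map δ φ (conjCoaction K H h)) =
      (toConv δ * toConv φ - toConv φ * toConv δ) h := by
  have h1 : toConv δ * toConv φ - toConv φ * toConv δ =
      toConv δ * (toConv φ * toConv (onePoint K H A).toLinearMap) +
      toConv (onePoint K H A).toLinearMap * (toConv φ * toConv (δ ∘ₗ HopfAlgebra.antipode K)) := by
    rw [hδ.comp_antipode, show toConv (onePoint K H A).toLinearMap = 1 from rfl, mul_one, one_mul,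
      toConv_neg, mul_neg, sub_eq_add_neg]
  rw [h1, show ∀ f g : WithConv (H →ₗ[K] A), (f + g) h = f h + g h from fun _ _ => rfl,
    convMul_assoc_apply, convMul_assoc_apply]
  refine apply_conjCoaction (LinearMap.mul' K A ∘ₗ TensorProduct.map δ φ)
    (LinearMap.mul' K A ∘ₗ TensorProduct.map δ (LinearMap.mul' K A ∘ₗ
      TensorProduct.map φ (onePoint K H A).toLinearMap) +
     LinearMap.mul' K A ∘ₗ TensorProduct.map (onePoint K H A).toLinearMap (LinearMap.mul' K A ∘ₗ
      TensorProduct.map φ (δ ∘ₗ HopfAlgebra.antipode K))) (fun x y z => ?_) h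
  simp [hδ x, onePoint_apply]
  ring

/-- `IsAdInvariantAlg` speaks only of elements that represent g ↦ Ad_g X; they are produced here by
conjugating with the universal point, the identity of H. -/
theorem exists_isAdjoint [Algebra.FiniteType K H] (X : leftInvariant K H) :
    ∃ s, IsAdjoint X s ∧ toConv (tangentAtOne K H H s) = toConv (AlgHom.id K H).toLinearMap *
      toConv (tangentAtOne K H H (1 ⊗ₜ X)) * toConv (invPoint (AlgHom.id K H)).toLinearMap := by
  obtain ⟨Ad, hAd⟩ := exists_adjoint (AlgHom.id K H) (invPoint (AlgHom.id K H)) (point_mul_inv _)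
  refine ⟨Ad (1 ⊗ₜ X), fun h => ?_, hAd _⟩
  have h1 : ∀ s : H ⊗[K] H, TensorProduct.rid K H ((atOne X).lTensor H s) =
      LinearMap.mul' K H (TensorProduct.map (AlgHom.id K H).toLinearMap
        (tangentAtOne K H H (1 ⊗ₜ X)) s) := by
    intro s
    induction s with
    | zero => simp
    | add s t hs ht => simp only [map_add, hs, ht]
    | tmul x y => simp [tangentAtOne_tmul, Algebra.smul_def, mul_comm]
  rw [h1, mul_map_conjCoaction, ← mul_assoc, ← hAd]
  rfl

theorem comp_tangentAtOne (φ : H →ₐ[K] A) (s : H ⊗[K] leftInvariant K H) :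
    tangentAtOne K H A (φ.toLinearMap.rTensor _ s) = φ.toLinearMap ∘ₗ tangentAtOne K H H s := by
  induction s with
  | zero => simp
  | add s t hs ht => simp only [map_add, hs, ht, LinearMap.comp_add]
  | tmul a X => ext h; simp [tangentAtOne_tmul]

theorem baseChange_rTensor {C L : Type*} [CommRing C] [Algebra K C] [AddCommGroup L] [Module K L]
    (B : LinearMap.BilinForm K L) (φ : C →ₐ[K] A) (s t : C ⊗[K] L) :
    B.baseChange A (φ.toLinearMap.rTensor L s) (φ.toLinearMap.rTensor L t) =
      φ (B.baseChange C s t) := by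
  induction s with
  | zero => simp
  | add s₁ s₂ h₁ h₂ => simp only [map_add, LinearMap.add_apply, h₁, h₂]
  | tmul a X =>
    induction t with
    | zero => simp
    | add t₁ t₂ h₁ h₂ => simp only [map_add, h₁, h₂]
    | tmul b Y => simp [LinearMap.BilinForm.baseChange_tmul]

/-- The invariance hypothesis concerns the universal point and constant X, Y. Pulling back along φ
gives it at the point φ, and A-bilinearity extends it to all x, y. -/
theorem baseChange_adjoint [Algebra.FiniteType K H] {B : LinearMap.BilinForm K (leftInvariant K H)}
    (hB : IsAdInvariantAlg B) (φ : H →ₐ[K] A)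
    {Ad : A ⊗[K] leftInvariant K H →ₗ[A] A ⊗[K] leftInvariant K H}
    (hAd : ∀ x, toConv (tangentAtOne K H A (Ad x)) = toConv φ.toLinearMap *
      toConv (tangentAtOne K H A x) * toConv (invPoint φ).toLinearMap)
    (x y : A ⊗[K] leftInvariant K H) :
    B.baseChange A (Ad x) (Ad y) = B.baseChange A x y := by
  have h1 : ∀ X : leftInvariant K H, ∃ s, IsAdjoint X s ∧
      Ad (1 ⊗ₜ X) = φ.toLinearMap.rTensor _ s := fun X => by
    obtain ⟨s, hs, hs'⟩ := exists_isAdjoint X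
    refine ⟨s, hs, tangentAtOne_injective (WithConv.toConv_injective ?_)⟩
    have h2 : toConv (φ.toLinearMap ∘ₗ (toConv (AlgHom.id K H).toLinearMap *
        toConv (tangentAtOne K H H (1 ⊗ₜ X)) *
          toConv (invPoint (AlgHom.id K H)).toLinearMap).ofConv)
        = toConv φ.toLinearMap * toConv (tangentAtOne K H A (1 ⊗ₜ X)) *
          toConv (invPoint φ).toLinearMap := by
      rw [LinearMap.algHom_comp_convMul_distrib, LinearMap.algHom_comp_convMul_distrib]
      congr 3
      simp only [← comp_tangentAtOne, LinearMap.rTensor_tmul, AlgHom.toLinearMap_apply, map_one]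
      rfl
    rw [hAd, comp_tangentAtOne, ← h2, ← hs']
  induction x with
  | zero => simp
  | add s₁ s₂ h₁ h₂ => simp only [map_add, LinearMap.add_apply, h₁, h₂]
  | tmul a X =>
    induction y with
    | zero => simp
    | add t₁ t₂ h₁ h₂ => simp only [map_add, h₁, h₂]
    | tmul b Y =>
      obtain ⟨s, hs, hs'⟩ := h1 X
      obtain ⟨t, ht, ht'⟩ := h1 Y
      have h3 : ∀ (c : A) (Z : leftInvariant K H), c ⊗ₜ[K] Z = c • (1 : A) ⊗ₜ[K] Z := fun c Z => by
        rw [TensorProduct.smul_tmul', smul_eq_mul, mul_one]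
      rw [h3 a, h3 b]
      simp only [map_smul, LinearMap.smul_apply]
      rw [hs', ht', baseChange_rTensor, hB X Y s t hs ht]
      simp [LinearMap.BilinForm.baseChange_tmul, Algebra.smul_def]

end Adjoint

end QuasiHam

/-! ### The momentum property over A, and the expansion of df -/

namespace QuasiHam

open WithConv

section

variable {K : Type*} [Field K] {H : Type*} [CommRing H] [HopfAlgebra K H]
  {A : Type*} [CommRing A] [Algebra K A]

theorem GroupAction.fundamentalField_apply (act : GroupAction K H A) (X : leftInvariant K H)
    (a : A) : act.fundamentalField X a =
      -TensorProduct.lid K A ((atOne X).rTensor A (act.ρ a)) := rfl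

theorem derivation_sum_apply {ι : Type*} (s : Finset ι) (d : ι → Derivation K A A) (x : A) :
    (∑ i ∈ s, d i) x = ∑ i ∈ s, d i x := by
  have := map_sum (Derivation.coeFnAddMonoidHom (R := K) (A := A) (M := A)) d s
  exact (congrFun this x).trans (Finset.sum_apply _ _ _)

/-- The fundamental vector field of a function with values in the Lie algebra. -/
noncomputable def GroupAction.fundamentalFieldₗ (act : GroupAction K H A) :
    A ⊗[K] leftInvariant K H →ₗ[A] Derivation K A A :=
  LinearMap.liftBaseChange A
    { toFun := fun X => act.fundamentalField X
      map_add' := fun X Y => by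
        ext a
        rw [Derivation.add_apply, act.fundamentalField_apply, act.fundamentalField_apply,
          act.fundamentalField_apply, map_add, LinearMap.rTensor_add, LinearMap.add_apply, map_add,
          neg_add]
      map_smul' := fun c X => by
        ext a
        rw [RingHom.id_apply, Derivation.smul_apply, act.fundamentalField_apply,
          act.fundamentalField_apply, map_smul, LinearMap.rTensor_smul, LinearMap.smul_apply,
          map_smul, smul_neg] }

theorem GroupAction.fundamentalFieldₗ_tmul (act : GroupAction K H A) (a : A)
    (X : leftInvariant K H) :
    act.fundamentalFieldₗ (a ⊗ₜ X) = a • act.fundamentalField X := rfl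

theorem GroupAction.fundamentalFieldₗ_apply_invariants (act : GroupAction K H A)
    (x : A ⊗[K] leftInvariant K H) (f : act.invariants) : act.fundamentalFieldₗ x f.1 = 0 := by
  have hf : act.ρ f.1 = (1 : H) ⊗ₜ f.1 := f.2
  induction x with
  | zero => simp
  | add s t hs ht => simp [hs, ht]
  | tmul a X =>
    simp [fundamentalFieldₗ_tmul, fundamentalField_apply, hf, (isDerivAlong_atOne X).map_one]

variable {act : GroupAction K H A} {B : LinearMap.BilinForm K (leftInvariant K H)}
  (S : QuasiHamiltonianAlg act B)

namespace QuasiHamiltonianAlg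

/-- Equivariance is differentiated in the group variable. The sign of `exp (-t X)` in X_M reverses
the commutator of `mul_map_conjCoaction`. -/
theorem toConv_tangentMap_fundamentalField (x : A ⊗[K] leftInvariant K H) :
    toConv (tangentMap S.φ (act.fundamentalFieldₗ x)) =
      toConv S.φ.toLinearMap * toConv (tangentAtOne K H A x) -
        toConv (tangentAtOne K H A x) * toConv S.φ.toLinearMap := by
  induction x with
  | zero => ext; simp [tangentMap]
  | add s t hs ht =>
    have h : toConv (tangentMap S.φ (act.fundamentalFieldₗ (s + t))) =
        toConv (tangentMap S.φ (act.fundamentalFieldₗ s)) +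
          toConv (tangentMap S.φ (act.fundamentalFieldₗ t)) := by
      ext; simp [tangentMap]
    rw [h, hs, ht, map_add, toConv_add, mul_add, add_mul]
    abel
  | tmul a X =>
    rw [show a ⊗ₜ[K] X = a • (1 : A) ⊗ₜ[K] X by rw [TensorProduct.smul_tmul', smul_eq_mul, mul_one],
      map_smul, map_smul, toConv_smul, mul_smul_comm, smul_mul_assoc, ← smul_sub]
    have h : tangentMap S.φ (a • act.fundamentalFieldₗ (1 ⊗ₜ X)) =
        a • tangentMap S.φ (act.fundamentalFieldₗ (1 ⊗ₜ X)) := by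
      ext; simp [tangentMap]
    rw [h, toConv_smul]
    congr 1
    ext h
    have h1 := (isDerivAlong_tangentAtOne (A := A) ((1 : A) ⊗ₜ[K] X)).mul_map_conjCoaction
      S.φ.toLinearMap h
    have h2 : ∀ s : H ⊗[K] H, LinearMap.mul' K A (TensorProduct.map
        (tangentAtOne K H A ((1 : A) ⊗ₜ[K] X)) S.φ.toLinearMap s) =
        TensorProduct.lid K A ((atOne X).rTensor A (S.φ.toLinearMap.lTensor H s)) := by
      intro s
      induction s with
      | zero => simp
      | add s t hs ht => simp only [map_add, hs, ht]
      | tmul x y => simp [tangentAtOne_tmul, Algebra.smul_def]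
    rw [h2, ← S.equivariant] at h1
    change (act.fundamentalFieldₗ (1 ⊗ₜ X)) (S.φ h) = _
    rw [act.fundamentalFieldₗ_tmul, one_smul, act.fundamentalField_apply, h1]
    rw [← neg_sub (toConv (tangentAtOne K H A (1 ⊗ₜ X)) * toConv S.φ.toLinearMap)]
    rfl

variable {a : Derivation K A A →ₗ[A] A ⊗[K] leftInvariant K H}
  (ha : ∀ v, leftTranslation S.φ (a v) = tangentMap S.φ v)
  {Ad Ad' : A ⊗[K] leftInvariant K H →ₗ[A] A ⊗[K] leftInvariant K H}
  (hAd : ∀ x, toConv (tangentAtOne K H A (Ad x)) = toConv S.φ.toLinearMap *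
    toConv (tangentAtOne K H A x) * toConv (invPoint S.φ).toLinearMap)
  (hAd' : ∀ x, toConv (tangentAtOne K H A (Ad' x)) = toConv (invPoint S.φ).toLinearMap *
    toConv (tangentAtOne K H A x) * toConv S.φ.toLinearMap)

include ha hAd' in
-- With ξ the tangent vector of x, multiply φ * ξ − ξ * φ on the left by φ⁻¹.
theorem map_fundamentalFieldₗ [Algebra.FiniteType K H] (x : A ⊗[K] leftInvariant K H) :
    a (act.fundamentalFieldₗ x) = x - Ad' x := by
  apply leftTranslation_injective S.φ
  rw [ha]
  apply WithConv.toConv_injective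
  rw [toConv_tangentMap_fundamentalField, toConv_leftTranslation, map_sub, toConv_sub, hAd',
    mul_sub, ← mul_assoc, ← mul_assoc, conv_point_mul_inv, one_mul]

include ha hAd in
-- Here Ad (a v) is the right logarithmic derivative R_Φ⁻¹ (dΦ v), since (φ * ξ * φ⁻¹) * φ = φ * ξ.
-- The momentum property then extends A-linearly.
theorem flat_fundamentalFieldₗ (x : A ⊗[K] leftInvariant K H) (v : Derivation K A A) :
    S.σ (act.fundamentalFieldₗ x) v =
      algebraMap K A 2⁻¹ * B.baseChange A x (a v + Ad (a v)) := by
  have h : rightTranslation S.φ (Ad (a v)) = tangentMap S.φ v := by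
    apply WithConv.toConv_injective
    rw [toConv_rightTranslation, hAd, ← ha, toConv_leftTranslation, mul_assoc, conv_inv_mul_point,
      mul_one]
  have h' : ∀ X, S.σ (act.fundamentalField X) v =
      (2 : K)⁻¹ • B.baseChange A (1 ⊗ₜ[K] X) (a v + Ad (a v)) :=
    fun X => S.momentum X v _ _ (ha v) h
  generalize a v + Ad (a v) = u at h' ⊢
  induction x with
  | zero => simp
  | add s t hs ht => simp only [map_add, LinearMap.add_apply, hs, ht, mul_add]
  | tmul b X =>
    rw [show b ⊗ₜ[K] X = b • (1 : A) ⊗ₜ[K] X by rw [TensorProduct.smul_tmul', smul_eq_mul, mul_one],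
      map_smul, map_smul, map_smul, LinearMap.smul_apply, LinearMap.smul_apply,
      act.fundamentalFieldₗ_tmul, one_smul, h', smul_eq_mul, smul_eq_mul,
      Algebra.smul_def]
    ring

theorem skew (v w : Derivation K A A) : S.σ v w = -S.σ w v := by
  have h := S.alternating (v + w)
  simp only [map_add, LinearMap.add_apply, S.alternating, zero_add, add_zero] at h
  exact eq_neg_of_add_eq_zero_right h

include ha in
theorem exists_expansion [Algebra.FiniteType K H] [Algebra.Smooth K A]
    (hB0 : B.Nondegenerate) (f : A) :
    ∃ (w : Derivation K A A) (x : A ⊗[K] leftInvariant K H),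
      ∀ v, v f = S.σ w v + B.baseChange A x (a v) := by
  have := finite_leftInvariant (K := K) (H := H)
  obtain ⟨n, e, e', he⟩ := exists_dual_bases (A := A) B hB0
  obtain ⟨m, b, d, hd⟩ := exists_coframe K A
  let N : Submodule A (Ω[A⁄K]) :=
    { carrier := {η | ∃ (w : Derivation K A A) (x : A ⊗[K] leftInvariant K H),
        ∀ v : Derivation K A A, v.liftKaehlerDifferential η = S.σ w v + B.baseChange A x (a v)}
      add_mem' := by
        rintro η₁ η₂ ⟨w₁, x₁, h₁⟩ ⟨w₂, x₂, h₂⟩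
        refine ⟨w₁ + w₂, x₁ + x₂, fun v => ?_⟩
        simp only [map_add, LinearMap.add_apply, h₁, h₂]
        ring
      zero_mem' := ⟨0, 0, fun v => by simp⟩
      smul_mem' := by
        rintro c η ⟨w, x, h⟩
        refine ⟨c • w, c • x, fun v => ?_⟩
        simp only [map_smul, LinearMap.smul_apply, h, smul_eq_mul]
        ring }
  -- The coframe turns every A-linear functional on vector fields into a differential.
  have hrep : ∀ α : Derivation K A A →ₗ[A] A, ∃ η : Ω[A⁄K], ∀ v : Derivation K A A,
      v.liftKaehlerDifferential η = α v := fun α => by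
    refine ⟨∑ i, α (d i) • KaehlerDifferential.D K A (b i), fun v => ?_⟩
    have hv : v = ∑ i, v (b i) • d i := by
      ext y
      refine ((isDerivAlong_id v).eq_sum hd y).trans ?_
      rw [derivation_sum_apply]
      exact Finset.sum_congr rfl fun i _ => mul_comm _ _
    conv_rhs => rw [hv]
    simp [mul_comm]
  suffices hN : N = ⊤ by
    obtain ⟨w, x, h⟩ := hN ▸ Submodule.mem_top (x := KaehlerDifferential.D K A f)
    exact ⟨w, x, fun v => by rw [← h v, Derivation.liftKaehlerDifferential_comp_D]⟩
  -- Otherwise N lies in a maximal submodule P with quotient A ⧸ m. By projectivity Ω[A⁄K] → A ⧸ m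
  -- lifts to A, which gives a vector field v with η ∈ P if and only if v(η) ∈ m. Both components of
  -- its image vanish at m, so v itself does, and then P would contain all differentials.
  refine (eq_top_or_exists_le_coatom N).resolve_right ?_
  rintro ⟨P, hP, hNP⟩
  have hs : IsSimpleModule A (Ω[A⁄K] ⧸ P) := isSimpleModule_iff_isCoatom.2 hP
  obtain ⟨m, hm, ⟨ψ⟩⟩ := isSimpleModule_iff_quot_maximal.1 hs
  obtain ⟨u, hu⟩ := Module.projective_lifting_property m.mkQ (ψ.toLinearMap ∘ₗ P.mkQ)
    (Submodule.mkQ_surjective m)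
  have hmem : ∀ η, u η ∈ m ↔ η ∈ P := fun η => by
    have h1 := LinearMap.congr_fun hu η
    simp only [LinearMap.comp_apply] at h1
    rw [← Submodule.Quotient.mk_eq_zero m, ← Submodule.mkQ_apply, h1]
    simp
  let v : Derivation K A A := u.compDer (KaehlerDifferential.D K A)
  have hv : v.liftKaehlerDifferential = u := by
    apply Derivation.liftKaehlerDifferential_unique
    ext x
    simp [v]
  have hP1 : ∀ η ∈ N, v.liftKaehlerDifferential η ∈ m := fun η hη => by
    rw [hv, hmem]
    exact hNP hη
  have hσ : ∀ w, S.σ v w ∈ m := fun w => by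
    obtain ⟨η, hη⟩ := hrep (S.σ w)
    rw [S.skew, ← hη]
    exact neg_mem (hP1 η ⟨w, 0, fun v => by simp [hη]⟩)
  have hΦ : ∀ h, tangentMap S.φ v h ∈ m := fun h => by
    rw [← ha, he (a v), map_sum, LinearMap.sum_apply]
    refine sum_mem fun i _ => ?_
    rw [map_smul, LinearMap.smul_apply, smul_eq_mul]
    refine Ideal.mul_mem_right _ _ ?_
    obtain ⟨η, hη⟩ := hrep (B.baseChange A (1 ⊗ₜ e' i) ∘ₗ a)
    rw [← LinearMap.comp_apply, ← hη]
    exact hP1 η ⟨0, 1 ⊗ₜ e' i, fun v => by simp [hη]⟩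
  have hva := S.nondegenerate m hm v hσ hΦ
  apply hP.1
  rw [eq_top_iff, ← KaehlerDifferential.span_range_derivation, Submodule.span_le]
  rintro _ ⟨y, rfl⟩
  rw [SetLike.mem_coe, ← hmem, ← hv, Derivation.liftKaehlerDifferential_comp_D]
  exact hva y

end QuasiHamiltonianAlg

end

end QuasiHam

/-! ### Forms along a morphism, and translation of vector fields -/

namespace QuasiHam

open WithConv

section Along

variable {K : Type*} [Field K] {A : Type*} [CommRing A] [Algebra K A]
  {C : Type*} [CommRing C] [Algebra K C] {n : ℕ} {b : Fin n → A} {d : Fin n → Derivation K A A}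

/-- A `2`-form, evaluated on vector fields along a morphism with comorphism `ψ`, in terms of a
coframe. -/
noncomputable def formAlong (ψ : A →ₐ[K] C) (σ : LinearMap.BilinForm A (Derivation K A A))
    (b : Fin n → A) (d : Fin n → Derivation K A A) :
    (A →ₗ[K] C) →ₗ[C] (A →ₗ[K] C) →ₗ[C] C :=
  LinearMap.mk₂ C (fun δ δ' => ∑ i, ∑ j, ψ (σ (d i) (d j)) * (δ (b i) * δ' (b j)))
    (fun δ₁ δ₂ δ' => by simp [add_mul, mul_add, Finset.sum_add_distrib])
    (fun c δ δ' => by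
      simp only [LinearMap.smul_apply, smul_eq_mul, Finset.mul_sum]
      exact Finset.sum_congr rfl fun i _ => Finset.sum_congr rfl fun j _ => by ring)
    (fun δ δ₁ δ₂ => by simp [mul_add, Finset.sum_add_distrib])
    (fun c δ δ' => by
      simp only [LinearMap.smul_apply, smul_eq_mul, Finset.mul_sum]
      exact Finset.sum_congr rfl fun i _ => Finset.sum_congr rfl fun j _ => by ring)

theorem formAlong_apply (ψ : A →ₐ[K] C) (σ : LinearMap.BilinForm A (Derivation K A A))
    (δ δ' : A →ₗ[K] C) : formAlong ψ σ b d δ δ' =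
      ∑ i, ∑ j, ψ (σ (d i) (d j)) * (δ (b i) * δ' (b j)) := rfl

theorem formAlong_skew (ψ : A →ₐ[K] C) {σ : LinearMap.BilinForm A (Derivation K A A)}
    (hσ : ∀ v w, σ v w = -σ w v) (δ δ' : A →ₗ[K] C) :
    formAlong ψ σ b d δ δ' = -formAlong ψ σ b d δ' δ := by
  rw [formAlong_apply, formAlong_apply, Finset.sum_comm, ← Finset.sum_neg_distrib]
  refine Finset.sum_congr rfl fun i _ => ?_
  rw [← Finset.sum_neg_distrib]
  refine Finset.sum_congr rfl fun j _ => ?_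
  rw [hσ, map_neg, mul_comm (δ _)]
  ring

theorem derivation_eq_sum
    (hd : ∀ x, KaehlerDifferential.D K A x = ∑ i, d i x • KaehlerDifferential.D K A (b i))
    (v : Derivation K A A) : v = ∑ i, v (b i) • d i := by
  ext y
  refine ((isDerivAlong_id v).eq_sum hd y).trans ?_
  rw [derivation_sum_apply]
  exact Finset.sum_congr rfl fun i _ => mul_comm _ _

theorem formAlong_comp_left
    (hd : ∀ x, KaehlerDifferential.D K A x = ∑ i, d i x • KaehlerDifferential.D K A (b i))
    (ψ : A →ₐ[K] C) (σ : LinearMap.BilinForm A (Derivation K A A)) (v : Derivation K A A)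
    (δ : A →ₗ[K] C) : formAlong ψ σ b d (ψ.toLinearMap ∘ₗ (v : A →ₗ[K] A)) δ =
      ∑ j, ψ (σ v (d j)) * δ (b j) := by
  rw [formAlong_apply, Finset.sum_comm]
  refine Finset.sum_congr rfl fun j _ => ?_
  conv_rhs => rw [derivation_eq_sum hd v]
  simp only [map_sum, LinearMap.sum_apply, map_smul, LinearMap.smul_apply, smul_eq_mul, map_mul,
    Finset.sum_mul]
  refine Finset.sum_congr rfl fun i _ => ?_
  simp only [LinearMap.comp_apply, AlgHom.toLinearMap_apply, Derivation.coeFn_coe]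
  ring

/-- It follows that `evalAlong` depends only on the fields along ψ and not on the chosen expansions.
-/
theorem evalAlong_eq_formAlong
    (hd : ∀ x, KaehlerDifferential.D K A x = ∑ i, d i x • KaehlerDifferential.D K A (b i))
    (ψ : A →ₐ[K] C) (σ : LinearMap.BilinForm A (Derivation K A A))
    (s t : C ⊗[K] Derivation K A A) :
    evalAlong ψ σ s t = formAlong ψ σ b d (expandAlong ψ s) (expandAlong ψ t) := by
  induction s with
  | zero => simp [evalAlong]
  | add s₁ s₂ h₁ h₂ =>
    simp only [evalAlong, map_add, LinearMap.add_apply] at h₁ h₂ ⊢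
    rw [h₁, h₂]
  | tmul c v =>
    induction t with
    | zero => simp [evalAlong]
    | add t₁ t₂ h₁ h₂ =>
      simp only [evalAlong, map_add] at h₁ h₂ ⊢
      rw [h₁, h₂]
    | tmul c' w =>
      have h1 : ∀ (e : C) (u : Derivation K A A), expandAlong ψ (e ⊗ₜ[K] u) =
          e • (ψ.toLinearMap ∘ₗ (u : A →ₗ[K] A)) := fun _ _ => rfl
      have h2 : evalAlong ψ σ (c ⊗ₜ[K] v) (c' ⊗ₜ[K] w) = c * c' * ψ (σ v w) := by
        simp [evalAlong, LinearMap.BilinMap.baseChange_tmul, mul_comm c]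
      rw [h1, h1, map_smul, map_smul, LinearMap.smul_apply, formAlong_comp_left hd, h2]
      conv_lhs => rw [derivation_eq_sum hd w]
      simp only [map_sum, map_smul, smul_eq_mul, map_mul, LinearMap.comp_apply,
        AlgHom.toLinearMap_apply, Derivation.coeFn_coe, Finset.mul_sum]
      exact Finset.sum_congr rfl fun i _ => by ring

end Along

namespace GroupAction

variable {K : Type*} [Field K] {H : Type*} [CommRing H] [HopfAlgebra K H]
  {A : Type*} [CommRing A] [Algebra K A] (act : GroupAction K H A)

/-- The vector field `(g, q) ↦ g v_q` along the action map. -/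
noncomputable def translate (v : Derivation K A A) : A →ₗ[K] H ⊗[K] A :=
  (v : A →ₗ[K] A).lTensor H ∘ₗ act.ρ.toLinearMap

theorem isDerivAlong_lTensor (v : Derivation K A A) :
    IsDerivAlong (AlgHom.id K (H ⊗[K] A)) ((v : A →ₗ[K] A).lTensor H) := by
  have := tmul_mem_of_isDerivAlong' (isDerivAlong_id v) (AlgHom.id K H)
  rwa [Algebra.TensorProduct.map_id] at this

theorem isDerivAlong_translate (v : Derivation K A A) : IsDerivAlong act.ρ (act.translate v) :=
  (isDerivAlong_lTensor v).comp_algHom act.ρ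

theorem translate_invariants (v : Derivation K A A) (f : act.invariants) :
    act.translate v f.1 = 1 ⊗ₜ v f.1 := by
  have hf : act.ρ f.1 = (1 : H) ⊗ₜ f.1 := f.2
  simp [translate, hf]

/-- The comorphism of `(g, q) ↦ (g, g q)`. -/
noncomputable def shear : H ⊗[K] A →ₐ[K] H ⊗[K] A :=
  Algebra.TensorProduct.lift Algebra.TensorProduct.includeLeft act.ρ fun _ _ => Commute.all _ _

/-- The comorphism of `(g, q) ↦ g⁻¹ q`. -/
noncomputable def ρInv : A →ₐ[K] H ⊗[K] A :=
  (Algebra.TensorProduct.map (HopfAlgebra.antipodeAlgHom K H) (AlgHom.id K A)).comp act.ρ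

/-- The comorphism of `(g, q) ↦ (g, g⁻¹ q)`. -/
noncomputable def shearInv : H ⊗[K] A →ₐ[K] H ⊗[K] A :=
  Algebra.TensorProduct.lift Algebra.TensorProduct.includeLeft act.ρInv fun _ _ => Commute.all _ _

/-- This packages g (g⁻¹ q) = q and g⁻¹ (g q) = q: m is one of the two multiplications twisted by
the antipode, and coassociativity lets it act on the two group variables. -/
theorem contract_coassoc (G : H ⊗[K] (H ⊗[K] A) →ₗ[K] H ⊗[K] A) (m : H ⊗[K] H →ₗ[K] H)
    (hG : ∀ x y a, G (x ⊗ₜ (y ⊗ₜ a)) = m (x ⊗ₜ y) ⊗ₜ a)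
    (hm : ∀ x, m (CoalgebraStruct.comul x) = algebraMap K H (CoalgebraStruct.counit x)) (a : A) :
    G (act.ρ.toLinearMap.lTensor H (act.ρ a)) = 1 ⊗ₜ a := by
  rw [← act.coassoc]
  conv_rhs => rw [← act.counit a]
  generalize act.ρ a = s
  induction s with
  | zero => simp
  | add s t hs ht => simp only [map_add, hs, ht, TensorProduct.tmul_add]
  | tmul x y =>
    have h1 : ∀ t : H ⊗[K] H, G (TensorProduct.assoc K H H A (t ⊗ₜ y)) = m t ⊗ₜ y := by
      intro t
      induction t with
      | zero => simp
      | add s t hs ht => simp only [map_add, TensorProduct.add_tmul, hs, ht]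
      | tmul x z => simp [hG]
    rw [LinearMap.rTensor_tmul, h1, hm]
    simp [Algebra.algebraMap_eq_smul_one, TensorProduct.smul_tmul]

theorem shearInv_ρ (a : A) : act.shearInv (act.ρ a) = 1 ⊗ₜ a := by
  rw [← act.contract_coassoc
    ((LinearMap.mul' K H ∘ₗ (HopfAlgebra.antipode K).lTensor H).rTensor A ∘ₗ
    (TensorProduct.assoc K H H A).symm.toLinearMap)
    (LinearMap.mul' K H ∘ₗ (HopfAlgebra.antipode K).lTensor H) (fun x y a => by simp)
    (fun x => HopfAlgebra.mul_antipode_lTensor_comul_apply x) a]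
  generalize act.ρ a = s
  induction s with
  | zero => simp
  | add s t hs ht => simp only [map_add, hs, ht]
  | tmul x y =>
    rw [LinearMap.lTensor_tmul]
    simp only [shearInv, ρInv, Algebra.TensorProduct.lift_tmul, AlgHom.comp_apply,
      AlgHom.toLinearMap_apply]
    generalize act.ρ y = t
    induction t with
    | zero => simp
    | add s t hs ht => simp only [map_add, TensorProduct.tmul_add, hs, ht, mul_add]
    | tmul z w => simp

theorem shear_ρInv (a : A) : act.shear (act.ρInv a) = 1 ⊗ₜ a := by
  rw [← act.contract_coassoc
    ((LinearMap.mul' K H ∘ₗ (HopfAlgebra.antipode K).rTensor H).rTensor A ∘ₗ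
    (TensorProduct.assoc K H H A).symm.toLinearMap)
    (LinearMap.mul' K H ∘ₗ (HopfAlgebra.antipode K).rTensor H) (fun x y a => by simp)
    (fun x => HopfAlgebra.mul_antipode_rTensor_comul_apply x) a]
  rw [ρInv, AlgHom.comp_apply]
  generalize act.ρ a = s
  induction s with
  | zero => simp
  | add s t hs ht => simp only [map_add, hs, ht]
  | tmul x y =>
    rw [LinearMap.lTensor_tmul]
    simp only [shear, Algebra.TensorProduct.map_tmul, Algebra.TensorProduct.lift_tmul,
      AlgHom.toLinearMap_apply, AlgHom.id_apply]
    generalize act.ρ y = t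
    induction t with
    | zero => simp
    | add s t hs ht => simp only [map_add, TensorProduct.tmul_add, hs, ht, mul_add]
    | tmul z w => simp

/-- The vector w at g q is the translate by g of the vector g⁻¹ w at q, so fields ρ ∘ w along the
action are combinations of translated ones. -/
theorem comp_eq_sum_translate {n : ℕ} {b : Fin n → A} {d : Fin n → Derivation K A A}
    (hd : ∀ x, KaehlerDifferential.D K A x = ∑ i, d i x • KaehlerDifferential.D K A (b i))
    (w : Derivation K A A) : ∃ c : Fin n → H ⊗[K] A,
      act.ρ.toLinearMap ∘ₗ (w : A →ₗ[K] A) = ∑ k, c k • act.translate (d k) := by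
  -- Conjugating id ⊗ w by the automorphism (g, q) ↦ (g, g q) gives an H-linear derivation E with E
  -- ∘ ρ = ρ ∘ w. Being H-linear, E is a combination of the id ⊗ d k.
  let E : H ⊗[K] A →ₗ[K] H ⊗[K] A :=
    act.shear.toLinearMap ∘ₗ (w : A →ₗ[K] A).lTensor H ∘ₗ act.shearInv.toLinearMap
  let κ : A →ₗ[K] H ⊗[K] A := E ∘ₗ Algebra.TensorProduct.includeRight.toLinearMap
  have hκ : IsDerivAlong Algebra.TensorProduct.includeRight κ := by
    have h := (((isDerivAlong_lTensor (H := H) w).algHom_comp act.shear).comp_algHom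
      act.shearInv).comp_algHom (Algebra.TensorProduct.includeRight (R := K) (A := H) (B := A))
    have h1 : ((act.shear.comp (AlgHom.id K (H ⊗[K] A))).comp act.shearInv).comp
        Algebra.TensorProduct.includeRight = Algebra.TensorProduct.includeRight := by
      ext a
      simp only [AlgHom.comp_apply, AlgHom.id_apply, Algebra.TensorProduct.includeRight_apply]
      rw [show act.shearInv (1 ⊗ₜ a) = act.ρInv a by
        simp [shearInv, ← Algebra.TensorProduct.one_def], shear_ρInv]
    rw [h1] at h
    exact h
  have hmul : ∀ (x : H) (z : H ⊗[K] A), (w : A →ₗ[K] A).lTensor H ((x ⊗ₜ 1) * z) =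
      (x ⊗ₜ 1) * (w : A →ₗ[K] A).lTensor H z := fun x z => by
    rw [isDerivAlong_lTensor w]
    simp
  have hE : ∀ z, E z = ∑ k, κ (b k) * ((d k : A →ₗ[K] A).lTensor H z) := by
    intro z
    induction z with
    | zero => simp
    | add s t hs ht => simp only [map_add, hs, ht, mul_add, Finset.sum_add_distrib]
    | tmul x a =>
      have h1 : E (x ⊗ₜ a) = (x ⊗ₜ 1) * κ a := by
        have h2 : act.shearInv (x ⊗ₜ a) = (x ⊗ₜ 1) * act.shearInv (1 ⊗ₜ a) := by
          simp [shearInv, ← Algebra.TensorProduct.one_def]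
        have h3 : act.shear (x ⊗ₜ 1) = x ⊗ₜ 1 := by simp [shear]
        simp only [E, κ, LinearMap.comp_apply, AlgHom.toLinearMap_apply,
          Algebra.TensorProduct.includeRight_apply]
        rw [h2, hmul, map_mul, h3]
      rw [h1, hκ.eq_sum hd a, Finset.mul_sum]
      refine Finset.sum_congr rfl fun k _ => ?_
      rw [mul_left_comm, ← mul_assoc, mul_comm]
      simp
  refine ⟨fun k => κ (b k), ?_⟩
  ext a
  have h := hE (act.ρ a)
  simp only [E, LinearMap.comp_apply, AlgHom.toLinearMap_apply, shearInv_ρ] at h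
  rw [LinearMap.lTensor_tmul, show ∀ y, act.shear (1 ⊗ₜ y) = act.ρ y by
    simp [shear, ← Algebra.TensorProduct.one_def]] at h
  rw [LinearMap.sum_apply]
  exact h

end GroupAction

end QuasiHam

/-! ### The theorem for affine algebraic manifolds -/

namespace QuasiHam

open WithConv

theorem baseChange_comm {K A L : Type*} [Field K] [CommRing A] [Algebra K A] [AddCommGroup L]
    [Module K L] {B : LinearMap.BilinForm K L} (hB : B.IsSymm) (x y : A ⊗[K] L) :
    B.baseChange A x y = B.baseChange A y x := by
  induction x with
  | zero => simp
  | add s₁ s₂ h₁ h₂ => simp only [map_add, LinearMap.add_apply, h₁, h₂]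
  | tmul a X =>
    induction y with
    | zero => simp
    | add t₁ t₂ h₁ h₂ => simp only [map_add, LinearMap.add_apply, h₁, h₂]
    | tmul b Y => simp [LinearMap.BilinForm.baseChange_tmul, hB.eq X Y, mul_comm]

namespace QuasiHamiltonianAlg

variable {K : Type*} [Field K] {H : Type*} [CommRing H] [HopfAlgebra K H] [Algebra.FiniteType K H]
  {A : Type*} [CommRing A] [Algebra K A] [Algebra.Smooth K A] {act : GroupAction K H A}
  {B : LinearMap.BilinForm K (leftInvariant K H)} (S : QuasiHamiltonianAlg act B)

/-- Pairing v with the expansion of df, for arbitrary f, gives v f = 0. -/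
theorem eq_zero_of_flat_eq_zero (hB0 : B.Nondegenerate) {v : Derivation K A A}
    (h : ∀ w, S.σ v w = 0) (h' : tangentMap S.φ v = 0) : v = 0 := by
  obtain ⟨a, ha⟩ := exists_leftTranslation_eq_tangentMap S.φ
  have hav : a v = 0 := leftTranslation_injective S.φ (by rw [ha, h', map_zero])
  ext f
  obtain ⟨w, x, hwx⟩ := S.exists_expansion ha hB0 f
  rw [hwx, S.skew, h, hav]
  simp

theorem IsHamiltonianField.unique (hB0 : B.Nondegenerate) {f : A} {X Y : Derivation K A A}
    (hX : S.IsHamiltonianField f X) (hY : S.IsHamiltonianField f Y) : X = Y := by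
  rw [← sub_eq_zero]
  apply S.eq_zero_of_flat_eq_zero hB0
  · intro w
    rw [map_sub, LinearMap.sub_apply, hX.flat_eq, hY.flat_eq, sub_self]
  · refine (map_sub (tangentMapₗ S.φ) X Y).trans ?_
    exact (congrArg₂ (· - ·) hX.map_eq_zero hY.map_eq_zero).trans (sub_self _)

theorem exists_isHamiltonianField [CharZero K] (hB : B.IsSymm) (hB0 : B.Nondegenerate)
    (hAd : IsAdInvariantAlg B) (f : act.invariants) : ∃ X, S.IsHamiltonianField f.1 X := by
  obtain ⟨a, ha⟩ := exists_leftTranslation_eq_tangentMap S.φ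
  obtain ⟨Ad, had⟩ := exists_adjoint S.φ (invPoint S.φ) (point_mul_inv _)
  obtain ⟨Ad', had'⟩ := exists_adjoint (invPoint S.φ) S.φ (inv_mul_point _)
  obtain ⟨w, x, hwx⟩ := S.exists_expansion ha hB0 f.1
  have := finite_leftInvariant (K := K) (H := H)
  obtain ⟨n, e, e', he⟩ := exists_dual_bases (A := A) B hB0
  have hc : (2 : A) * algebraMap K A 2⁻¹ = 1 := by
    rw [← map_ofNat (algebraMap K A) 2, ← map_mul, mul_inv_cancel₀ two_ne_zero, map_one]
  let α : Derivation K A A →ₗ[A] A :=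
    { toFun := fun v => v f.1
      map_add' := fun _ _ => rfl
      map_smul' := fun _ _ => rfl }
  have h1 : ∀ x, Ad (Ad' x) = x := fun x =>
    tangentAtOne_injective (WithConv.toConv_injective (by
      rw [had, had', ← mul_assoc, ← mul_assoc, conv_point_mul_inv, one_mul, mul_assoc,
        conv_point_mul_inv, mul_one]))
  have h2 : ∀ x, Ad' (Ad x) = x := fun x =>
    tangentAtOne_injective (WithConv.toConv_injective (by
      rw [had', had, ← mul_assoc, ← mul_assoc, conv_inv_mul_point, one_mul, mul_assoc,
        conv_inv_mul_point, mul_one]))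
  have h3 : ∀ x, (∀ y, B.baseChange A y x = 0) → x = 0 := fun x hx => by
    rw [he x]
    exact Finset.sum_eq_zero fun i _ => by rw [hx, zero_smul]
  obtain ⟨v, hv, hv'⟩ := exists_flat_eq_of_expansion hc S.σ S.alternating (B.baseChange A)
    (baseChange_comm hB) h3 a Ad Ad' h1 h2 (baseChange_adjoint hAd S.φ had) act.fundamentalFieldₗ
    (S.flat_fundamentalFieldₗ ha had) (S.map_fundamentalFieldₗ ha had') α
    (fun x => act.fundamentalFieldₗ_apply_invariants x f) w x hwx
  exact ⟨v, hv, by rw [← ha, hv', map_zero]⟩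

variable {S} in
-- The difference δ of the two fields along the action map is killed by dΦ and is σ-orthogonal to
-- all fields ρ ∘ w. The expansion of dy then gives δ y = 0 for every y.
theorem IsHamiltonianField.translate_eq (hB0 : B.Nondegenerate) {f : act.invariants}
    {X : Derivation K A A} (hX : S.IsHamiltonianField f.1 X) :
    act.translate X = act.ρ.toLinearMap ∘ₗ (X : A →ₗ[K] A) := by
  obtain ⟨a, ha⟩ := exists_leftTranslation_eq_tangentMap S.φ
  obtain ⟨n, b, d, hd⟩ := exists_coframe K A
  let δ := act.translate X - act.ρ.toLinearMap ∘ₗ (X : A →ₗ[K] A)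
  have hδ : IsDerivAlong act.ρ δ :=
    (act.isDerivAlong_translate X).sub ((isDerivAlong_id X).algHom_comp act.ρ)
  have hX0 : ∀ h, X (S.φ h) = 0 := fun h => LinearMap.congr_fun hX.map_eq_zero h
  have hδφ : ∀ h, δ (S.φ h) = 0 := fun h => by
    have h1 : (X : A →ₗ[K] A) ∘ₗ S.φ.toLinearMap = 0 := hX.map_eq_zero
    simp only [δ, GroupAction.translate, LinearMap.sub_apply, LinearMap.comp_apply,
      AlgHom.toLinearMap_apply, S.equivariant, Derivation.coeFn_coe, hX0, map_zero, sub_zero]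
    rw [← LinearMap.comp_apply, ← LinearMap.lTensor_comp, h1]
    simp
  -- This sum is ω ∘ dΦ evaluated on δ; its left translation along ρ ∘ φ is δ ∘ φ.
  have hz : ∑ i, δ (b i) • act.ρ.toLinearMap.rTensor _ (a (d i)) = 0 := by
    apply leftTranslation_injective (act.ρ.comp S.φ)
    have h1 : ∀ y : A ⊗[K] leftInvariant K H, leftTranslation (act.ρ.comp S.φ)
        (act.ρ.toLinearMap.rTensor _ y) = act.ρ.toLinearMap ∘ₗ leftTranslation S.φ y := by
      intro y
      induction y with
      | zero => simp
      | add s t hs ht => simp only [map_add, hs, ht, LinearMap.comp_add]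
      | tmul c Y => ext h; simp [leftTranslation]
    ext h
    simp only [map_sum, map_smul, h1, ha, LinearMap.sum_apply, LinearMap.smul_apply, map_zero,
      LinearMap.zero_apply, smul_eq_mul]
    rw [← hδφ h, hδ.eq_sum hd]
    exact Finset.sum_congr rfl fun i _ => mul_comm _ _
  have hform : ∀ (u w : Derivation K A A), formAlong act.ρ S.σ b d (act.translate u)
      (act.translate w) = 1 ⊗ₜ S.σ u w := fun u w => by
    have h1 : ∀ v : Derivation K A A, expandAlong act.ρ (∑ i, act.translate v (b i) ⊗ₜ[K] d i) =
        act.translate v := fun v => by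
      ext y
      rw [map_sum, LinearMap.sum_apply, (act.isDerivAlong_translate v).eq_sum hd]
      exact Finset.sum_congr rfl fun i _ => mul_comm _ _
    have h2 := S.invariant u w _ _ (h1 u) (h1 w)
    rwa [evalAlong_eq_formAlong hd, h1, h1] at h2
  -- Invariance of σ and of f makes both pairings equal to the derivative of f along the translate
  -- of u.
  have hδt : ∀ u, formAlong act.ρ S.σ b d δ (act.translate u) = 0 := fun u => by
    rw [map_sub, LinearMap.sub_apply, hform, formAlong_comp_left hd, hX.flat_eq,
      ← act.translate_invariants u f, (act.isDerivAlong_translate u).eq_sum hd f.1, sub_eq_zero]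
    exact Finset.sum_congr rfl fun i _ => by rw [hX.flat_eq]
  have hδw : ∀ w : Derivation K A A,
      formAlong act.ρ S.σ b d (act.ρ.toLinearMap ∘ₗ (w : A →ₗ[K] A)) δ = 0 := fun w => by
    obtain ⟨c, hc⟩ := act.comp_eq_sum_translate hd w
    rw [formAlong_skew _ S.skew, hc, map_sum]
    simp only [map_smul, hδt, smul_zero, Finset.sum_const_zero, neg_zero]
  rw [← sub_eq_zero]
  ext y
  obtain ⟨w, x, hwx⟩ := S.exists_expansion ha hB0 y
  have h1 := hδw w
  rw [formAlong_comp_left hd] at h1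
  have h2 : ∑ i, act.ρ (B.baseChange A x (a (d i))) * δ (b i) = 0 := by
    have h3 := congrArg (B.baseChange (H ⊗[K] A) (act.ρ.toLinearMap.rTensor _ x)) hz
    simp only [map_sum, map_smul, baseChange_rTensor, map_zero, smul_eq_mul] at h3
    rw [← h3]
    exact Finset.sum_congr rfl fun i _ => mul_comm _ _
  refine (hδ.eq_sum hd y).trans ?_
  simp only [hwx, map_add, add_mul, Finset.sum_add_distrib]
  rw [h1, h2, add_zero]
  rfl

variable {S} in
theorem IsHamiltonianField.apply_mem_invariants (hB0 : B.Nondegenerate) {f : act.invariants}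
    {X : Derivation K A A} (hX : S.IsHamiltonianField f.1 X) (h : act.invariants) :
    X h.1 ∈ act.invariants := by
  have h1 := LinearMap.congr_fun (hX.translate_eq hB0) h.1
  rw [act.translate_invariants] at h1
  exact h1.symm

omit [Algebra.FiniteType K H] [Algebra.Smooth K A] in
-- Let J be the left-hand side. In dσ(X, Y, Z) the three derivatives of values of σ contribute −J
-- and the three bracket terms 2J, so dσ(X, Y, Z) = J; it vanishes because all three fields are
-- killed by dΦ.
theorem jacobi_of_isHamiltonianField {f g h : A} {X Y Z : Derivation K A A}
    (hX : S.IsHamiltonianField f X) (hY : S.IsHamiltonianField g Y)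
    (hZ : S.IsHamiltonianField h Z) : X (Y h) + Y (Z f) + Z (X g) = 0 := by
  have h0 : ∀ {f : A} {X : Derivation K A A}, S.IsHamiltonianField f X →
      leftTranslation S.φ 0 = tangentMap S.φ X := fun hX => by rw [hX.map_eq_zero, map_zero]
  have h1 := S.quasiClosed X Y Z 0 0 0 (h0 hX) (h0 hY) (h0 hZ)
  have h2 : ∀ {f g : A} {X Y : Derivation K A A}, S.IsHamiltonianField f X →
      S.IsHamiltonianField g Y → X g = -Y f := fun hX hY => by
    rw [← hX.flat_eq, S.skew, hY.flat_eq, neg_neg]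
  simp only [cartanForm, map_zero, add_zero, smul_zero, extDerivTwoFormAlg,
    S.skew ⁅_, _⁆, hX.flat_eq, hY.flat_eq, hZ.flat_eq, Derivation.commutator_apply] at h1
  rw [h2 hY hX, h2 hZ hX, h2 hZ hY] at h1
  simp only [map_neg] at h1
  rw [h2 hZ hX, map_neg]
  linear_combination h1

theorem exists_poisson [CharZero K] (hB : B.IsSymm) (hB0 : B.Nondegenerate)
    (hAd : IsAdInvariantAlg B) : ∃ X : act.invariants → Derivation K A A,
      (∀ f Y, S.IsHamiltonianField f.1 Y ↔ Y = X f) ∧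
      ∃ br : act.invariants →ₗ[K] act.invariants →ₗ[K] act.invariants,
        IsPoissonBracket br ∧
        ∀ f h, (br f h).1 = X f h.1 ∧ (br f h).1 = S.σ (X h) (X f) := by
  choose X hX using S.exists_isHamiltonianField hB hB0 hAd
  -- The assignment f ↦ X f is linear by uniqueness; this gives linearity of the bracket in its
  -- first variable.
  have hadd : ∀ f g, X (f + g) = X f + X g := fun f g =>
    IsHamiltonianField.unique S hB0 (hX _)
      ⟨fun v => by simp [(hX f).flat_eq, (hX g).flat_eq],
        ((tangentMapₗ S.φ).map_add _ _).trans (by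
          change tangentMap S.φ _ + tangentMap S.φ _ = 0
          rw [(hX f).map_eq_zero, (hX g).map_eq_zero, add_zero])⟩
  have hsmul : ∀ (c : K) f, X (c • f) = c • X f := fun c f =>
    IsHamiltonianField.unique S hB0 (hX _)
      ⟨fun v => by
        rw [← algebraMap_smul A c (X f), map_smul, LinearMap.smul_apply, (hX f).flat_eq,
          algebraMap_smul]
        simp,
       by
        ext h
        simpa [tangentMap] using Or.inr (LinearMap.congr_fun (hX f).map_eq_zero h)⟩
  let br : act.invariants →ₗ[K] act.invariants →ₗ[K] act.invariants :=
    LinearMap.mk₂ K (fun f h => ⟨X f h.1, (hX f).apply_mem_invariants hB0 h⟩)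
      (fun f g h => Subtype.ext (by simp [hadd]))
      (fun c f h => Subtype.ext (by simp [hsmul]))
      (fun f g h => Subtype.ext (by simp))
      (fun c f h => Subtype.ext (by simp))
  have hbr : ∀ f h, (br f h).1 = X f h.1 := fun _ _ => rfl
  have hbr' : ∀ f h, (br f h).1 = S.σ (X h) (X f) := fun f h => ((hX h).flat_eq _).symm
  refine ⟨X, fun f Y => ⟨fun hY => IsHamiltonianField.unique S hB0 hY (hX f), fun hY => hY ▸ hX f⟩,
    br, ⟨fun f => ?_, fun f g h => ?_, fun f g h => ?_⟩, fun f h => ⟨hbr f h, hbr' f h⟩⟩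
  · exact Subtype.ext ((hbr' f f).trans (S.alternating _))
  · refine Subtype.ext ?_
    simp only [hbr, MulMemClass.coe_mul, AddMemClass.coe_add, Derivation.leibniz, smul_eq_mul]
    ring
  · have hs : ∀ u v, br u v = -br v u := fun u v => Subtype.ext (by
      simp only [hbr', NegMemClass.coe_neg]
      exact S.skew _ _)
    rw [hs (br f g) h, hs (br g h) f, hs (br h f) g]
    refine Subtype.ext ?_
    have := S.jacobi_of_isHamiltonianField (hX f) (hX g) (hX h)
    change -(X h (X f g.1)) + -(X f (X g h.1)) + -(X g (X h f.1)) = 0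
    linear_combination -this

end QuasiHamiltonianAlg

end QuasiHam

/-! ### Duality on a tangent space, and Maurer-Cartan forms -/

noncomputable section

namespace QuasiHam

/-- A functional that vanishes on all the covectors σ w + B x ∘ a is evaluation at some v with σ(·,
v) = 0 and a v = 0, so v = 0. Those covectors therefore fill the dual. -/
theorem exists_expansion_of_injective {𝕜 D L : Type*} [Field 𝕜] [AddCommGroup D] [Module 𝕜 D]
    [FiniteDimensional 𝕜 D] [AddCommGroup L] [Module 𝕜 L] (σ : LinearMap.BilinForm 𝕜 D)
    (hσ : ∀ v, σ v v = 0) (B : LinearMap.BilinForm 𝕜 L) (hB0 : ∀ x, (∀ y, B y x = 0) → x = 0)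
    (a : D →ₗ[𝕜] L) (h : ∀ v, (∀ w, σ v w = 0) → a v = 0 → v = 0) (α : D →ₗ[𝕜] 𝕜) :
    ∃ (w : D) (x : L), ∀ v, α v = σ w v + B x (a v) := by
  have hskew : ∀ v u, σ v u = -σ u v := fun v u => by
    have h := hσ (v + u)
    simp only [map_add, LinearMap.add_apply, hσ, zero_add, add_zero] at h
    exact eq_neg_of_add_eq_zero_right h
  let T : D × L →ₗ[𝕜] Module.Dual 𝕜 D :=
    LinearMap.coprod σ (LinearMap.lcomp 𝕜 𝕜 a ∘ₗ B)
  suffices hT : LinearMap.range T = ⊤ by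
    obtain ⟨⟨w, x⟩, hwx⟩ := LinearMap.range_eq_top.1 hT α
    exact ⟨w, x, fun v => by rw [← hwx]; rfl⟩
  by_contra hT
  obtain ⟨f, hf0, hf⟩ := Submodule.exists_le_ker_of_lt_top _ (lt_top_iff_ne_top.2 hT)
  obtain ⟨v, rfl⟩ := (Module.evalEquiv 𝕜 D).surjective f
  have hf' : ∀ w x, σ w v + B x (a v) = 0 := fun w x => hf ⟨(w, x), rfl⟩
  refine hf0 ?_
  rw [h v (fun w => by have := hf' w 0; rw [hskew]; simpa using this)
    (hB0 _ fun y => by have := hf' 0 y; simpa using this), map_zero]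

section Group

variable {𝕜 : Type*} [RCLike 𝕜]
  {V : Type*} [NormedAddCommGroup V] [NormedSpace 𝕜 V]
  {G : Type*} [TopologicalSpace G] [ChartedSpace V G] [Group G] {n : ℕ∞ω}

/-- The left invariant Maurer-Cartan form as a linear map. -/
def maurerCartanLeftₗ (q : G) : TangentSpace 𝓘(𝕜, V) q →ₗ[𝕜] GroupLieAlgebra 𝓘(𝕜, V) G where
  toFun := maurerCartanLeft q
  map_add' v w := (mfderiv 𝓘(𝕜, V) 𝓘(𝕜, V) (fun x : G => q⁻¹ * x) q).map_add v w
  map_smul' c v := (mfderiv 𝓘(𝕜, V) 𝓘(𝕜, V) (fun x : G => q⁻¹ * x) q).map_smul c v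

/-- The adjoint action as a linear map. -/
def adjointActionₗ (g : G) : GroupLieAlgebra 𝓘(𝕜, V) G →ₗ[𝕜] GroupLieAlgebra 𝓘(𝕜, V) G where
  toFun := adjointAction g
  map_add' v w := (mfderiv 𝓘(𝕜, V) 𝓘(𝕜, V) (fun x : G => g * x * g⁻¹) 1).map_add v w
  map_smul' c v := (mfderiv 𝓘(𝕜, V) 𝓘(𝕜, V) (fun x : G => g * x * g⁻¹) 1).map_smul c v

variable [ContMDiffMul 𝓘(𝕜, V) n G] (hn : n ≠ 0)

include hn

theorem mdifferentiable_mul_left' (g : G) :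
    MDifferentiable 𝓘(𝕜, V) 𝓘(𝕜, V) (fun x : G => g * x) :=
  (contMDiff_mul_left (I := 𝓘(𝕜, V)) (n := n) (a := g)).mdifferentiable hn

theorem mdifferentiable_mul_right' (g : G) :
    MDifferentiable 𝓘(𝕜, V) 𝓘(𝕜, V) (fun x : G => x * g) :=
  (contMDiff_mul_right (I := 𝓘(𝕜, V)) (n := n) (a := g)).mdifferentiable hn

theorem mdifferentiable_conj (g : G) :
    MDifferentiable 𝓘(𝕜, V) 𝓘(𝕜, V) (fun x : G => g * x * g⁻¹) :=
  (mdifferentiable_mul_right' hn g⁻¹).comp (mdifferentiable_mul_left' hn g)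

/-- Differentiate x q⁻¹ = q (q⁻¹ x) q⁻¹ at x = q. -/
theorem maurerCartanRight_eq (q : G) (v : TangentSpace 𝓘(𝕜, V) q) :
    maurerCartanRight q v = adjointAction q (maurerCartanLeft q v) := by
  have h1 : (fun x : G => x * q⁻¹) = (fun x => q * x * q⁻¹) ∘ fun x => q⁻¹ * x := by
    ext x; simp
  have h2 := mfderiv_comp q (I := 𝓘(𝕜, V)) (I' := 𝓘(𝕜, V)) (I'' := 𝓘(𝕜, V))
    (g := fun x : G => q * x * q⁻¹) (f := fun x => q⁻¹ * x)
    (mdifferentiable_conj hn q _) (mdifferentiable_mul_left' hn q⁻¹ q)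
  rw [← h1] at h2
  have h3 : q⁻¹ * q = 1 := inv_mul_cancel q
  unfold maurerCartanRight adjointAction maurerCartanLeft
  rw [h2]
  change (mfderiv 𝓘(𝕜, V) 𝓘(𝕜, V) (fun x : G => q * x * q⁻¹) (q⁻¹ * q) : V →L[𝕜] V) _ =
    (mfderiv 𝓘(𝕜, V) 𝓘(𝕜, V) (fun x : G => q * x * q⁻¹) 1 : V →L[𝕜] V) _
  rw [h3]
  rfl

theorem adjointAction_adjointAction_inv (g : G) (x : GroupLieAlgebra 𝓘(𝕜, V) G) :
    adjointAction g (adjointAction g⁻¹ x) = x := by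
  have h1 : (fun x : G => g * x * g⁻¹) ∘ (fun x => g⁻¹ * x * g⁻¹⁻¹) = id := by
    ext x; simp [mul_assoc]
  have h2 := mfderiv_comp 1 (I := 𝓘(𝕜, V)) (I' := 𝓘(𝕜, V)) (I'' := 𝓘(𝕜, V))
    (g := fun x : G => g * x * g⁻¹) (f := fun x => g⁻¹ * x * g⁻¹⁻¹)
    (mdifferentiable_conj hn g _) (mdifferentiable_conj hn g⁻¹ 1)
  have h3 : g⁻¹ * 1 * g⁻¹⁻¹ = 1 := by simp
  rw [h1, mfderiv_id] at h2
  have h4 := (congrArg (fun L : V →L[𝕜] V => L x) h2).symm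
  refine Eq.trans ?_ h4
  change (mfderiv 𝓘(𝕜, V) 𝓘(𝕜, V) (fun x : G => g * x * g⁻¹) 1 : V →L[𝕜] V) _ =
    (mfderiv 𝓘(𝕜, V) 𝓘(𝕜, V) (fun x : G => g * x * g⁻¹) (g⁻¹ * 1 * g⁻¹⁻¹) : V →L[𝕜] V) _
  rw [h3]
  rfl

theorem eq_zero_of_maurerCartanLeft_eq_zero {q : G} {v : TangentSpace 𝓘(𝕜, V) q}
    (h : maurerCartanLeft q v = 0) : v = 0 := by
  have h1 : (fun x : G => q * x) ∘ (fun x => q⁻¹ * x) = id := by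
    ext x; simp
  have h2 := mfderiv_comp q (I := 𝓘(𝕜, V)) (I' := 𝓘(𝕜, V)) (I'' := 𝓘(𝕜, V))
    (g := fun x : G => q * x) (f := fun x => q⁻¹ * x)
    (mdifferentiable_mul_left' hn q _) (mdifferentiable_mul_left' hn q⁻¹ q)
  rw [h1, mfderiv_id] at h2
  have h4 := (congrArg (fun L : V →L[𝕜] V => L v) h2)
  refine Eq.trans h4 ?_
  change (mfderiv 𝓘(𝕜, V) 𝓘(𝕜, V) (fun x : G => q * x) (q⁻¹ * q) : V →L[𝕜] V)
    (maurerCartanLeft q v) = 0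
  rw [h]
  exact ContinuousLinearMap.map_zero _

end Group

end QuasiHam

end

/-! ### Orbit maps, and the Hamiltonian vector at a point -/

noncomputable section

namespace QuasiHam

section Deriv

variable {𝕜 : Type*} [RCLike 𝕜]
  {E : Type*} [NormedAddCommGroup E] [NormedSpace 𝕜 E]
  {M : Type*} [TopologicalSpace M] [ChartedSpace E M]
  {F : Type*} [NormedAddCommGroup F] [NormedSpace 𝕜 F]
  {N : Type*} [TopologicalSpace N] [ChartedSpace F N]
  {V : Type*} [NormedAddCommGroup V] [NormedSpace 𝕜 V]
  {G : Type*} [TopologicalSpace G] [ChartedSpace V G]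

variable (𝕜 E F) in
/-- The derivative of a map between manifolds, as a linear map between model spaces. -/
def modelDeriv (f : M → N) (q : M) : E →L[𝕜] F := mfderiv 𝓘(𝕜, E) 𝓘(𝕜, F) f q

theorem modelDeriv_comp {g : N → G} {f : M → N} {q : M}
    (hg : MDifferentiableAt 𝓘(𝕜, F) 𝓘(𝕜, V) g (f q))
    (hf : MDifferentiableAt 𝓘(𝕜, E) 𝓘(𝕜, F) f q) :
    modelDeriv 𝕜 E V (g ∘ f) q = (modelDeriv 𝕜 F V g (f q)).comp (modelDeriv 𝕜 E F f q) :=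
  mfderiv_comp q hg hf

theorem modelDeriv_id (q : M) : modelDeriv 𝕜 E E (id : M → M) q = ContinuousLinearMap.id 𝕜 E :=
  mfderiv_id

/-- The derivative of multiplication at (1, 1) is addition, since multiplication restricts to the
identity on each factor. -/
theorem modelDeriv_mul [Group G] {n : ℕ∞ω} [ContMDiffMul 𝓘(𝕜, V) n G] (hn : n ≠ 0) {u w : M → G}
    {q : M} (hu : MDifferentiableAt 𝓘(𝕜, E) 𝓘(𝕜, V) u q)
    (hw : MDifferentiableAt 𝓘(𝕜, E) 𝓘(𝕜, V) w q) (hu1 : u q = 1) (hw1 : w q = 1) :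
    modelDeriv 𝕜 E V (fun x => u x * w x) q = modelDeriv 𝕜 E V u q + modelDeriv 𝕜 E V w q := by
  have hmul : MDifferentiable (𝓘(𝕜, V).prod 𝓘(𝕜, V)) 𝓘(𝕜, V) (fun p : G × G => p.1 * p.2) :=
    (contMDiff_mul 𝓘(𝕜, V) n).mdifferentiable hn
  have h1 := mfderiv_comp q (I := 𝓘(𝕜, E)) (I'' := 𝓘(𝕜, V)) (hmul (u q, w q)) (hu.prodMk hw)
  have h2 : ∀ a b : V, (mfderiv (𝓘(𝕜, V).prod 𝓘(𝕜, V)) 𝓘(𝕜, V) (fun p : G × G => p.1 * p.2) (1, 1) :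
      V × V →L[𝕜] V) (a, b) = a + b := fun a b => by
    have h3 := mfderiv_prod_eq_add_apply (v := ((a, b) : V × V)) (hmul (1, 1))
    have h4 : (fun z : G => z * 1) = id := by ext; simp
    have h5 : (fun z : G => 1 * z) = id := by ext; simp
    refine h3.trans ?_
    change (modelDeriv 𝕜 V V (fun z : G => z * 1) 1) a +
      (modelDeriv 𝕜 V V (fun z : G => 1 * z) 1) b = _
    rw [h4, h5, modelDeriv_id]
    rfl
  rw [mfderiv_prodMk hu hw] at h1
  ext v
  have h6 := congrArg (fun L : E →L[𝕜] V => L v) h1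
  refine h6.trans ?_
  change (mfderiv (𝓘(𝕜, V).prod 𝓘(𝕜, V)) 𝓘(𝕜, V) (fun p : G × G => p.1 * p.2) (u q, w q) :
      V × V →L[𝕜] V) (modelDeriv 𝕜 E V u q v, modelDeriv 𝕜 E V w q v) = _
  rw [hu1, hw1, h2]
  rfl

variable [Group G] [MulAction G M] {n : ℕ∞ω}

theorem mdifferentiable_smul_const [ContMDiffSMul 𝓘(𝕜, V) 𝓘(𝕜, E) n G M] (hn : n ≠ 0) (q : M) :
    MDifferentiable 𝓘(𝕜, V) 𝓘(𝕜, E) (fun g : G => g • q) :=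
  ((contMDiff_smul (I := 𝓘(𝕜, V)) (I' := 𝓘(𝕜, E)) (n := n) (G := G) (M := M)).comp
    (contMDiff_id.prodMk contMDiff_const)).mdifferentiable hn

theorem mdifferentiable_const_smul [ContMDiffSMul 𝓘(𝕜, V) 𝓘(𝕜, E) n G M] (hn : n ≠ 0) (g : G) :
    MDifferentiable 𝓘(𝕜, E) 𝓘(𝕜, E) (fun q : M => g • q) :=
  ((contMDiff_smul (I := 𝓘(𝕜, V)) (I' := 𝓘(𝕜, E)) (n := n) (G := G) (M := M)).comp
    (contMDiff_const.prodMk contMDiff_id)).mdifferentiable hn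

/-- The fundamental vector field as a linear map. -/
def fundamentalFieldₗ (q : M) : GroupLieAlgebra 𝓘(𝕜, V) G →ₗ[𝕜] TangentSpace 𝓘(𝕜, E) q :=
  (-(modelDeriv 𝕜 V E (fun g : G => g • q) 1 : V →L[𝕜] E) : V →L[𝕜] E).toLinearMap

theorem dirDeriv_fundamentalField [ContMDiffSMul 𝓘(𝕜, V) 𝓘(𝕜, E) n G M] (hn : n ≠ 0)
    {f : M → 𝕜} (hf : MDifferentiable 𝓘(𝕜, E) 𝓘(𝕜, 𝕜) f) (hf' : ∀ (g : G) q, f (g • q) = f q)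
    (X : GroupLieAlgebra 𝓘(𝕜, V) G) (q : M) : dirDeriv (E := E) f q (fundamentalField X q) = 0 := by
  have h1 : f ∘ (fun g : G => g • q) = fun _ => f q := by
    ext g; exact hf' g q
  have h2 := modelDeriv_comp (hf _) (mdifferentiable_smul_const (𝕜 := 𝕜) (V := V) (G := G) hn q 1)
  rw [h1, one_smul] at h2
  have h3 : modelDeriv 𝕜 V 𝕜 (fun _ : G => f q) 1 = 0 := mfderiv_const
  rw [h3] at h2
  have h4 := congrArg (fun L : V →L[𝕜] 𝕜 => L X) h2
  refine ((modelDeriv 𝕜 E 𝕜 f q).map_neg _).trans ?_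
  exact (congrArg Neg.neg h4.symm).trans neg_zero

theorem maurerCartanLeft_fundamentalField [LieGroup 𝓘(𝕜, V) n G]
    [ContMDiffSMul 𝓘(𝕜, V) 𝓘(𝕜, E) n G M] (hn : n ≠ 0) {Φ : M → G}
    (hΦ : MDifferentiable 𝓘(𝕜, E) 𝓘(𝕜, V) Φ) (hΦ' : ∀ (g : G) q, Φ (g • q) = g * Φ q * g⁻¹)
    (X : GroupLieAlgebra 𝓘(𝕜, V) G) (q : M) :
    maurerCartanLeft (Φ q) (mfderiv 𝓘(𝕜, E) 𝓘(𝕜, V) Φ q (fundamentalField X q)) =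
      X - adjointAction (Φ q)⁻¹ X := by
  let p := Φ q
  -- By equivariance h g * g = p⁻¹ g p. Differentiating at g = 1 gives dh + id = Ad (p⁻¹), and the
  -- sign in the fundamental field turns this into X - Ad (p⁻¹) X.
  let h : G → G := (fun x => p⁻¹ * x) ∘ Φ ∘ fun g : G => g • q
  have hs := mdifferentiable_smul_const (𝕜 := 𝕜) (V := V) (G := G) (E := E) (n := n) hn q
  have hl := mdifferentiable_mul_left' (𝕜 := 𝕜) (V := V) (n := n) hn p⁻¹
  have hh : MDifferentiableAt 𝓘(𝕜, V) 𝓘(𝕜, V) h 1 :=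
    (hl _).comp 1 ((hΦ _).comp 1 (hs 1))
  have h1 : modelDeriv 𝕜 V V h 1 = (modelDeriv 𝕜 V V (fun x => p⁻¹ * x) p).comp
      ((modelDeriv 𝕜 E V Φ q).comp (modelDeriv 𝕜 V E (fun g : G => g • q) 1)) := by
    have h2 := modelDeriv_comp (f := Φ ∘ fun g : G => g • q) (hl (Φ ((1 : G) • q)))
      ((hΦ ((1 : G) • q)).comp 1 (hs 1))
    have h3 := modelDeriv_comp (f := fun g : G => g • q) (hΦ ((1 : G) • q)) (hs 1)
    have h4 : modelDeriv 𝕜 V V h 1 = (modelDeriv 𝕜 V V (fun x => p⁻¹ * x) (Φ ((1 : G) • q))).comp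
      (modelDeriv 𝕜 V V (Φ ∘ fun g : G => g • q) 1) := h2
    rw [h4, h3, one_smul]
  have h5 : (fun g => h g * id g) = fun x => p⁻¹ * x * p⁻¹⁻¹ := by
    ext g
    simp [h, hΦ', p, mul_assoc]
  have h6 := modelDeriv_mul hn hh mdifferentiableAt_id (by simp [h, p]) rfl
  rw [h5, modelDeriv_id, h1] at h6
  have h7 := congrArg (fun L : V →L[𝕜] V => L X) h6
  have h8 : (adjointAction p⁻¹ X : V) = modelDeriv 𝕜 V V (fun x => p⁻¹ * x) p
      (modelDeriv 𝕜 E V Φ q (modelDeriv 𝕜 V E (fun g : G => g • q) 1 X)) + (show V from X) := h7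
  have h9 : (maurerCartanLeft (Φ q) (mfderiv 𝓘(𝕜, E) 𝓘(𝕜, V) Φ q (fundamentalField X q)) : V) =
      modelDeriv 𝕜 V V (fun x => p⁻¹ * x) p
        (modelDeriv 𝕜 E V Φ q (-modelDeriv 𝕜 V E (fun g : G => g • q) 1 X)) := rfl
  have h10 : ∀ a b c : V, a = b + c → -b = c - a := fun a b c h => by rw [h]; abel
  refine h9.trans ?_
  rw [map_neg, map_neg]
  exact h10 _ _ _ h8

end Deriv

section Pointwise

variable {𝕜 : Type*} [RCLike 𝕜] {n : ℕ∞ω}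
  {V : Type*} [NormedAddCommGroup V] [NormedSpace 𝕜 V]
  {G : Type*} [TopologicalSpace G] [ChartedSpace V G] [Group G]
  {E : Type*} [NormedAddCommGroup E] [NormedSpace 𝕜 E]
  {M : Type*} [TopologicalSpace M] [ChartedSpace E M] [IsManifold 𝓘(𝕜, E) 1 M] [MulAction G M]
  {B : LinearMap.BilinForm 𝕜 (GroupLieAlgebra 𝓘(𝕜, V) G)}
  (S : QuasiHamiltonian (E := E) (M := M) n B)

/-- The value of the `2`-form at a point as a bilinear form. -/
def QuasiHamiltonian.formAt (q : M) : LinearMap.BilinForm 𝕜 (TangentSpace 𝓘(𝕜, E) q) :=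
  LinearMap.mk₂ 𝕜 (fun v w => S.σ q v w) (fun v v' w => by rw [map_add]; rfl)
    (fun c v w => by rw [map_smul]; rfl) (fun v w w' => map_add _ _ _)
    (fun c v w => map_smul _ _ _)

theorem QuasiHamiltonian.skew (q : M) (v w : TangentSpace 𝓘(𝕜, E) q) :
    S.σ q v w = -S.σ q w v := by
  have h := S.alternating q (v + w)
  have h1 : S.σ q (v + w) (v + w) = S.σ q v v + S.σ q v w + (S.σ q w v + S.σ q w w) := by
    rw [map_add (S.σ q), _root_.add_apply, map_add, map_add]
  rw [h1, S.alternating, S.alternating, zero_add, add_zero] at h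
  exact eq_neg_of_add_eq_zero_left h

theorem QuasiHamiltonian.hamiltonianVector_unique {q : M} {v v' : TangentSpace 𝓘(𝕜, E) q}
    (h : ∀ w, S.σ q v w = S.σ q v' w)
    (hv : mfderiv 𝓘(𝕜, E) 𝓘(𝕜, V) S.Φ q v = 0) (hv' : mfderiv 𝓘(𝕜, E) 𝓘(𝕜, V) S.Φ q v' = 0) :
    v = v' := by
  rw [← sub_eq_zero]
  refine S.nondegenerate q _ (fun w => ?_) ?_
  · rw [map_sub, _root_.sub_apply, h, sub_self]
  · rw [map_sub, hv, hv', sub_self]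

/-- The value at a point of the form `v ↦ ω (dΦ v)`. -/
def QuasiHamiltonian.logDeriv (q : M) :
    TangentSpace 𝓘(𝕜, E) q →ₗ[𝕜] GroupLieAlgebra 𝓘(𝕜, V) G :=
  maurerCartanLeftₗ (S.Φ q) ∘ₗ (mfderiv 𝓘(𝕜, E) 𝓘(𝕜, V) S.Φ q).toLinearMap

theorem QuasiHamiltonian.exists_hamiltonianVector [LieGroup 𝓘(𝕜, V) n G]
    [FiniteDimensional 𝕜 E] [ContMDiffSMul 𝓘(𝕜, V) 𝓘(𝕜, E) n G M] (hn : n ≠ 0) (hB : B.IsSymm)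
    (hB0 : B.Nondegenerate) (hAd : IsAdInvariant B) {f : M → 𝕜}
    (hf : MDifferentiable 𝓘(𝕜, E) 𝓘(𝕜, 𝕜) f) (hf' : ∀ (g : G) q, f (g • q) = f q) (q : M) :
    ∃ v : TangentSpace 𝓘(𝕜, E) q, (∀ w, S.σ q v w = dirDeriv f q w) ∧
      mfderiv 𝓘(𝕜, E) 𝓘(𝕜, V) S.Φ q v = 0 := by
  have hfd : FiniteDimensional 𝕜 (TangentSpace 𝓘(𝕜, E) q) :=
    inferInstanceAs (FiniteDimensional 𝕜 E)
  have hΦ : MDifferentiable 𝓘(𝕜, E) 𝓘(𝕜, V) S.Φ := S.contMDiff_Φ.mdifferentiable hn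
  let α : TangentSpace 𝓘(𝕜, E) q →ₗ[𝕜] 𝕜 := (modelDeriv 𝕜 E 𝕜 f q).toLinearMap
  have hsep : ∀ x, (∀ y, B y x = 0) → x = 0 := fun x hx => hB0.2 x hx
  have hinj : ∀ v, (∀ w, S.formAt q v w = 0) → S.logDeriv q v = 0 → v = 0 := fun v h h' =>
    S.nondegenerate q v h (eq_zero_of_maurerCartanLeft_eq_zero (n := n) hn h')
  obtain ⟨w, x, hwx⟩ := exists_expansion_of_injective (S.formAt q) (S.alternating q) B hsep
    (S.logDeriv q) hinj α
  obtain ⟨v, hv, hv'⟩ := exists_flat_eq_of_expansion (c := (2 : 𝕜)⁻¹) (mul_inv_cancel₀ two_ne_zero)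
    (S.formAt q) (S.alternating q) B (fun x y => hB.eq x y) hsep (S.logDeriv q)
    (adjointActionₗ (S.Φ q)) (adjointActionₗ (S.Φ q)⁻¹)
    (fun x => adjointAction_adjointAction_inv (n := n) hn _ x)
    (fun x => by
      have := adjointAction_adjointAction_inv (n := n) hn (S.Φ q)⁻¹ x
      rw [inv_inv] at this
      exact this)
    (fun x y => hAd _ x y) (fundamentalFieldₗ q)
    (fun X v => by
      have h := S.momentum X q v
      rw [maurerCartanRight_eq (n := n) hn] at h
      exact h)
    (fun X => maurerCartanLeft_fundamentalField hn hΦ S.equivariant X q) α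
    (fun X => dirDeriv_fundamentalField (n := n) hn hf hf' X q) w x hwx
  exact ⟨v, hv, eq_zero_of_maurerCartanLeft_eq_zero (n := n) hn hv'⟩

end Pointwise

end QuasiHam

end

/-! ### Regularity of the Hamiltonian field -/

noncomputable section

namespace QuasiHam

open Filter Topology

section Smooth

variable {𝕜 : Type*} [RCLike 𝕜] {n : ℕ∞ω}
  {E : Type*} [NormedAddCommGroup E] [NormedSpace 𝕜 E]
  {M : Type*} [TopologicalSpace M] [ChartedSpace E M]
  {F : Type*} [NormedAddCommGroup F] [NormedSpace 𝕜 F]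
  {N : Type*} [TopologicalSpace N] [ChartedSpace F N]

/-- Cramer's rule: the coefficients of a solution of a linear system with linearly independent
columns depend smoothly on the data. -/
theorem contMDiffAt_of_sum_smul_eq {ι W : Type*} [Fintype ι] [NormedAddCommGroup W]
    [NormedSpace 𝕜 W] [FiniteDimensional 𝕜 W] {q₀ : M} {l : ι → M → W} {r : M → W} {c : ι → M → 𝕜}
    (hl : ∀ i, ContMDiffAt 𝓘(𝕜, E) 𝓘(𝕜, W) n (l i) q₀) (hr : ContMDiffAt 𝓘(𝕜, E) 𝓘(𝕜, W) n r q₀)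
    (hli : LinearIndependent 𝕜 fun i => l i q₀) (hc : ∀ᶠ q in 𝓝 q₀, ∑ i, c i q • l i q = r q)
    (i : ι) : ContMDiffAt 𝓘(𝕜, E) 𝓘(𝕜, 𝕜) n (c i) q₀ := by
  classical
  -- A left inverse of the column matrix at q₀ makes the overdetermined system square: A q is L
  -- after the columns at q. It equals 1 at q₀ and so is invertible nearby.
  obtain ⟨L₀, hL₀⟩ := (Fintype.linearCombination 𝕜 fun i => l i q₀).exists_leftInverse_of_injective
    (LinearMap.ker_eq_bot.2 hli.fintypeLinearCombination_injective)
  let L : W →L[𝕜] (ι → 𝕜) := LinearMap.toContinuousLinearMap L₀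
  let A : M → (ι → 𝕜) →L[𝕜] (ι → 𝕜) := fun q =>
    ∑ i, (ContinuousLinearMap.proj (R := 𝕜) (φ := fun _ : ι => 𝕜) i).smulRight (L (l i q))
  have hA : ContMDiffAt 𝓘(𝕜, E) 𝓘(𝕜, (ι → 𝕜) →L[𝕜] (ι → 𝕜)) n A q₀ := by
    refine contMDiffAt_finsetSum fun i _ => ?_
    exact ((ContinuousLinearMap.smulRightL 𝕜 (ι → 𝕜) (ι → 𝕜)
      (ContinuousLinearMap.proj i)).comp L).contDiff.contDiffAt.comp_contMDiffAt (hl i)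
  have hAapp : ∀ q (x : ι → 𝕜), A q x = L (∑ i, x i • l i q) := fun q x => by
    simp [A]
  have hA0 : A q₀ = 1 := by
    ext1 x
    rw [hAapp]
    exact LinearMap.congr_fun hL₀ x
  have hunit : ∀ᶠ q in 𝓝 q₀, IsUnit (A q) :=
    hA.continuousAt.eventually (Units.isOpen.mem_nhds (by rw [hA0]; exact isUnit_one))
  have hinv : ContMDiffAt 𝓘(𝕜, E) 𝓘(𝕜, (ι → 𝕜) →L[𝕜] (ι → 𝕜)) n
      (fun q => Ring.inverse (A q)) q₀ := by
    have h1 := contDiffAt_ringInverse (n := n) 𝕜 (1 : ((ι → 𝕜) →L[𝕜] (ι → 𝕜))ˣ)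
    rw [Units.val_one, ← hA0] at h1
    exact h1.comp_contMDiffAt hA
  have hsol : ContMDiffAt 𝓘(𝕜, E) 𝓘(𝕜, ι → 𝕜) n (fun q => Ring.inverse (A q) (L (r q))) q₀ :=
    hinv.clm_apply (L.contDiff.contDiffAt.comp_contMDiffAt hr)
  have heq : (fun q => fun i => c i q) =ᶠ[𝓝 q₀] fun q => Ring.inverse (A q) (L (r q)) := by
    filter_upwards [hc, hunit] with q hq hu
    rw [← hq, ← hAapp q (fun i => c i q), ← mul_apply_eq_comp, Ring.inverse_mul_cancel _ hu]
    rfl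
  exact (contMDiffAt_pi_space.1 (hsol.congr_of_eventuallyEq heq)) i

/-- In the classes ∞ and ω taking a derivative costs nothing. -/
theorem add_one_le_self (hn : n = ∞ ∨ n = ω) : n + 1 ≤ n := by
  rcases hn with rfl | rfl <;> simp

theorem ne_zero_of_smooth (hn : n = ∞ ∨ n = ω) : n ≠ 0 := by
  rcases hn with rfl | rfl <;> simp

variable [IsManifold 𝓘(𝕜, E) 1 M] [IsManifold 𝓘(𝕜, F) 1 N]

theorem contMDiffAt_mfderiv_apply [IsManifold 𝓘(𝕜, E) n M] [IsManifold 𝓘(𝕜, F) n N]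
    (hn : n = ∞ ∨ n = ω) {f : M → N} (hf : ContMDiff 𝓘(𝕜, E) 𝓘(𝕜, F) n f)
    {u : ∀ q : M, TangentSpace 𝓘(𝕜, E) q} {q : M}
    (hu : ContMDiffAt 𝓘(𝕜, E) 𝓘(𝕜, E).tangent n
      (fun x => (⟨x, u x⟩ : TangentBundle 𝓘(𝕜, E) M)) q) :
    ContMDiffAt 𝓘(𝕜, E) 𝓘(𝕜, F).tangent n
      (fun x => (⟨f x, mfderiv 𝓘(𝕜, E) 𝓘(𝕜, F) f x (u x)⟩ : TangentBundle 𝓘(𝕜, F) N)) q :=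
  (hf.contMDiff_tangentMap (add_one_le_self hn)).contMDiffAt.comp q hu

theorem contMDiffAt_dirDeriv [IsManifold 𝓘(𝕜, E) n M] (hn : n = ∞ ∨ n = ω) {f : M → 𝕜}
    (hf : ContMDiff 𝓘(𝕜, E) 𝓘(𝕜, 𝕜) n f)
    {u : ∀ q : M, TangentSpace 𝓘(𝕜, E) q} {q : M}
    (hu : ContMDiffAt 𝓘(𝕜, E) 𝓘(𝕜, E).tangent n
      (fun x => (⟨x, u x⟩ : TangentBundle 𝓘(𝕜, E) M)) q) :
    ContMDiffAt 𝓘(𝕜, E) 𝓘(𝕜, 𝕜) n (fun x => dirDeriv f x (u x)) q :=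
  (contMDiff_snd_tangentBundle_modelSpace 𝕜 𝓘(𝕜, 𝕜)).contMDiffAt.comp q
    (contMDiffAt_mfderiv_apply hn hf hu)

end Smooth

section HamiltonianField

variable {𝕜 : Type*} [RCLike 𝕜] {n : ℕ∞ω}
  {V : Type*} [NormedAddCommGroup V] [NormedSpace 𝕜 V]
  {G : Type*} [TopologicalSpace G] [ChartedSpace V G] [Group G]
  {E : Type*} [NormedAddCommGroup E] [NormedSpace 𝕜 E]
  {M : Type*} [TopologicalSpace M] [ChartedSpace E M] [IsManifold 𝓘(𝕜, E) 1 M]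
  [MulAction G M] {B : LinearMap.BilinForm 𝕜 (GroupLieAlgebra 𝓘(𝕜, V) G)}
  (S : QuasiHamiltonian (E := E) (M := M) n B)

theorem QuasiHamiltonian.contMDiffAt_form {q : M} {u v : ∀ q : M, TangentSpace 𝓘(𝕜, E) q}
    (hu : ContMDiffAt 𝓘(𝕜, E) 𝓘(𝕜, E).tangent n
      (fun x => (⟨x, u x⟩ : TangentBundle 𝓘(𝕜, E) M)) q)
    (hv : ContMDiffAt 𝓘(𝕜, E) 𝓘(𝕜, E).tangent n
      (fun x => (⟨x, v x⟩ : TangentBundle 𝓘(𝕜, E) M)) q) :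
    ContMDiffAt 𝓘(𝕜, E) 𝓘(𝕜, 𝕜) n (fun x => S.σ x (u x) (v x)) q := by
  have h : ContMDiffAt 𝓘(𝕜, E) (𝓘(𝕜, E).prod 𝓘(𝕜, 𝕜)) n
      (fun x => Bundle.TotalSpace.mk' 𝕜 (E := Bundle.Trivial M 𝕜) x (S.σ x (u x) (v x))) q :=
    ContMDiffAt.clm_bundle_apply₂ (F₁ := E) (F₂ := E) S.contMDiff_σ.contMDiffAt hu hv
  rw [Bundle.contMDiffAt_totalSpace] at h
  exact h.2

/-- In a local frame s, the two equations for X form a linear system of class n for its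
coefficients. Its columns `l i` are the images of the `s i` under v ↦ (σ(v, ·), dΦ v), independent
by non-degeneracy, so Cramer's rule applies. -/
theorem QuasiHamiltonian.contMDiff_of_isHamiltonian [FiniteDimensional 𝕜 V]
    [FiniteDimensional 𝕜 E] [IsManifold 𝓘(𝕜, E) n M] [IsManifold 𝓘(𝕜, V) n G]
    (hn : n = ∞ ∨ n = ω) {f : M → 𝕜} (hf : ContMDiff 𝓘(𝕜, E) 𝓘(𝕜, 𝕜) n f)
    {X : ∀ q : M, TangentSpace 𝓘(𝕜, E) q} (hX : ∀ q v, S.σ q (X q) v = dirDeriv f q v)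
    (hX' : ∀ q, mfderiv 𝓘(𝕜, E) 𝓘(𝕜, V) S.Φ q (X q) = 0) :
    ContMDiff 𝓘(𝕜, E) 𝓘(𝕜, E).tangent n
      (fun q => (⟨q, X q⟩ : TangentBundle 𝓘(𝕜, E) M)) := by
  intro q₀
  have : IsManifold 𝓘(𝕜, E) (n + 1) M := IsManifold.of_le (add_one_le_self hn)
  have : IsManifold 𝓘(𝕜, V) 1 G :=
    IsManifold.of_le (ENat.one_le_iff_ne_zero_withTop.2 (ne_zero_of_smooth hn))
  have : IsManifold 𝓘(𝕜, V) (n + 1) G := IsManifold.of_le (add_one_le_self hn)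
  have : ContMDiffVectorBundle n E (TangentSpace 𝓘(𝕜, E) : M → Type _) 𝓘(𝕜, E) :=
    TangentBundle.contMDiffVectorBundle
  have : ContMDiffVectorBundle n V (TangentSpace 𝓘(𝕜, V) : G → Type _) 𝓘(𝕜, V) :=
    TangentBundle.contMDiffVectorBundle
  let b := Module.finBasis 𝕜 E
  let e := trivializationAt E (TangentSpace 𝓘(𝕜, E)) q₀
  let e' := trivializationAt V (TangentSpace 𝓘(𝕜, V)) (S.Φ q₀)
  have hq₀ : q₀ ∈ e.baseSet := FiberBundle.mem_baseSet_trivializationAt' q₀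
  have hp₀ : S.Φ q₀ ∈ e'.baseSet := FiberBundle.mem_baseSet_trivializationAt' (S.Φ q₀)
  let s := e.localFrame b
  have hs : ∀ i, ContMDiffAt 𝓘(𝕜, E) 𝓘(𝕜, E).tangent n
      (fun x => (⟨x, s i x⟩ : TangentBundle 𝓘(𝕜, E) M)) q₀ := fun i =>
    contMDiffAt_localFrame_of_mem n e b i hq₀
  have hfr := e.isLocalFrameOn_localFrame_baseSet 𝓘(𝕜, E) n b
  let c : Fin (Module.finrank 𝕜 E) → M → 𝕜 := fun i q => b.repr (e ⟨q, X q⟩).2 i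
  have hXs : ∀ q ∈ e.baseSet, ∑ i, c i q • s i q = X q := fun q hq => by
    rw [← (e.basisAt b hq).sum_repr (X q)]
    refine Finset.sum_congr rfl fun i _ => ?_
    simp [c, s, hq, Bundle.Trivialization.basisAt]
  let l : Fin (Module.finrank 𝕜 E) → M → (Fin (Module.finrank 𝕜 E) → 𝕜) × V := fun i q =>
    (fun j => S.σ q (s i q) (s j q), (e' ⟨S.Φ q, mfderiv 𝓘(𝕜, E) 𝓘(𝕜, V) S.Φ q (s i q)⟩).2)
  let r : M → (Fin (Module.finrank 𝕜 E) → 𝕜) × V := fun q => (fun j => dirDeriv f q (s j q), 0)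
  have hl : ∀ i, ContMDiffAt 𝓘(𝕜, E) 𝓘(𝕜, (Fin (Module.finrank 𝕜 E) → 𝕜) × V) n (l i) q₀ :=
    fun i => (contMDiffAt_pi_space.2 fun j => S.contMDiffAt_form (hs i) (hs j)).prodMk_space
      (Bundle.contMDiffAt_totalSpace.1 (contMDiffAt_mfderiv_apply hn S.contMDiff_Φ (hs i))).2
  have hr : ContMDiffAt 𝓘(𝕜, E) 𝓘(𝕜, (Fin (Module.finrank 𝕜 E) → 𝕜) × V) n r q₀ :=
    (contMDiffAt_pi_space.2 fun j => contMDiffAt_dirDeriv hn hf (hs j)).prodMk_space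
      contMDiffAt_const
  have hsum : ∀ q ∈ e.baseSet, S.Φ q ∈ e'.baseSet → ∀ a : Fin (Module.finrank 𝕜 E) → 𝕜,
      ∑ i, a i • l i q = (fun j => S.σ q (∑ i, a i • s i q) (s j q),
        (e' ⟨S.Φ q, mfderiv 𝓘(𝕜, E) 𝓘(𝕜, V) S.Φ q (∑ i, a i • s i q)⟩).2) := by
    intro q hq hp a
    refine Prod.ext ?_ ?_
    · rw [Prod.fst_sum]
      ext j
      rw [Finset.sum_apply]
      refine Eq.trans ?_ (map_sum ((S.formAt q).flip (s j q)) (fun i => a i • s i q)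
        Finset.univ).symm
      exact Finset.sum_congr rfl fun i _ =>
        (map_smul ((S.formAt q).flip (s j q)) (a i) (s i q)).symm
    · rw [Prod.snd_sum]
      let T : TangentSpace 𝓘(𝕜, E) q →L[𝕜] V :=
        (e'.continuousLinearEquivAt 𝕜 _ hp).toContinuousLinearMap.comp
          (mfderiv 𝓘(𝕜, E) 𝓘(𝕜, V) S.Φ q)
      refine Eq.trans ?_ (map_sum T (fun i => a i • s i q) Finset.univ).symm
      exact Finset.sum_congr rfl fun i _ => (map_smul T (a i) (s i q)).symm
  have hdet : ∀ v : TangentSpace 𝓘(𝕜, E) q₀, (∀ j, S.σ q₀ v (s j q₀) = 0) →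
      (e' ⟨S.Φ q₀, mfderiv 𝓘(𝕜, E) 𝓘(𝕜, V) S.Φ q₀ v⟩).2 = 0 → v = 0 := by
    intro v hv hv'
    refine S.nondegenerate q₀ v (fun w => ?_) ?_
    · rw [← (hfr.toBasisAt hq₀).sum_repr w, map_sum]
      refine Finset.sum_eq_zero fun j _ => ?_
      rw [map_smul, hfr.toBasisAt_coe]
      erw [hv j, smul_zero]
    · exact (e'.continuousLinearEquivAt 𝕜 _ hp₀).map_eq_zero_iff.1 hv'
  have hli : LinearIndependent 𝕜 fun i => l i q₀ := by
    rw [Fintype.linearIndependent_iff]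
    intro a ha
    rw [hsum q₀ hq₀ hp₀] at ha
    have h := hdet _ (fun j => congrFun (congrArg Prod.fst ha) j) (congrArg Prod.snd ha)
    exact Fintype.linearIndependent_iff.1 (hfr.linearIndependent hq₀) a h
  have hc : ∀ᶠ q in 𝓝 q₀, ∑ i, c i q • l i q = r q := by
    filter_upwards [e.open_baseSet.mem_nhds hq₀,
      S.contMDiff_Φ.continuous.continuousAt.preimage_mem_nhds (e'.open_baseSet.mem_nhds hp₀)]
      with q hq hp
    rw [hsum q hq hp, hXs q hq]
    refine Prod.ext (funext fun j => hX q _) ?_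
    rw [hX']
    exact (e'.continuousLinearEquivAt 𝕜 _ hp).map_zero
  have hsm := contMDiffAt_of_sum_smul_eq hl hr hli hc
  refine (e.contMDiffAt_section_iff hq₀).2 ?_
  have h : (fun q => (e ⟨q, X q⟩).2) = fun q => ∑ i, c i q • b i :=
    funext fun q => (b.sum_repr _).symm
  rw [h]
  exact contMDiffAt_finsetSum fun i _ => (hsm i).smul contMDiffAt_const

end HamiltonianField

end QuasiHam

end

/-! ### The Lie bracket as a commutator of derivations -/

noncomputable section

namespace QuasiHam

open Filter Topology

section LieBracket

variable {𝕜 : Type*} [RCLike 𝕜] {n : ℕ∞ω}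
  {E : Type*} [NormedAddCommGroup E] [NormedSpace 𝕜 E]
  {M : Type*} [TopologicalSpace M] [ChartedSpace E M]

/-- A vector field read in a chart. -/
def chartField (q₀ : M) (u : ∀ q : M, TangentSpace 𝓘(𝕜, E) q) (y : E) : E :=
  (modelDeriv 𝕜 E E (extChartAt 𝓘(𝕜, E) q₀).symm y).inverse (u ((extChartAt 𝓘(𝕜, E) q₀).symm y))

theorem mpullbackWithin_extChartAt_symm (q₀ : M) (u : ∀ q : M, TangentSpace 𝓘(𝕜, E) q) :
    VectorField.mpullbackWithin 𝓘(𝕜, E) 𝓘(𝕜, E) (extChartAt 𝓘(𝕜, E) q₀).symm u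
      (Set.range 𝓘(𝕜, E)) = chartField q₀ u := by
  funext y
  rw [VectorField.mpullbackWithin_apply]
  simp only [modelWithCornersSelf_coe, Set.range_id, mfderivWithin_univ]
  rfl

theorem dirDeriv_eq_fderiv {k : M → 𝕜} {q₀ : M} (hk : MDifferentiableAt 𝓘(𝕜, E) 𝓘(𝕜, 𝕜) k q₀)
    (v : TangentSpace 𝓘(𝕜, E) q₀) :
    dirDeriv k q₀ v = fderiv 𝕜 (k ∘ (extChartAt 𝓘(𝕜, E) q₀).symm) (extChartAt 𝓘(𝕜, E) q₀ q₀) v := by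
  have h : modelDeriv 𝕜 E 𝕜 k q₀ =
      fderiv 𝕜 (k ∘ (extChartAt 𝓘(𝕜, E) q₀).symm) (extChartAt 𝓘(𝕜, E) q₀ q₀) := by
    refine (hk.mfderiv).trans ?_
    simp only [modelWithCornersSelf_coe, Set.range_id, fderivWithin_univ]
    rfl
  exact congrArg (fun L : E →L[𝕜] 𝕜 => L v) h

variable [IsManifold 𝓘(𝕜, E) 1 M]

/-- The tangent space at q₀ is identified with E by this very chart. -/
theorem modelDeriv_extChartAt (q₀ : M) :
    modelDeriv 𝕜 E E (extChartAt 𝓘(𝕜, E) q₀) q₀ = ContinuousLinearMap.id 𝕜 E := by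
  have hk : MDifferentiableAt 𝓘(𝕜, E) 𝓘(𝕜, E) (extChartAt 𝓘(𝕜, E) q₀) q₀ :=
    mdifferentiableAt_extChartAt (mem_chart_source E q₀)
  have h : modelDeriv 𝕜 E E (extChartAt 𝓘(𝕜, E) q₀) q₀ =
      fderiv 𝕜 (extChartAt 𝓘(𝕜, E) q₀ ∘ (extChartAt 𝓘(𝕜, E) q₀).symm)
        (extChartAt 𝓘(𝕜, E) q₀ q₀) := by
    refine (hk.mfderiv).trans ?_
    simp only [modelWithCornersSelf_coe, Set.range_id, fderivWithin_univ]
    rfl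
  have h1 : extChartAt 𝓘(𝕜, E) q₀ ∘ (extChartAt 𝓘(𝕜, E) q₀).symm
      =ᶠ[𝓝 (extChartAt 𝓘(𝕜, E) q₀ q₀)] id := by
    filter_upwards [extChartAt_target_mem_nhds q₀] with y hy
    exact (extChartAt 𝓘(𝕜, E) q₀).right_inv hy
  rw [h, h1.fderiv_eq, fderiv_id]

theorem isInvertible_modelDeriv_extChartAt_symm {q₀ : M} {y : E}
    (hy : y ∈ (extChartAt 𝓘(𝕜, E) q₀).target) :
    (modelDeriv 𝕜 E E (extChartAt 𝓘(𝕜, E) q₀).symm y).IsInvertible := by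
  have h := isInvertible_mfderivWithin_extChartAt_symm hy
  simp only [modelWithCornersSelf_coe, Set.range_id, mfderivWithin_univ] at h
  exact h

theorem mdifferentiableAt_extChartAt_symm' {q₀ : M} {y : E}
    (hy : y ∈ (extChartAt 𝓘(𝕜, E) q₀).target) :
    MDifferentiableAt 𝓘(𝕜, E) 𝓘(𝕜, E) (extChartAt 𝓘(𝕜, E) q₀).symm y := by
  have h := mdifferentiableWithinAt_extChartAt_symm hy
  simp only [modelWithCornersSelf_coe, Set.range_id, mdifferentiableWithinAt_univ] at h
  exact h

theorem chartField_self (q₀ : M) (u : ∀ q : M, TangentSpace 𝓘(𝕜, E) q) :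
    chartField q₀ u (extChartAt 𝓘(𝕜, E) q₀ q₀) = u q₀ := by
  have hy := mem_extChartAt_target (I := 𝓘(𝕜, E)) q₀
  have h := modelDeriv_comp (f := extChartAt 𝓘(𝕜, E) q₀) (mdifferentiableAt_extChartAt_symm' hy)
    (mdifferentiableAt_extChartAt (mem_chart_source E q₀))
  have h1 : (extChartAt 𝓘(𝕜, E) q₀).symm ∘ extChartAt 𝓘(𝕜, E) q₀ =ᶠ[𝓝 q₀] id := by
    filter_upwards [extChartAt_source_mem_nhds (I := 𝓘(𝕜, E)) q₀] with x hx
    exact (extChartAt 𝓘(𝕜, E) q₀).left_inv hx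
  have h2 : modelDeriv 𝕜 E E ((extChartAt 𝓘(𝕜, E) q₀).symm ∘ extChartAt 𝓘(𝕜, E) q₀) q₀ =
      ContinuousLinearMap.id 𝕜 E := h1.mfderiv_eq.trans mfderiv_id
  rw [modelDeriv_extChartAt, ContinuousLinearMap.comp_id, h2] at h
  have h3 : ∀ p : M, p = q₀ → (u p : E) = u q₀ := fun p hp => by rw [hp]
  rw [chartField, ← h, ContinuousLinearMap.inverse_id]
  exact h3 _ (extChartAt_to_inv q₀)

theorem fderiv_chartField {h : M → 𝕜} (hh : MDifferentiable 𝓘(𝕜, E) 𝓘(𝕜, 𝕜) h) {q₀ : M}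
    (u : ∀ q : M, TangentSpace 𝓘(𝕜, E) q) {y : E} (hy : y ∈ (extChartAt 𝓘(𝕜, E) q₀).target) :
    fderiv 𝕜 (h ∘ (extChartAt 𝓘(𝕜, E) q₀).symm) y (chartField q₀ u y) =
      dirDeriv h ((extChartAt 𝓘(𝕜, E) q₀).symm y) (u ((extChartAt 𝓘(𝕜, E) q₀).symm y)) := by
  have h1 := modelDeriv_comp (hh _) (mdifferentiableAt_extChartAt_symm' hy)
  have h2 : modelDeriv 𝕜 E 𝕜 (h ∘ (extChartAt 𝓘(𝕜, E) q₀).symm) y =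
      fderiv 𝕜 (h ∘ (extChartAt 𝓘(𝕜, E) q₀).symm) y := mfderiv_eq_fderiv
  rw [← h2, h1]
  exact congrArg (modelDeriv 𝕜 E 𝕜 h ((extChartAt 𝓘(𝕜, E) q₀).symm y))
    ((isInvertible_modelDeriv_extChartAt_symm hy).self_apply_inverse _)

/-- In the chart at q the second derivatives of h cancel by symmetry, which leaves dh applied to
Dv(u) − Du(v), the bracket of the coordinate fields. -/
theorem dirDeriv_mlieBracket [IsManifold 𝓘(𝕜, E) n M] [CompleteSpace E] (hn : n = ∞ ∨ n = ω)
    {h : M → 𝕜} (hh : ContMDiff 𝓘(𝕜, E) 𝓘(𝕜, 𝕜) n h) {u v : ∀ q : M, TangentSpace 𝓘(𝕜, E) q}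
    {q : M} (hu : ContMDiffAt 𝓘(𝕜, E) 𝓘(𝕜, E).tangent n
      (fun x => (⟨x, u x⟩ : TangentBundle 𝓘(𝕜, E) M)) q)
    (hv : ContMDiffAt 𝓘(𝕜, E) 𝓘(𝕜, E).tangent n
      (fun x => (⟨x, v x⟩ : TangentBundle 𝓘(𝕜, E) M)) q) :
    dirDeriv h q (VectorField.mlieBracket 𝓘(𝕜, E) u v q) =
      dirDeriv (fun x => dirDeriv h x (v x)) q (u q)
        - dirDeriv (fun x => dirDeriv h x (u x)) q (v q) := by
  have hn2 : (2 : ℕ∞ω) ≤ n := by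
    rcases hn with rfl | rfl
    · exact WithTop.coe_le_coe.2 le_top
    · exact le_top
  have : IsManifold 𝓘(𝕜, E) 2 M := IsManifold.of_le hn2
  let φ := extChartAt 𝓘(𝕜, E) q
  have hn0 := ne_zero_of_smooth hn
  have hhm := hh.mdifferentiable hn0
  have hy₀ : φ q ∈ φ.target := mem_extChartAt_target (I := 𝓘(𝕜, E)) q
  have hĥ : ContDiffAt 𝕜 2 (h ∘ φ.symm) (φ q) := by
    rw [← contMDiffAt_iff_contDiffAt]
    exact (hh.of_le hn2).contMDiffAt.comp _
      ((contMDiffOn_extChartAt_symm (I := 𝓘(𝕜, E)) q).contMDiffAt (extChartAt_target_mem_nhds q))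
  have hsymm : IsSymmSndFDerivAt 𝕜 (h ∘ φ.symm) (φ q) := hĥ.isSymmSndFDerivAt (by simp)
  have hD : DifferentiableAt 𝕜 (fderiv 𝕜 (h ∘ φ.symm)) (φ q) :=
    (hĥ.fderiv_right (m := 1) (by norm_num)).differentiableAt one_ne_zero
  have hfield : ∀ {w : ∀ q : M, TangentSpace 𝓘(𝕜, E) q},
      ContMDiffAt 𝓘(𝕜, E) 𝓘(𝕜, E).tangent n
        (fun x => (⟨x, w x⟩ : TangentBundle 𝓘(𝕜, E) M)) q →
      DifferentiableAt 𝕜 (chartField q w) (φ q) := by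
    intro w hw
    have h1 := (hw.mdifferentiableAt hn0).mdifferentiableWithinAt
      (s := Set.univ)|>.differentiableWithinAt_mpullbackWithin_vectorField
    rw [mpullbackWithin_extChartAt_symm] at h1
    simp only [modelWithCornersSelf_coe, Set.range_id, Set.preimage_univ, Set.inter_self,
      differentiableWithinAt_univ] at h1
    exact h1
  have hsecond : ∀ {w : ∀ q : M, TangentSpace 𝓘(𝕜, E) q},
      ContMDiffAt 𝓘(𝕜, E) 𝓘(𝕜, E).tangent n
        (fun x => (⟨x, w x⟩ : TangentBundle 𝓘(𝕜, E) M)) q → ∀ z : E,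
      dirDeriv (fun x => dirDeriv h x (w x)) q z =
        fderiv 𝕜 (h ∘ φ.symm) (φ q) (fderiv 𝕜 (chartField q w) (φ q) z) +
          fderiv 𝕜 (fderiv 𝕜 (h ∘ φ.symm)) (φ q) z (w q : E) := by
    intro w hw z
    refine (dirDeriv_eq_fderiv ((contMDiffAt_dirDeriv hn hh hw).mdifferentiableAt hn0) _).trans ?_
    have h1 : (fun x => dirDeriv h x (w x)) ∘ φ.symm =ᶠ[𝓝 (φ q)]
        fun y => fderiv 𝕜 (h ∘ φ.symm) y (chartField q w y) := by
      filter_upwards [extChartAt_target_mem_nhds (I := 𝓘(𝕜, E)) q] with y hy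
      exact (fderiv_chartField hhm w hy).symm
    have h2 := h1.fderiv_eq.trans (fderiv_clm_apply hD (hfield hw))
    refine (congrArg (fun L : E →L[𝕜] 𝕜 => L z) h2).trans ?_
    exact congrArg (fun b : E => fderiv 𝕜 (h ∘ φ.symm) (φ q) (fderiv 𝕜 (chartField q w) (φ q) z) +
      fderiv 𝕜 (fderiv 𝕜 (h ∘ φ.symm)) (φ q) z b) (chartField_self q w)
  have hbr : (VectorField.mlieBracket 𝓘(𝕜, E) u v q : E) =
      fderiv 𝕜 (chartField q v) (φ q) (u q : E) -
        fderiv 𝕜 (chartField q u) (φ q) (v q : E) := by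
    have hu' : chartField q u (φ q) = (u q : E) := chartField_self q u
    have hv' : chartField q v (φ q) = (v q : E) := chartField_self q v
    have h1 : (modelDeriv 𝕜 E E (extChartAt 𝓘(𝕜, E) q) q).inverse =
        ContinuousLinearMap.id 𝕜 E := by
      rw [modelDeriv_extChartAt, ContinuousLinearMap.inverse_id]
    have h2 : VectorField.lieBracketWithin 𝕜
        (VectorField.mpullbackWithin 𝓘(𝕜, E) 𝓘(𝕜, E) (extChartAt 𝓘(𝕜, E) q).symm u
          (Set.range 𝓘(𝕜, E)))
        (VectorField.mpullbackWithin 𝓘(𝕜, E) 𝓘(𝕜, E) (extChartAt 𝓘(𝕜, E) q).symm v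
          (Set.range 𝓘(𝕜, E)))
        ((extChartAt 𝓘(𝕜, E) q).symm ⁻¹' Set.univ ∩ Set.range 𝓘(𝕜, E)) (φ q) =
        fderiv 𝕜 (chartField q v) (φ q) (chartField q u (φ q)) -
          fderiv 𝕜 (chartField q u) (φ q) (chartField q v (φ q)) := by
      rw [mpullbackWithin_extChartAt_symm, mpullbackWithin_extChartAt_symm]
      simp only [modelWithCornersSelf_coe, Set.range_id, Set.preimage_univ, Set.inter_self]
      rw [VectorField.lieBracketWithin_univ]
      rfl
    rw [hu', hv'] at h2
    refine Eq.trans (congrArg (fun L : E →L[𝕜] E => L _) h1) ?_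
    exact h2
  have key : ∀ (D : E →L[𝕜] 𝕜) (D₂ : E →L[𝕜] E →L[𝕜] 𝕜) (P Q : E →L[𝕜] E) (x y z : E),
      z = P x - Q y → D₂ x y = D₂ y x → D z = (D (P x) + D₂ x y) - (D (Q y) + D₂ y x) := by
    intro D D₂ P Q x y z hz hxy
    rw [hz, hxy, map_sub, add_sub_add_right_eq_sub]
  refine (dirDeriv_eq_fderiv (hhm q) _).trans (Eq.trans ?_
    (congrArg₂ (· - ·) (hsecond hv (u q)) (hsecond hu (v q))).symm)
  exact key _ _ _ _ _ _ _ hbr (hsymm _ _)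

end LieBracket

end QuasiHam

end

/-! ### The theorem for smooth and analytic manifolds -/

noncomputable section

namespace QuasiHam

section DirDeriv

variable {𝕜 : Type*} [RCLike 𝕜]
  {E : Type*} [NormedAddCommGroup E] [NormedSpace 𝕜 E]
  {M : Type*} [TopologicalSpace M] [ChartedSpace E M]

theorem dirDeriv_add_left {f g : M → 𝕜} {q : M} (hf : MDifferentiableAt 𝓘(𝕜, E) 𝓘(𝕜, 𝕜) f q)
    (hg : MDifferentiableAt 𝓘(𝕜, E) 𝓘(𝕜, 𝕜) g q) (v : TangentSpace 𝓘(𝕜, E) q) :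
    dirDeriv (f + g) q v = dirDeriv f q v + dirDeriv g q v :=
  congrArg (fun L : E →L[𝕜] 𝕜 => L v) (mfderiv_add hf hg)

theorem dirDeriv_smul_left {f : M → 𝕜} {q : M} (hf : MDifferentiableAt 𝓘(𝕜, E) 𝓘(𝕜, 𝕜) f q)
    (c : 𝕜) (v : TangentSpace 𝓘(𝕜, E) q) : dirDeriv (c • f) q v = c * dirDeriv f q v :=
  congrArg (fun L : E →L[𝕜] 𝕜 => L v) (const_smul_mfderiv hf c)

theorem dirDeriv_neg_left {f : M → 𝕜} {q : M} (v : TangentSpace 𝓘(𝕜, E) q) :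
    dirDeriv (fun x => -f x) q v = -dirDeriv f q v :=
  congrArg (fun L : E →L[𝕜] 𝕜 => L v) mfderiv_neg

theorem dirDeriv_mul_left {f g : M → 𝕜} {q : M} (hf : MDifferentiableAt 𝓘(𝕜, E) 𝓘(𝕜, 𝕜) f q)
    (hg : MDifferentiableAt 𝓘(𝕜, E) 𝓘(𝕜, 𝕜) g q) (v : TangentSpace 𝓘(𝕜, E) q) :
    dirDeriv (f * g) q v = f q * dirDeriv g q v + g q * dirDeriv f q v :=
  congrArg (fun L : E →L[𝕜] 𝕜 => L v) (hf.hasMFDerivAt.mul hg.hasMFDerivAt).mfderiv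

theorem dirDeriv_add_right (f : M → 𝕜) {q : M} (v w : TangentSpace 𝓘(𝕜, E) q) :
    dirDeriv f q (v + w) = dirDeriv f q v + dirDeriv f q w :=
  (modelDeriv 𝕜 E 𝕜 f q).map_add v w

theorem dirDeriv_smul_right (f : M → 𝕜) {q : M} (c : 𝕜) (v : TangentSpace 𝓘(𝕜, E) q) :
    dirDeriv f q (c • v) = c * dirDeriv f q v :=
  (modelDeriv 𝕜 E 𝕜 f q).map_smul c v

end DirDeriv

namespace QuasiHamiltonian

variable {𝕜 : Type*} [RCLike 𝕜] {n : ℕ∞ω}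
  {V : Type*} [NormedAddCommGroup V] [NormedSpace 𝕜 V]
  {G : Type*} [TopologicalSpace G] [ChartedSpace V G] [Group G]
  {E : Type*} [NormedAddCommGroup E] [NormedSpace 𝕜 E]
  {M : Type*} [TopologicalSpace M] [ChartedSpace E M] [IsManifold 𝓘(𝕜, E) 1 M]
  [MulAction G M] {B : LinearMap.BilinForm 𝕜 (GroupLieAlgebra 𝓘(𝕜, V) G)}
  {S : QuasiHamiltonian (E := E) (M := M) n B} {f g h : M → 𝕜}
  {X Y Z : ∀ q : M, TangentSpace 𝓘(𝕜, E) q}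

theorem IsHamiltonianField.unique (hX : S.IsHamiltonianField f X) (hY : S.IsHamiltonianField f Y) :
    X = Y :=
  funext fun q => S.hamiltonianVector_unique
    (fun w => (hX.flat_eq q w).trans (hY.flat_eq q w).symm) (hX.map_eq_zero q) (hY.map_eq_zero q)

theorem IsHamiltonianField.dirDeriv_swap (hX : S.IsHamiltonianField f X)
    (hY : S.IsHamiltonianField g Y) (q : M) : dirDeriv g q (X q) = -dirDeriv f q (Y q) := by
  rw [← hX.flat_eq, S.skew, hY.flat_eq, neg_neg]

/-- The computation is the one made over coordinate rings: dσ(X, Y, Z) equals the cyclic sum, once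
`dirDeriv_mlieBracket` rewrites the brackets as commutators. -/
theorem jacobi_of_isHamiltonianField [IsManifold 𝓘(𝕜, E) n M] [CompleteSpace E]
    (hn : n = ∞ ∨ n = ω) (hf : ContMDiff 𝓘(𝕜, E) 𝓘(𝕜, 𝕜) n f)
    (hg : ContMDiff 𝓘(𝕜, E) 𝓘(𝕜, 𝕜) n g) (hh : ContMDiff 𝓘(𝕜, E) 𝓘(𝕜, 𝕜) n h)
    (hX : S.IsHamiltonianField f X) (hY : S.IsHamiltonianField g Y)
    (hZ : S.IsHamiltonianField h Z) (q : M) :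
    dirDeriv (fun x => dirDeriv h x (Y x)) q (X q) +
      dirDeriv (fun x => dirDeriv f x (Z x)) q (Y q) +
      dirDeriv (fun x => dirDeriv g x (X x)) q (Z q) = 0 := by
  have h1 := S.quasiClosed q X Y Z (hX.contMDiff q) (hY.contMDiff q) (hZ.contMDiff q)
  have h0 : maurerCartanLeft (𝕜 := 𝕜) (V := V) (S.Φ q) 0 = 0 :=
    (maurerCartanLeftₗ (𝕜 := 𝕜) (V := V) (S.Φ q)).map_zero
  rw [hX.map_eq_zero, hY.map_eq_zero, hZ.map_eq_zero, h0] at h1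
  have hYZ : (fun x => dirDeriv g x (Z x)) = fun x => -dirDeriv h x (Y x) :=
    funext fun x => hZ.dirDeriv_swap hY x
  have hXZ : (fun x => dirDeriv h x (X x)) = fun x => -dirDeriv f x (Z x) :=
    funext fun x => hX.dirDeriv_swap hZ x
  have hXY : (fun x => dirDeriv f x (Y x)) = fun x => -dirDeriv g x (X x) :=
    funext fun x => hY.dirDeriv_swap hX x
  simp only [cartanForm, map_zero, add_zero, smul_zero, extDerivTwoForm, hX.flat_eq,
    hY.flat_eq] at h1
  rw [S.skew q _ (Z q), S.skew q _ (Y q), S.skew q _ (X q), hX.flat_eq, hY.flat_eq, hZ.flat_eq,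
    dirDeriv_mlieBracket hn hh (hX.contMDiff q) (hY.contMDiff q),
    dirDeriv_mlieBracket hn hg (hX.contMDiff q) (hZ.contMDiff q),
    dirDeriv_mlieBracket hn hf (hY.contMDiff q) (hZ.contMDiff q), hYZ, hXZ, hXY,
    dirDeriv_neg_left, dirDeriv_neg_left, dirDeriv_neg_left] at h1
  linear_combination h1

variable [LieGroup 𝓘(𝕜, V) n G] [ContMDiffSMul 𝓘(𝕜, V) 𝓘(𝕜, E) n G M]

/-- The translate of X q satisfies at g • q the equations that define X (g • q), since σ, f and Φ
are compatible with the action. -/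
theorem IsHamiltonianField.smul_eq (hX : S.IsHamiltonianField f X) (hn : n ≠ 0)
    (hf : MDifferentiable 𝓘(𝕜, E) 𝓘(𝕜, 𝕜) f) (hf' : ∀ (g : G) q, f (g • q) = f q) (g : G) (q : M) :
    (X (g • q) : E) = modelDeriv 𝕜 E E (fun x : M => g • x) q (X q) := by
  have hs : ∀ g : G, MDifferentiable 𝓘(𝕜, E) 𝓘(𝕜, E) (fun x : M => g • x) :=
    mdifferentiable_const_smul (V := V) hn
  have hΦ : MDifferentiable 𝓘(𝕜, E) 𝓘(𝕜, V) S.Φ := S.contMDiff_Φ.mdifferentiable hn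
  refine S.hamiltonianVector_unique (fun w => ?_) (hX.map_eq_zero _) ?_
  · rw [hX.flat_eq]
    have h1 := modelDeriv_comp (hs g (g⁻¹ • g • q)) (hs g⁻¹ (g • q))
    have h2 : (fun x : M => g • x) ∘ (fun x : M => g⁻¹ • x) = id := by
      ext x; simp
    rw [h2, modelDeriv_id, inv_smul_smul] at h1
    have h3 := modelDeriv_comp (hf (g⁻¹ • g • q)) (hs g⁻¹ (g • q))
    have h4 : f ∘ (fun x : M => g⁻¹ • x) = f := funext fun x => hf' _ x
    rw [h4, inv_smul_smul] at h3
    let w' : TangentSpace 𝓘(𝕜, E) q := modelDeriv 𝕜 E E (fun x : M => g⁻¹ • x) (g • q) w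
    have h5 : w = mfderiv 𝓘(𝕜, E) 𝓘(𝕜, E) (fun x : M => g • x) q w' :=
      congrArg (fun L : E →L[𝕜] E => L w) h1
    have h6 := S.invariant g q (X q) w'
    rw [← h5, hX.flat_eq] at h6
    refine Eq.trans ?_ h6.symm
    exact congrArg (fun L : E →L[𝕜] 𝕜 => L w) h3
  · have hc : MDifferentiable 𝓘(𝕜, V) 𝓘(𝕜, V) (fun x : G => g * x * g⁻¹) :=
      mdifferentiable_conj (n := n) hn g
    have h1 := modelDeriv_comp (hΦ (g • q)) (hs g q)
    have h2 := modelDeriv_comp (hc (S.Φ q)) (hΦ q)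
    have h3 : S.Φ ∘ (fun x : M => g • x) = (fun x : G => g * x * g⁻¹) ∘ S.Φ :=
      funext fun x => S.equivariant g x
    rw [h3, h2] at h1
    have h4 := congrArg (fun L : E →L[𝕜] V => L (X q)) h1
    have h5 : modelDeriv 𝕜 E V S.Φ q (X q : E) = 0 := hX.map_eq_zero q
    refine h4.symm.trans ?_
    refine (congrArg (modelDeriv 𝕜 V V (fun x : G => g * x * g⁻¹) (S.Φ q)) h5).trans ?_
    exact map_zero _

theorem IsHamiltonianField.dirDeriv_smul_eq (hX : S.IsHamiltonianField f X) (hn : n ≠ 0)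
    (hf : MDifferentiable 𝓘(𝕜, E) 𝓘(𝕜, 𝕜) f) (hf' : ∀ (g : G) q, f (g • q) = f q)
    (hh : MDifferentiable 𝓘(𝕜, E) 𝓘(𝕜, 𝕜) h) (hh' : ∀ (g : G) q, h (g • q) = h q) (g : G) (q : M) :
    dirDeriv h (g • q) (X (g • q)) = dirDeriv h q (X q) := by
  have h1 := modelDeriv_comp (hh (g • q)) (mdifferentiable_const_smul (V := V) hn g q)
  have h2 : h ∘ (fun x : M => g • x) = h := funext fun x => hh' g x
  rw [h2] at h1
  refine (congrArg (modelDeriv 𝕜 E 𝕜 h (g • q)) (hX.smul_eq hn hf hf' g q)).trans ?_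
  exact (congrArg (fun L : E →L[𝕜] 𝕜 => L (X q)) h1).symm

theorem exists_isHamiltonianField (S : QuasiHamiltonian (E := E) (M := M) n B)
    [FiniteDimensional 𝕜 V] [FiniteDimensional 𝕜 E] [IsManifold 𝓘(𝕜, E) n M]
    (hn : n = ∞ ∨ n = ω) (hB : B.IsSymm) (hB0 : B.Nondegenerate) (hAd : IsAdInvariant B)
    (hf : ContMDiff 𝓘(𝕜, E) 𝓘(𝕜, 𝕜) n f) (hf' : ∀ (g : G) q, f (g • q) = f q) :
    ∃ X, S.IsHamiltonianField f X := by
  choose X hX hX' using S.exists_hamiltonianVector (ne_zero_of_smooth hn) hB hB0 hAd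
    (hf.mdifferentiable (ne_zero_of_smooth hn)) hf'
  exact ⟨X, S.contMDiff_of_isHamiltonian hn hf hX hX', hX, hX'⟩

theorem exists_poisson (S : QuasiHamiltonian (E := E) (M := M) n B)
    [FiniteDimensional 𝕜 V] [FiniteDimensional 𝕜 E] [IsManifold 𝓘(𝕜, E) n M]
    (hn : n = ∞ ∨ n = ω) (hB : B.IsSymm) (hB0 : B.Nondegenerate) (hAd : IsAdInvariant B) :
    ∃ X : invariantFunctions 𝕜 E G M n → ∀ q : M, TangentSpace 𝓘(𝕜, E) q,
      (∀ f Y, S.IsHamiltonianField f.1 Y ↔ Y = X f) ∧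
      ∃ br : invariantFunctions 𝕜 E G M n →ₗ[𝕜]
          invariantFunctions 𝕜 E G M n →ₗ[𝕜] invariantFunctions 𝕜 E G M n,
        IsPoissonBracket br ∧
        ∀ f h (q : M), (br f h).1 q = dirDeriv h.1 q (X f q) ∧
          (br f h).1 q = S.σ q (X h q) (X f q) := by
  have : CompleteSpace E := FiniteDimensional.complete 𝕜 E
  have hn0 := ne_zero_of_smooth hn
  choose X hX using fun f : invariantFunctions 𝕜 E G M n =>
    S.exists_isHamiltonianField hn hB hB0 hAd f.1.contMDiff f.2
  have hd : ∀ f : invariantFunctions 𝕜 E G M n, MDifferentiable 𝓘(𝕜, E) 𝓘(𝕜, 𝕜) f.1 :=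
    fun f => f.1.contMDiff.mdifferentiable hn0
  have hadd : ∀ f g q, X (f + g) q = X f q + X g q := fun f g q =>
    S.hamiltonianVector_unique
      (fun w => by
        rw [(hX _).flat_eq, map_add, _root_.add_apply, (hX f).flat_eq, (hX g).flat_eq]
        exact dirDeriv_add_left (hd f q) (hd g q) w)
      ((hX _).map_eq_zero q)
      (by rw [map_add, (hX f).map_eq_zero, (hX g).map_eq_zero, add_zero])
  have hsmul : ∀ (c : 𝕜) f q, X (c • f) q = c • X f q := fun c f q =>
    S.hamiltonianVector_unique
      (fun w => by
        rw [(hX _).flat_eq, map_smul, _root_.smul_apply, (hX f).flat_eq]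
        exact dirDeriv_smul_left (hd f q) c w)
      ((hX _).map_eq_zero q)
      (by rw [map_smul, (hX f).map_eq_zero, smul_zero])
  have hext : ∀ {a b : invariantFunctions 𝕜 E G M n}, (∀ q, a.1 q = b.1 q) → a = b :=
    fun hab => Subtype.ext (ContMDiffMap.ext hab)
  let br : invariantFunctions 𝕜 E G M n →ₗ[𝕜] invariantFunctions 𝕜 E G M n →ₗ[𝕜]
      invariantFunctions 𝕜 E G M n :=
    LinearMap.mk₂ 𝕜
      (fun f h => ⟨⟨fun q => dirDeriv h.1 q (X f q), fun q =>
          contMDiffAt_dirDeriv hn h.1.contMDiff ((hX f).contMDiff q)⟩,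
        fun g q => (hX f).dirDeriv_smul_eq hn0 (hd f) f.2 (hd h) h.2 g q⟩)
      (fun f g h => hext fun q =>
        (congrArg (dirDeriv h.1 q) (hadd f g q)).trans (dirDeriv_add_right _ _ _))
      (fun c f h => hext fun q =>
        (congrArg (dirDeriv h.1 q) (hsmul c f q)).trans (dirDeriv_smul_right _ _ _))
      (fun f g h => hext fun q => dirDeriv_add_left (hd g q) (hd h q) _)
      (fun c f h => hext fun q => dirDeriv_smul_left (hd h q) c _)
  have hbr : ∀ f h (q : M), (br f h).1 q = dirDeriv h.1 q (X f q) := fun _ _ _ => rfl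
  have hbr' : ∀ f h (q : M), (br f h).1 q = S.σ q (X h q) (X f q) :=
    fun f h q => ((hX h).flat_eq q _).symm
  refine ⟨X, fun f Y => ⟨fun hY => hY.unique (hX f), fun hY => hY ▸ hX f⟩, br,
    ⟨fun f => ?_, fun f g h => ?_, fun f g h => ?_⟩, fun f h q => ⟨hbr f h q, hbr' f h q⟩⟩
  · exact hext fun q => (hbr' f f q).trans (S.alternating q _)
  · refine hext fun q => ?_
    refine (dirDeriv_mul_left (hd g q) (hd h q) (X f q)).trans ?_
    change _ = dirDeriv g.1 q (X f q) * h.1 q + g.1 q * dirDeriv h.1 q (X f q)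
    ring
  -- The iterated derivatives above have the inner bracket in the second slot; skew symmetry moves
  -- it there.
  · have hs : ∀ u v, br u v = -br v u := fun u v => hext fun q =>
      (hbr' u v q).trans ((S.skew q _ _).trans (congrArg Neg.neg (hbr' v u q).symm))
    rw [hs (br f g) h, hs (br g h) f, hs (br h f) g]
    refine hext fun q => ?_
    have := jacobi_of_isHamiltonianField hn f.1.contMDiff g.1.contMDiff h.1.contMDiff
      (hX f) (hX g) (hX h) q
    change -dirDeriv (fun x => dirDeriv g.1 x (X f x)) q (X h q) +
      -dirDeriv (fun x => dirDeriv h.1 x (X g x)) q (X f q) +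
      -dirDeriv (fun x => dirDeriv f.1 x (X h x)) q (X g q) = 0
    linear_combination -this

end QuasiHamiltonian

end QuasiHam

end

/-! ### The settings combined -/

theorem theorem4 :
    -- smooth, real analytic and complex analytic manifolds
    (∀ (𝕜 : Type*) [RCLike 𝕜] (n : ℕ∞ω) (_ : n = ∞ ∨ n = ω)
      (V : Type*) [NormedAddCommGroup V] [NormedSpace 𝕜 V] [FiniteDimensional 𝕜 V]
      (G : Type*) [TopologicalSpace G] [ChartedSpace V G] [Group G] [LieGroup 𝓘(𝕜, V) n G]
      (E : Type*) [NormedAddCommGroup E] [NormedSpace 𝕜 E] [FiniteDimensional 𝕜 E]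
      (M : Type*) [TopologicalSpace M] [ChartedSpace E M] [IsManifold 𝓘(𝕜, E) ∞ M]
      [IsManifold 𝓘(𝕜, E) n M] [MulAction G M] [ContMDiffSMul 𝓘(𝕜, V) 𝓘(𝕜, E) n G M]
      (B : LinearMap.BilinForm 𝕜 (GroupLieAlgebra 𝓘(𝕜, V) G)) (_ : B.IsSymm)
      (_ : B.Nondegenerate) (_ : QuasiHam.IsAdInvariant B)
      (S : QuasiHam.QuasiHamiltonian (E := E) (M := M) n B),
      ∃ X : QuasiHam.invariantFunctions 𝕜 E G M n → ∀ q : M, TangentSpace 𝓘(𝕜, E) q,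
        (∀ f Y, S.IsHamiltonianField f.1 Y ↔ Y = X f) ∧
        ∃ br : QuasiHam.invariantFunctions 𝕜 E G M n →ₗ[𝕜]
            QuasiHam.invariantFunctions 𝕜 E G M n →ₗ[𝕜] QuasiHam.invariantFunctions 𝕜 E G M n,
          QuasiHam.IsPoissonBracket br ∧
          ∀ f h (q : M), (br f h).1 q = QuasiHam.dirDeriv h.1 q (X f q) ∧
            (br f h).1 q = S.σ q (X h q) (X f q)) ∧
    -- affine algebraic manifolds
    (∀ (K : Type*) [Field K] [CharZero K]
      (H : Type*) [CommRing H] [HopfAlgebra K H] [Algebra.FiniteType K H]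
      (A : Type*) [CommRing A] [Algebra K A] [Algebra.Smooth K A]
      (act : QuasiHam.GroupAction K H A)
      (B : LinearMap.BilinForm K (QuasiHam.leftInvariant K H)) (_ : B.IsSymm)
      (_ : B.Nondegenerate) (_ : QuasiHam.IsAdInvariantAlg B)
      (S : QuasiHam.QuasiHamiltonianAlg act B),
      ∃ X : act.invariants → Derivation K A A,
        (∀ f Y, S.IsHamiltonianField f.1 Y ↔ Y = X f) ∧
        ∃ br : act.invariants →ₗ[K] act.invariants →ₗ[K] act.invariants,
          QuasiHam.IsPoissonBracket br ∧
          ∀ f h, (br f h).1 = X f h.1 ∧ (br f h).1 = S.σ (X h) (X f)) := by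
  refine ⟨?_, ?_⟩
  · intro 𝕜 _ n hn V _ _ _ G _ _ _ _ E _ _ _ M _ _ _ _ _ _ B hB hB0 hAd S
    exact S.exists_poisson hn hB hB0 hAd
  · intro K _ _ H _ _ _ A _ _ _ act B hB hB0 hAd S
    exact S.exists_poisson hB hB0 hAd
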